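/- **Setting.** Let $0<a\le 1$, $r_+=1+\sqrt{1-a^2}$, and consider the exterior $r>r_+$ of the Kerr black hole of unit mass with metric, in Boyer–Lindquist coordinates $(t,r,\theta,\varphi)$, $$ds^2=-\frac{\rho^2\Delta}{A}dt^2+\frac{A}{\rho^2}\sin^2\theta\,(d\varphi-\omega\,dt)^2+\rho^2\Big(\frac{dr^2}{\Delta}+d\theta^2\Big),$$ $\rho^2=r^2+a^2\cos^2\theta$, $\Delta(r)=r^2-2r+a^2$, $A=(r^2+a^2)^2-a^2\Delta\sin^2\theta$, $\omega=2ra/A$. Light beams are the solutions of Hamilton's equations with $H=\frac12 g^{ij}p_ip_j$ issuing from null vectors (those with $p_\varphi=0$ are continued through the symmetry axis). Fix $r_0>r_+$, $\theta_0\in(0,\pi)$, let $\rho_0,A_0,\omega_0$ be the values of $\rho,A,\omega$ at $(r_0,\theta_0)$, and let $\Omega\in(\Omega_-,\Omega_+)$, $\Omega_\pm=\dfrac{1}{r_0^2+a^2\pm a\sqrt{\Delta(r_0)}\sin\theta_0}\Big(a\pm\dfrac{\sqrt{\Delta(r_0)}}{\sin\theta_0}\Big)$. The stationary observer $r=r_0$,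 $\theta=\theta_0$, $\varphi=\Omega t+\varphi_0$ has $u_0=\rho_0\big(\Delta(r_0)-a^2\sin^2\theta_0+\Omega(4ar_0-A_0\Omega)\sin^2\theta_0\big)^{-1/2}$ and the orthonormal tetrad $$e_{(t)}=u_0(\partial_t+\Omega\partial_\varphi),\quad e_{(r)}=-\tfrac{\sqrt{\Delta(r_0)}}{\rho_0}\partial_r,\quad e_{(\theta)}=-\tfrac1{\rho_0}\partial_\theta,$$ $$e_{(\varphi)}=\tfrac{u_0}{\sin\theta_0\sqrt{\Delta(r_0)}}\Big[\tfrac{A_0\sin^2\theta_0}{\rho_0^2}(\Omega-\omega_0)\partial_t+\Big(1-2r_0\tfrac{1-a\Omega\sin^2\theta_0}{\rho_0^2}\Big)\partial_\varphi\Big].$$ To a unit vector $N=(N_1,N_2,N_3)=(\sin\alpha\cos\beta,\sin\alpha\sin\beta,\cos\alpha)$ of the celestial sphere $\mathcal S_N$ (the unit sphere) one assigns the light beam that starts at an event of the observer's worldline with tangent vector $w=W(-e_{(t)}+N_1e_{(\theta)}+N_2e_{(\varphi)}+N_3e_{(r)})$, $W>0$ (backward tracing). The *shadow* is the set of those $N\in\mathcal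 S_N$ whose beam evolves onto the event horizon, i.e. $r\to r_+$ at the end of its interval of existence in $r>r_+$. For $r_c>r_+$ put $$\lambda(r_c)=\frac{(1+r_c)a^2+r_c^2(r_c-3)}{a(1-r_c)},\quad \eta(r_c)=r_c^3\,\frac{4a^2-r_c(r_c-3)^2}{a^2(r_c-1)^2},\quad Z=\frac{2\sqrt{r_c}}{1-r_c}\big(3r_c-(a^2+3r_c^2)+r_c^3\big)^{1/2},$$ $$\Theta_*(r_c)=\eta(r_c)+\cos^2\theta_0\Big(a^2-\frac{\lambda^2(r_c)}{\sin^2\theta_0}\Big),\qquad B_\alpha(r_c)=\arccos\frac{|r_0-r_c|\sqrt{r_0^2+2r_cr_0-3r_c^2+Z^2}}{\rho_0u_0(1-\lambda(r_c)\Omega)\sqrt{\Delta(r_0)}},$$ $$B_\beta(r_c)=\arctan\frac{u_0\big(\rho_0^2(\lambda(r_c)-\Omega(r_0^2+a^2)\sin^2\theta_0)+2r_0(1-a\Omega\sin^2\theta_0)(a\sin^2\theta_0-\lambda(r_c))\big)}{\rho_0\sin\theta_0\sqrt{\Delta(r_0)}\sqrt{\Theta_*(r_c)}},$$ where, if $\Theta_*(r_c)=0$,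 the arctangent is read as $\pm\pi/2$ according to the sign of the numerator (and as $0$ if the numerator vanishes too; then $\sin B_\alpha=0$). Let $r_{1}=2+2\cos(\frac23\arccos(-a))$, $r_2=2+2\cos(\frac23\arccos a)$. **Statement.** If $a<1$, then $\Theta_*$ has two zeros in $(r_+,\infty)$. Whenever $\Theta_*$ has two zeros $r_1^*<r_2^*$ in $(r_+,\infty)$ (for $a=1$ this is a condition on $\theta_0$), these are its only zeros there, $r_1\le r_1^*<r_2^*\le r_2$, and the boundary of the shadow in $\mathcal S_N$ is the following curve $\mathcal C$: 1. if $r_0>r_2^*$, then $$\mathcal C=\{\alpha=B_\alpha(r_c),\ \beta=\pi+B_\beta(r_c)\}\cup\{\alpha=B_\alpha(r_c),\ \beta=2\pi-B_\beta(r_c)\},\qquad r_c\in[r_1^*,r_2^*];\tag{I}$$ 2. if $r_0<r_1^*$, then $$\mathcal C=\{\alpha=\pi-B_\alpha(r_c),\ \beta=\pi+B_\beta(r_c)\}\cup\{\alpha=\pi-B_\alpha(r_c),\ \beta=2\pi-B_\beta(r_c)\},\qquad r_c\in[r_1^*,r_2^*];\tag{II}$$ 3. if $r_1^*\le r_0\le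 r_2^*$, then $\mathcal C$ is the union of the curve (I) taken over $r_c\in[r_1^*,r_0]$ and the curve (II) taken over $r_c\in(r_0,r_2^*]$. -/

import Mathlib

open Real Set Filter Topology

noncomputable section

namespace KerrShadow

/-! ### The Kerr metric in Boyer-Lindquist coordinates

Units are chosen so that the mass is `1`; `a` is the spin parameter. Coordinates are indexed by
`Fin 4` in the order `(t, r, θ, φ)`, and the signature is `(-, +, +, +)`. -/

/-- `ρ² = r² + a² cos² θ`. -/
def rhoSq (a r θ : ℝ) : ℝ := r ^ 2 + a ^ 2 * cos θ ^ 2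

/-- `Δ(r) = r² - 2 r + a²`. -/
def kerrDelta (a r : ℝ) : ℝ := r ^ 2 - 2 * r + a ^ 2

/-- `A = (r² + a²)² - a² Δ(r) sin² θ`. -/
def kerrA (a r θ : ℝ) : ℝ := (r ^ 2 + a ^ 2) ^ 2 - a ^ 2 * kerrDelta a r * sin θ ^ 2

/-- The frame-dragging angular velocity `ω = 2 r a / A`. -/
def kerrOmega (a r θ : ℝ) : ℝ := 2 * r * a / kerrA a r θ

/-- The radius of the event horizon, the larger root of `Δ`. -/
def rPlus (a : ℝ) : ℝ := 1 + √(1 - a ^ 2)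

/-- The matrix `g_ij` of the line element
`-(ρ² Δ / A) dt² + (A / ρ²) sin² θ (dφ - ω dt)² + ρ² (dr² / Δ + dθ²)`. -/
def metric (a : ℝ) (x : Fin 4 → ℝ) : Matrix (Fin 4) (Fin 4) ℝ :=
  let r := x 1
  let θ := x 2
  let B := kerrA a r θ / rhoSq a r θ * sin θ ^ 2
  let ω := kerrOmega a r θ
  !![-(rhoSq a r θ * kerrDelta a r / kerrA a r θ) + B * ω ^ 2, 0, 0, -(B * ω);
     0, rhoSq a r θ / kerrDelta a r, 0, 0;
     0, 0, rhoSq a r θ, 0;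
     -(B * ω), 0, 0, B]

/-- The matrix `g^ij` inverse to `metric` (see `metric_mul_cometric`). -/
def cometric (a : ℝ) (x : Fin 4 → ℝ) : Matrix (Fin 4) (Fin 4) ℝ :=
  let r := x 1
  let θ := x 2
  let gtφ := -(2 * a * r / (rhoSq a r θ * kerrDelta a r))
  !![-(kerrA a r θ / (rhoSq a r θ * kerrDelta a r)), 0, 0, gtφ;
     0, kerrDelta a r / rhoSq a r θ, 0, 0;
     0, 0, 1 / rhoSq a r θ, 0;
     gtφ, 0, 0, (1 / sin θ ^ 2 - a ^ 2 / kerrDelta a r) / rhoSq a r θ]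

theorem metric_mul_cometric (a : ℝ) (x : Fin 4 → ℝ) (hρ : rhoSq a (x 1) (x 2) ≠ 0)
    (hΔ : kerrDelta a (x 1) ≠ 0) (hA : kerrA a (x 1) (x 2) ≠ 0) (hs : sin (x 2) ≠ 0) :
    metric a x * cometric a x = 1 := by
  have hc : cos (x 2) ^ 2 = 1 - sin (x 2) ^ 2 := by
    have := sin_sq_add_cos_sq (x 2)
    linarith
  ext i j
  fin_cases i <;> fin_cases j <;>
    simp [metric, cometric, kerrOmega, Matrix.mul_apply, Fin.sum_univ_four] <;>
    field_simp <;> (try simp only [rhoSq, kerrA, kerrDelta, hc]) <;> ring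

/-! ### Light beams -/

/-- The Hamiltonian `H = ½ g^ij p_i p_j` of the geodesic flow. -/
def hamiltonian (a : ℝ) (x p : Fin 4 → ℝ) : ℝ :=
  (1 / 2) * (p ⬝ᵥ Matrix.mulVec (cometric a x) p)

/-- `IsGeodesic a T x p`: on the parameter interval `[0, T)`, `0 < T ≤ ∞`, the curve `(x, p)` stays
outside the horizon and solves Hamilton's equations
`dx^i/dτ = ∂H/∂p_i`, `dp_i/dτ = - ∂H/∂x^i`.

The angle `θ` is followed on the whole real line, `(r, θ, φ)` and `(r, -θ, φ + π)` being the same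
point of space, so that a beam with `p_φ = 0`, for which the terms with `1 / sin² θ` are absent, may
cross the symmetry axis; a beam with `p_φ ≠ 0` that starts off the axis never meets it. -/
def IsGeodesic (a : ℝ) (T : EReal) (x p : ℝ → Fin 4 → ℝ) : Prop :=
  ∀ τ : ℝ, 0 ≤ τ → (τ : EReal) < T →
    rPlus a < x τ 1 ∧
    ∀ i : Fin 4,
      HasDerivWithinAt (fun σ => x σ i)
        (deriv (fun y => hamiltonian a (x τ) (Function.update (p τ) i y)) (p τ i)) (Ici 0) τ ∧
      HasDerivWithinAt (fun σ => p σ i)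
        (-deriv (fun y => hamiltonian a (Function.update (x τ) i y) (p τ)) (x τ i)) (Ici 0) τ

/-- The geodesic that starts at the event `x₀` with tangent vector `w` evolves onto the event
horizon: `r → r₊` at the end of its interval of existence in the exterior region. -/
def EvolvesOntoHorizon (a : ℝ) (x₀ w : Fin 4 → ℝ) : Prop :=
  ∃ (T : EReal) (x p : ℝ → Fin 4 → ℝ), 0 < T ∧
    x 0 = x₀ ∧ p 0 = Matrix.mulVec (metric a x₀) w ∧
    IsGeodesic a T x p ∧
    Tendsto (fun τ => x τ 1) (comap (fun τ : ℝ => (τ : EReal)) (𝓝[<] T)) (𝓝 (rPlus a))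

/-! ### Stationary observers and the shadow -/

/-- The lower end of the range of admissible angular velocities at `(r₀, θ₀)`. -/
def OmegaMinus (a r₀ θ₀ : ℝ) : ℝ :=
  1 / (r₀ ^ 2 + a ^ 2 - a * √(kerrDelta a r₀) * sin θ₀) * (a - √(kerrDelta a r₀) / sin θ₀)

/-- The upper end of the range of admissible angular velocities at `(r₀, θ₀)`. -/
def OmegaPlus (a r₀ θ₀ : ℝ) : ℝ :=
  1 / (r₀ ^ 2 + a ^ 2 + a * √(kerrDelta a r₀) * sin θ₀) * (a + √(kerrDelta a r₀) / sin θ₀)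

/-- The time component `u₀ = dt/dτ` of the four-velocity of the observer. -/
def uZero (a r₀ θ₀ Ω : ℝ) : ℝ :=
  √(rhoSq a r₀ θ₀) / √(kerrDelta a r₀ - a ^ 2 * sin θ₀ ^ 2
    + Ω * (4 * a * r₀ - kerrA a r₀ θ₀ * Ω) * sin θ₀ ^ 2)

/-- `e_(t) = u = u₀ (∂_t + Ω ∂_φ)`, the four-velocity of the observer. -/
def eT (a r₀ θ₀ Ω : ℝ) : Fin 4 → ℝ :=
  ![uZero a r₀ θ₀ Ω, 0, 0, uZero a r₀ θ₀ Ω * Ω]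

/-- `e_(r)`, pointing towards the black hole. -/
def eR (a r₀ θ₀ : ℝ) : Fin 4 → ℝ :=
  ![0, -(√(kerrDelta a r₀) / √(rhoSq a r₀ θ₀)), 0, 0]

/-- `e_(θ)`. -/
def eTheta (a r₀ θ₀ : ℝ) : Fin 4 → ℝ :=
  ![0, 0, -(1 / √(rhoSq a r₀ θ₀)), 0]

/-- `e_(φ)`. -/
def ePhi (a r₀ θ₀ Ω : ℝ) : Fin 4 → ℝ :=
  let k := uZero a r₀ θ₀ Ω / (sin θ₀ * √(kerrDelta a r₀))
  ![k * (kerrA a r₀ θ₀ * sin θ₀ ^ 2 / rhoSq a r₀ θ₀ * (Ω - kerrOmega a r₀ θ₀)), 0, 0,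
    k * (1 - 2 * r₀ * ((1 - a * Ω * sin θ₀ ^ 2) / rhoSq a r₀ θ₀))]

/-- The celestial sphere `S_N` of the observer: unit vectors `N = (N₁, N₂, N₃)`. -/
abbrev CelestialSphere : Type := Metric.sphere (0 : EuclideanSpace ℝ (Fin 3)) 1

/-- The tangent vector `w = W (-e_(t) + N₁ e_(θ) + N₂ e_(φ) + N₃ e_(r))` of the light beam traced
backward in time in the direction `N`. -/
def beamVector (a r₀ θ₀ Ω W : ℝ) (N : CelestialSphere) : Fin 4 → ℝ :=
  W • (-eT a r₀ θ₀ Ω + N.1 0 • eTheta a r₀ θ₀ + N.1 1 • ePhi a r₀ θ₀ Ω + N.1 2 • eR a r₀ θ₀)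

/-- The shadow seen at the event `(t₀, r₀, θ₀, Ω t₀ + φ₀)` of the worldline of the observer: the
directions on the celestial sphere whose backward-traced light beams evolve onto the horizon. -/
def shadow (a r₀ θ₀ Ω φ₀ t₀ W : ℝ) : Set CelestialSphere :=
  {N | EvolvesOntoHorizon a ![t₀, r₀, θ₀, Ω * t₀ + φ₀] (beamVector a r₀ θ₀ Ω W N)}

/-! ### The curve -/

/-- `λ(r_c)`, the value of `L / E` on the spherical orbit of radius `r_c`. -/
def lam (a rc : ℝ) : ℝ := ((1 + rc) * a ^ 2 + rc ^ 2 * (rc - 3)) / (a * (1 - rc))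

/-- `η(r_c)`, the value of the reduced Carter constant on the spherical orbit of radius `r_c`. -/
def eta (a rc : ℝ) : ℝ :=
  rc ^ 3 * ((4 * a ^ 2 - rc * (rc - 3) ^ 2) / (a ^ 2 * (rc - 1) ^ 2))

/-- The radius of the prograde circular photon orbit. -/
def rOne (a : ℝ) : ℝ := 2 + 2 * cos (2 / 3 * arccos (-a))

/-- The radius of the retrograde circular photon orbit. -/
def rTwo (a : ℝ) : ℝ := 2 + 2 * cos (2 / 3 * arccos a)

/-- The quantity `Z(r_c)`. -/
def zFun (a rc : ℝ) : ℝ :=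
  2 * √rc / (1 - rc) * √(3 * rc - (a ^ 2 + 3 * rc ^ 2) + rc ^ 3)

/-- `Θ_*(r_c)`. -/
def ThetaStar (a θ₀ rc : ℝ) : ℝ :=
  eta a rc + cos θ₀ ^ 2 * (a ^ 2 - lam a rc ^ 2 / sin θ₀ ^ 2)

/-- `B_α(r_c)`. -/
def BAlpha (a r₀ θ₀ Ω rc : ℝ) : ℝ :=
  arccos (|r₀ - rc| * √(r₀ ^ 2 + 2 * rc * r₀ - 3 * rc ^ 2 + zFun a rc ^ 2) /
    (√(rhoSq a r₀ θ₀) * uZero a r₀ θ₀ Ω * (1 - lam a rc * Ω) * √(kerrDelta a r₀)))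

/-- The numerator in the definition of `B_β(r_c)`. -/
def BBetaNum (a r₀ θ₀ Ω rc : ℝ) : ℝ :=
  uZero a r₀ θ₀ Ω * (rhoSq a r₀ θ₀ * (lam a rc - Ω * (r₀ ^ 2 + a ^ 2) * sin θ₀ ^ 2)
    + 2 * r₀ * (1 - a * Ω * sin θ₀ ^ 2) * (a * sin θ₀ ^ 2 - lam a rc))

open Classical in
/-- `B_β(r_c)`. At a zero of `Θ_*`, where the denominator of the argument of the arctangent vanishes,
the arctangent is read as its limit `±π/2` according to the sign of the numerator (if the numerator
vanishes too, then `sin B_α = 0` and the value is immaterial). -/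
def BBeta (a r₀ θ₀ Ω rc : ℝ) : ℝ :=
  if ThetaStar a θ₀ rc = 0 then SignType.sign (BBetaNum a r₀ θ₀ Ω rc) * (π / 2)
  else arctan (BBetaNum a r₀ θ₀ Ω rc /
    (√(rhoSq a r₀ θ₀) * sin θ₀ * √(kerrDelta a r₀) * √(ThetaStar a θ₀ rc)))

/-- The vector with angular coordinates `(α, β)`. -/
def direction (α β : ℝ) : EuclideanSpace ℝ (Fin 3) :=
  !₂[sin α * cos β, sin α * sin β, cos α]

/-- `{α = B_α, β = π + B_β} ∪ {α = B_α, β = 2π - B_β}`, `r_c ∈ I`. -/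
def curveFront (a r₀ θ₀ Ω : ℝ) (I : Set ℝ) : Set CelestialSphere :=
  {N | ∃ rc ∈ I, N.1 = direction (BAlpha a r₀ θ₀ Ω rc) (π + BBeta a r₀ θ₀ Ω rc)} ∪
  {N | ∃ rc ∈ I, N.1 = direction (BAlpha a r₀ θ₀ Ω rc) (2 * π - BBeta a r₀ θ₀ Ω rc)}

/-- `{α = π - B_α, β = π + B_β} ∪ {α = π - B_α, β = 2π - B_β}`, `r_c ∈ I`. -/
def curveBack (a r₀ θ₀ Ω : ℝ) (I : Set ℝ) : Set CelestialSphere :=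
  {N | ∃ rc ∈ I, N.1 = direction (π - BAlpha a r₀ θ₀ Ω rc) (π + BBeta a r₀ θ₀ Ω rc)} ∪
  {N | ∃ rc ∈ I, N.1 = direction (π - BAlpha a r₀ θ₀ Ω rc) (2 * π - BBeta a r₀ θ₀ Ω rc)}

end KerrShadow

end

open KerrShadow

/-! Hamilton's equations separate. With `p_t = E`, `p_φ = -L` and Carter's constant `K = κ²`
conserved, a null beam satisfies `(Δ p_r)² = R(r)` and `p_θ² = Θ(θ)`; in Mino time, `dτ = ρ² ds`,
the radius moves like a particle on a line, `r'' = R'(r)/2`. Write `R = Δ (q² - κ²)` with `q =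
P/√Δ`. The slope of `q` has the sign of `E critRatio(r) - (E a² - a L)`, and `critRatio` increases
strictly from `-r₊²`. Hence for `E > 0` and `E a² - a L > -E r₊²` the function `q` is positive and
has a single minimum in the exterior, at the radius `r_c` of the spherical orbit with the same
`L/E`.

Whether the beam falls in depends on `κ` against `q(r_c)` and on the side of `r_c` on which it
starts. Equivalently, the initial value of `Δ p_r` is compared with `-threshold`: below it the beam
is captured, above it the beam escapes (`CriticalRadius.captured`, `CriticalRadius.escaping`). For
the other values of `E`, `L` nothing is critical: `E ≤ 0` gives capture and `P(r₊) ≤ 0` gives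
escape. The one delicate case is `a = 1`, `L = 2E`, where the existence of two zeros of `Θ_*` is
what yields escape.

The criteria `Captured` and `Escaping` are open conditions on the direction, so `classification`
confines the frontier of the shadow to the critical directions. Conversely, rotating a critical
direction with `N₁ ≠ 0` about the `φ` axis fixes `N₂`, hence `E` and `L`, and moves `N₃` through its
critical value; both kinds of beams therefore accumulate there. Directions with `N₁ = 0` are limits
of such directions along the curve.

It remains to solve for the critical directions. The ratio `L/E = λ(r_c)` determines `N₂`, the
threshold determines `N₃`, and the unit sphere gives `N₁²` as a positive multiple of `Θ_*(r_c)`; so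
`r_c` ranges over the set `Θ_* ≥ 0`. Up to a positive factor `Θ_*` is `(a sin θ₀)² - thetaMono²`
with `thetaMono` strictly increasing, so this set is the interval between the two zeros. The sign of
`N₃` is that of `r₀ - r_c`, which decides between the curves (I) and (II). -/

noncomputable section

namespace KerrShadow

/-! ### Second order equations on the line -/

/-- A continuous function that starts above `c` and reaches it does so at a first time. -/
theorem exists_first_hit {f : ℝ → ℝ} {a t c : ℝ} (hf : Continuous f) (hat : a ≤ t) (ha : c < f a)
    (ht : f t ≤ c) : ∃ s, a < s ∧ s ≤ t ∧ f s = c ∧ ∀ τ ∈ Ico a s, c < f τ := by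
  set S := {x | x ∈ Icc a t ∧ f x ≤ c}
  have hS : IsCompact S := isCompact_Icc.inter_right (isClosed_Iic.preimage hf)
  obtain ⟨s, ⟨⟨has, hst⟩, hsc⟩, hmin⟩ := hS.exists_isLeast ⟨t, ⟨hat, le_rfl⟩, ht⟩
  have hlt : ∀ τ ∈ Ico a s, c < f τ := fun τ hτ => by
    by_contra! h
    exact absurd (hmin ⟨⟨hτ.1, hτ.2.le.trans hst⟩, h⟩) (not_le.2 hτ.2)
  have has' : a < s := by
    rcases has.eq_or_lt with h | h
    · rw [← h] at hsc; linarith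
    · exact h
  refine ⟨s, has', hst, le_antisymm hsc ?_, hlt⟩
  have hcl : s ∈ closure (Ico a s) := by
    rw [closure_Ico has'.ne]; exact ⟨has, le_rfl⟩
  exact closure_minimal (fun τ hτ => (hlt τ hτ).le) (isClosed_Ici.preimage hf) hcl

theorem eq_of_hasDerivAt_zero {f : ℝ → ℝ} {a b : ℝ} (hab : a ≤ b)
    (hf : ∀ s ∈ Icc a b, HasDerivAt f 0 s) : f b = f a :=
  constant_of_has_deriv_right_zero (fun s hs => (hf s hs).continuousAt.continuousWithinAt)
    (fun s hs => (hf s ⟨hs.1, hs.2.le⟩).hasDerivWithinAt) b ⟨hab, le_rfl⟩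

/-- A function whose derivative is at most `m` grows at most linearly. -/
theorem le_add_mul_of_hasDerivAt_le {f f' : ℝ → ℝ} {a b m : ℝ} (hab : a ≤ b)
    (hf : ∀ s ∈ Icc a b, HasDerivAt f (f' s) s) (hm : ∀ s ∈ Icc a b, f' s ≤ m) :
    f b ≤ f a + m * (b - a) := by
  have := (convex_Icc a b).image_sub_le_mul_sub_of_deriv_le
    (f := f) (C := m) (fun s hs => (hf s hs).continuousAt.continuousWithinAt)
    (fun s hs => (hf s (interior_subset hs)).differentiableAt.differentiableWithinAt)
    (fun s hs => (hf s (interior_subset hs)).deriv ▸ hm s (interior_subset hs))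
    a ⟨le_rfl, hab⟩ b ⟨hab, le_rfl⟩ hab
  linarith

/-- The field `(v, G(x))` is unbounded in `v`, so the velocity is clamped to `[-B, B]` with `B =
|v₀| + M T`. The clamped field is bounded, and Picard–Lindelöf applies on all of `[-T, T]`. Since
`|v'| ≤ M`, the velocity never leaves `[-B, B]` and the clamp is inactive. -/
theorem exists_secondOrder_solution_Icc {G : ℝ → ℝ} {K : NNReal} {M : ℝ} (hG : LipschitzWith K G)
    (hM : ∀ x, |G x| ≤ M) (x₀ v₀ : ℝ) {T : ℝ} (hT : 0 < T) :
    ∃ y : ℝ → ℝ × ℝ, y 0 = (x₀, v₀) ∧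
      ∀ s ∈ Ioo (-T) T, HasDerivAt y ((y s).2, G (y s).1) s := by
  have hM0 : 0 ≤ M := (abs_nonneg _).trans (hM 0)
  set B : ℝ := |v₀| + M * T with hB
  have hB0 : 0 ≤ B := by positivity
  have hBB : -B ≤ B := by linarith
  set cl : ℝ → ℝ := fun w => projIcc (-B) B hBB w
  have hcl : LipschitzWith 1 cl := by
    have h := LipschitzWith.projIcc hBB
    exact LipschitzWith.comp (Kf := 1) (f := Subtype.val) (LipschitzWith.subtype_val _) h |>.weaken
      (by simp)
  set F : ℝ × ℝ → ℝ × ℝ := fun p => (cl p.2, G p.1)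
  have hF : LipschitzWith (max 1 K) F := by
    refine (LipschitzWith.prodMk (hcl.comp LipschitzWith.prod_snd)
      (hG.comp LipschitzWith.prod_fst)).weaken ?_
    simp
  set L : NNReal := ⟨max B M, le_max_of_le_left hB0⟩
  have hFb : ∀ p, ‖F p‖ ≤ L := fun p => by
    have h1 : |cl p.2| ≤ B := abs_le.2 (projIcc (-B) B hBB p.2).2
    change max ‖cl p.2‖ ‖G p.1‖ ≤ max B M
    exact max_le_max h1 (hM _)
  set A : NNReal := L * ⟨T, hT.le⟩
  have hPL : IsPicardLindelof (fun _ => F) (tmin := -T) (tmax := T) ⟨0, by constructor <;> linarith⟩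
      (x₀, v₀) A 0 L (max 1 K) :=
    IsPicardLindelof.of_time_independent (fun p _ => hFb p) hF.lipschitzOnWith (by
      have hA : (A : ℝ) = L * T := rfl
      simp [hA])
  obtain ⟨y, hy0, hy⟩ := hPL.exists_eq_forall_mem_Icc_hasDerivWithinAt₀
  have hy' : ∀ s ∈ Ioo (-T) T, HasDerivAt y (F (y s)) s := fun s hs =>
    (hy s (Ioo_subset_Icc_self hs)).hasDerivAt (Icc_mem_nhds hs.1 hs.2)
  refine ⟨y, hy0, fun s hs => ?_⟩
  have hd : ∀ σ ∈ Ioo (-T) T, HasDerivAt (fun σ => (y σ).2) (G (y σ).1) σ := fun σ hσ => by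
    have h : HasDerivAt y (cl (y σ).2, G (y σ).1) σ := hy' σ hσ
    exact hasFDerivAt_snd.comp_hasDerivAt σ h
  have h2 : |(y s).2 - (y 0).2| ≤ M * |s - 0| := by
    have := (convex_Ioo (-T) T).norm_image_sub_le_of_norm_hasDerivWithin_le
      (f := fun σ => (y σ).2) (f' := fun σ => G (y σ).1) (C := M) (x := 0) (y := s)
      (fun σ hσ => (hd σ hσ).hasDerivWithinAt)
      (fun σ _ => hM _) ⟨by linarith, hT⟩ hs
    simpa using this
  have hy0' : (y 0).2 = v₀ := by
    have := congrArg Prod.snd hy0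
    simpa using this
  have h3 : |(y s).2| ≤ B := by
    rw [hy0', sub_zero] at h2
    have h4 : |s| ≤ T := abs_le.2 ⟨hs.1.le, hs.2.le⟩
    have h5 : |(y s).2| ≤ |(y s).2 - v₀| + |v₀| := by
      have := abs_add_le ((y s).2 - v₀) v₀
      simpa using this
    have : M * |s| ≤ M * T := by gcongr
    linarith
  have h6 : cl (y s).2 = (y s).2 := by
    simp only [cl]
    rw [projIcc_of_mem hBB (abs_le.1 h3)]
  have := hy' s hs
  simpa only [F, h6] using this

/-- Global solutions of `x'' = G(x)` for a bounded Lipschitz force `G`. -/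
theorem exists_secondOrder_solution {G : ℝ → ℝ} {K : NNReal} {M : ℝ} (hG : LipschitzWith K G)
    (hM : ∀ x, |G x| ≤ M) (x₀ v₀ : ℝ) :
    ∃ x v : ℝ → ℝ, x 0 = x₀ ∧ v 0 = v₀ ∧
      ∀ s, HasDerivAt x (v s) s ∧ HasDerivAt v (G (x s)) s := by
  have hpos : ∀ n : ℕ, (0 : ℝ) < n + 1 := fun n => by positivity
  choose y hy0 hy using fun n : ℕ => exists_secondOrder_solution_Icc hG hM x₀ v₀ (hpos n)
  set F : ℝ × ℝ → ℝ × ℝ := fun p => (p.2, G p.1)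
  have hF : LipschitzWith (max 1 K) F := by
    refine (LipschitzWith.prodMk LipschitzWith.prod_snd
      (hG.comp LipschitzWith.prod_fst)).weaken ?_
    simp
  have hagree : ∀ m n : ℕ, m ≤ n → EqOn (y m) (y n) (Ioo (-(m + 1 : ℝ)) (m + 1)) := by
    intro m n hmn
    have hmn' : (m : ℝ) ≤ n := by exact_mod_cast hmn
    refine ODE_solution_unique_of_mem_Ioo (v := fun _ => F) (s := fun _ => univ) (t₀ := 0)
      (fun t _ => hF.lipschitzOnWith) ⟨by linarith [hpos m], hpos m⟩
      (fun t ht => ⟨hy m t ht, trivial⟩) (fun t ht => ⟨hy n t ⟨?_, ?_⟩, trivial⟩) ?_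
    · linarith [ht.1]
    · linarith [ht.2]
    · rw [hy0, hy0]
  -- By uniqueness the local solutions agree on common intervals. At `s` the solution of index
  -- `⌈|s|⌉₊` is used, whose open interval contains `s`.
  set z : ℝ → ℝ × ℝ := fun s => y ⌈|s|⌉₊ s
  have hz : ∀ n : ℕ, EqOn z (y n) (Ioo (-(n + 1 : ℝ)) (n + 1)) := by
    intro n s hs
    have h1 : |s| ≤ ⌈|s|⌉₊ := Nat.le_ceil _
    have h2 : s ∈ Ioo (-(⌈|s|⌉₊ + 1 : ℝ)) (⌈|s|⌉₊ + 1) := by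
      rw [mem_Ioo, ← abs_lt]; linarith
    rcases le_total n ⌈|s|⌉₊ with h | h
    · exact (hagree _ _ h hs).symm
    · exact hagree _ _ h h2
  have hz' : ∀ s, HasDerivAt z ((z s).2, G (z s).1) s := by
    intro s
    have h1 : |s| < ⌈|s|⌉₊ + 1 := (Nat.le_ceil _).trans_lt (by linarith)
    have h2 := abs_lt.1 h1
    have h3 := hy ⌈|s|⌉₊ s h2
    have h4 : z =ᶠ[𝓝 s] y ⌈|s|⌉₊ :=
      Filter.eventuallyEq_iff_exists_mem.2 ⟨_, Ioo_mem_nhds h2.1 h2.2, hz _⟩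
    exact h3.congr_of_eventuallyEq h4
  have hz0 : z 0 = (x₀, v₀) := hy0 _
  refine ⟨fun s => (z s).1, fun s => (z s).2, by simp [hz0], by simp [hz0], fun s => ⟨?_, ?_⟩⟩
  · exact hasFDerivAt_fst.comp_hasDerivAt s (hz' s)
  · exact hasFDerivAt_snd.comp_hasDerivAt s (hz' s)

/-- Global solutions of `x'' = G(x)` for a force `G` that is of class `C¹` on `[l, u]`, the equation
being required only while the solution is in `[l, u]`; the energy is conserved there. -/
theorem exists_clamped_solution {G V : ℝ → ℝ} {l u : ℝ} (hlu : l ≤ u)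
    (hG : ContDiffOn ℝ 1 G (Icc l u)) (hV : ∀ x ∈ Icc l u, HasDerivAt V (2 * G x) x)
    (x₀ v₀ : ℝ) (hv₀ : v₀ ^ 2 = V x₀) :
    ∃ x v : ℝ → ℝ, x 0 = x₀ ∧ v 0 = v₀ ∧ (∀ s, HasDerivAt x (v s) s) ∧ Continuous v ∧
      (∀ s, x s ∈ Icc l u → HasDerivAt v (G (x s)) s) ∧
      ∀ s, 0 ≤ s → (∀ σ ∈ Icc 0 s, x σ ∈ Icc l u) → v s ^ 2 = V (x s) := by
  obtain ⟨K, hK⟩ := hG.exists_lipschitzOnWith one_ne_zero (convex_Icc l u) isCompact_Icc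
  obtain ⟨M, hM⟩ := isCompact_Icc.exists_bound_of_continuousOn hG.continuousOn
  -- Extending `G` by its endpoint values outside `[l, u]` makes it globally bounded and Lipschitz.
  set H : ℝ → ℝ := fun x => G (projIcc l u hlu x)
  have hH : LipschitzWith K H := by
    have h := hK.to_restrict.comp (LipschitzWith.projIcc hlu)
    rw [mul_one] at h
    exact h
  have hHG : ∀ x ∈ Icc l u, H x = G x := fun x hx => by simp only [H]; rw [projIcc_of_mem hlu hx]
  obtain ⟨x, v, hx0, hv0, hxv⟩ := exists_secondOrder_solution hH
    (fun x => hM _ (projIcc l u hlu x).2) x₀ v₀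
  have hvd : ∀ s, x s ∈ Icc l u → HasDerivAt v (G (x s)) s := fun s hs => hHG _ hs ▸ (hxv s).2
  refine ⟨x, v, hx0, hv0, fun s => (hxv s).1,
    continuous_iff_continuousAt.2 fun s => (hxv s).2.continuousAt, hvd, fun s hs hmem => ?_⟩
  have h := eq_of_hasDerivAt_zero (f := fun σ => v σ ^ 2 - V (x σ)) hs fun σ hσ => by
    have h1 := ((hvd σ (hmem σ hσ)).pow 2).sub ((hV _ (hmem σ hσ)).comp σ (hxv σ).1)
    convert! h1 using 1
    push_cast; ring
  simp only [hx0, hv0, hv₀] at h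
  linarith

/-! ### The radial potential -/

/-- `P(r) = (r² + a²) E - a L`. -/
def radP (a E L r : ℝ) : ℝ := E * (r ^ 2 + a ^ 2) - a * L

/-- The radial potential `R(r) = P(r)² - Δ(r) K`. -/
def radR (a E L K r : ℝ) : ℝ := radP a E L r ^ 2 - kerrDelta a r * K

/-- The radial force `R'(r) / 2`. -/
def radForce (a E L K r : ℝ) : ℝ := radP a E L r * (2 * E * r) - (r - 1) * K

theorem hasDerivAt_kerrDelta (a r : ℝ) : HasDerivAt (kerrDelta a) (2 * (r - 1)) r := by
  have := (((hasDerivAt_id r).pow 2).sub ((hasDerivAt_id r).const_mul 2)).add_const (a ^ 2)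
  convert! this using 1
  simp; ring

theorem hasDerivAt_radP (a E L r : ℝ) : HasDerivAt (radP a E L) (2 * E * r) r := by
  have := ((((hasDerivAt_id r).pow 2).add_const (a ^ 2)).const_mul E).sub_const (a * L)
  convert! this using 1
  simp; ring

theorem hasDerivAt_radR (a E L K r : ℝ) :
    HasDerivAt (radR a E L K) (2 * radForce a E L K r) r := by
  have := ((hasDerivAt_radP a E L r).pow 2).sub ((hasDerivAt_kerrDelta a r).mul_const K)
  convert! this using 1
  simp [radForce]; ring

theorem continuous_radP (a E L : ℝ) : Continuous (radP a E L) := by unfold radP; fun_prop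

theorem continuous_kerrDelta (a : ℝ) : Continuous (kerrDelta a) := by unfold kerrDelta; fun_prop

theorem continuous_radR (a E L K : ℝ) : Continuous (radR a E L K) := by
  have := continuous_radP a E L
  have := continuous_kerrDelta a
  unfold radR; fun_prop

theorem contDiff_radForce (a E L K : ℝ) : ContDiff ℝ 1 (radForce a E L K) := by
  unfold radForce radP; fun_prop

theorem kerrDelta_eq (a r : ℝ) : kerrDelta a r = (r - 1) ^ 2 - (1 - a ^ 2) := by
  unfold kerrDelta; ring

theorem one_le_rPlus (a : ℝ) : 1 ≤ rPlus a := by unfold rPlus; linarith [sqrt_nonneg (1 - a ^ 2)]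

theorem kerrDelta_pos {a r : ℝ} (h : rPlus a < r) : 0 < kerrDelta a r := by
  rw [kerrDelta_eq]
  have h1 : √(1 - a ^ 2) < r - 1 := by unfold rPlus at h; linarith
  have h2 := (sqrt_lt' ((sqrt_nonneg _).trans_lt h1)).1 h1
  linarith

theorem kerrDelta_rPlus {a : ℝ} (ha : a ^ 2 ≤ 1) : kerrDelta a (rPlus a) = 0 := by
  rw [kerrDelta_eq, rPlus, add_sub_cancel_left, sq_sqrt (by linarith)]; ring

/-- `v / P` is strictly decreasing along radial motion wherever `P / √Δ` is decreasing in `r`. -/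
theorem hasDerivAt_velocity_div_radP {a E L K s : ℝ} {x v : ℝ → ℝ} (hx : HasDerivAt x (v s) s)
    (hv : HasDerivAt v (radForce a E L K (x s)) s) (hE : v s ^ 2 = radR a E L K (x s))
    (hP : radP a E L (x s) ≠ 0) :
    HasDerivAt (fun σ => v σ / radP a E L (x σ))
      (K * ((2 * E * x s * kerrDelta a (x s) - (x s - 1) * radP a E L (x s)) /
        radP a E L (x s) ^ 2)) s := by
  have := hv.div ((hasDerivAt_radP a E L (x s)).comp s hx) hP
  convert! this using 1
  simp only [Function.comp]
  field_simp
  -- The numerator is `R'/2 · P - v² P'`. After `v² = R` the terms `P² P'` cancel, and only a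
  -- multiple of `K` survives.
  rw [hE]; unfold radR radForce; ring

/-- Once moving inwards through a region where the radial potential is positive down to the horizon,
the motion reaches the horizon. -/
theorem exists_le_of_velocity_neg {V x v : ℝ → ℝ} {l s₂ : ℝ}
    (hx : ∀ s, HasDerivAt x (v s) s) (hv : Continuous v) (hl : l < x s₂) (hv₂ : v s₂ < 0)
    (hV : ContinuousOn V (Icc l (x s₂))) (hVpos : ∀ r ∈ Icc l (x s₂), 0 < V r)
    (hE : ∀ s, s₂ ≤ s → (∀ σ ∈ Icc s₂ s, x σ ∈ Icc l (x s₂)) → v s ^ 2 = V (x s)) :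
    ∃ s, s₂ < s ∧ x s = l ∧ ∀ σ ∈ Ico s₂ s, l < x σ ∧ x σ ≤ x s₂ := by
  have hxc : Continuous x := continuous_iff_continuousAt.2 fun s => (hx s).continuousAt
  obtain ⟨r₁, hr₁, hmin⟩ := isCompact_Icc.exists_isMinOn (nonempty_Icc.2 hl.le) hV
  have hd2 : 0 < V r₁ := hVpos _ hr₁
  -- By compactness the speed is at least `d > 0` as long as the motion stays in the interval.
  set d := √(V r₁) with hd
  have hd0 : 0 < d := sqrt_pos.2 hd2
  have key : ∀ s, s₂ ≤ s → (∀ σ ∈ Ico s₂ s, l ≤ x σ) →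
      (∀ σ ∈ Ico s₂ s, v σ < 0) → x s ∈ Icc l (x s₂) ∧ d ≤ |v s| := by
    intro s hs hlx hneg
    have hmono : ∀ σ ∈ Icc s₂ s, x σ ≤ x s₂ := by
      intro σ hσ
      refine antitoneOn_of_deriv_nonpos (convex_Icc s₂ σ) hxc.continuousOn
        (fun y _ => (hx y).differentiableAt.differentiableWithinAt) (fun y hy => ?_)
        ⟨le_rfl, hσ.1⟩ ⟨hσ.1, le_rfl⟩ hσ.1
      rw [interior_Icc] at hy
      rw [(hx y).deriv]
      exact (hneg y ⟨hy.1.le, hy.2.trans_le hσ.2⟩).le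
    have hge : ∀ σ ∈ Icc s₂ s, l ≤ x σ := by
      intro σ hσ
      rcases hσ.2.lt_or_eq with h | h
      · exact hlx σ ⟨hσ.1, h⟩
      · subst h
        rcases hσ.1.eq_or_lt with h | h
        · rw [← h]; exact hl.le
        · refine closure_minimal (s := Ico s₂ σ) (t := {y | l ≤ x y}) hlx
            (isClosed_Ici.preimage hxc) ?_
          rw [closure_Ico h.ne]; exact ⟨hσ.1, le_rfl⟩
    have hin : ∀ σ ∈ Icc s₂ s, x σ ∈ Icc l (x s₂) := fun σ hσ => ⟨hge σ hσ, hmono σ hσ⟩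
    refine ⟨hin s ⟨hs, le_rfl⟩, ?_⟩
    have h1 := hE s hs hin
    rw [hd, ← sqrt_sq_eq_abs, h1]
    exact sqrt_le_sqrt (hmin (hin s ⟨hs, le_rfl⟩))
  -- The velocity cannot change sign: at its first zero the speed would still be at least `d`.
  have hneg : ∀ s, s₂ ≤ s → (∀ σ ∈ Ico s₂ s, l ≤ x σ) → v s < 0 := by
    intro s hs hlx
    by_contra! hvs
    obtain ⟨s', h1, h2, h3, h4⟩ := exists_first_hit (f := fun s => -v s) hv.neg hs
      (c := 0) (by simpa using hv₂) (by simpa using hvs)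
    have h5 := (key s' h1.le (fun σ hσ => hlx σ ⟨hσ.1, hσ.2.trans_le h2⟩)
      (fun σ hσ => by simpa using h4 σ hσ)).2
    rw [neg_eq_zero.1 h3] at h5
    simp at h5; linarith
  have hneg' : ∀ s, s₂ ≤ s → (∀ σ ∈ Ico s₂ s, l ≤ x σ) → v s ≤ -d ∧ x s ≤ x s₂ := by
    intro s hs hlx
    have h1 := key s hs hlx (fun σ hσ => hneg σ hσ.1 fun τ hτ => hlx τ ⟨hτ.1, hτ.2.trans hσ.2⟩)
    have h2 := h1.2
    rw [abs_of_neg (hneg s hs hlx)] at h2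
    exact ⟨by linarith, h1.1.2⟩
  have hreach : ∃ t, s₂ ≤ t ∧ x t ≤ l := by
    by_contra! hcon
    have hall : ∀ s, s₂ ≤ s → v s ≤ -d := fun s hs => (hneg' s hs fun σ hσ => (hcon σ hσ.1).le).1
    set t := s₂ + (x s₂ - l) / d with ht
    have ht0 : s₂ ≤ t := by
      have : 0 ≤ (x s₂ - l) / d := div_nonneg (by linarith) hd0.le
      linarith
    have h1 := le_add_mul_of_hasDerivAt_le ht0 (fun s _ => hx s) (fun s hs => hall s hs.1)
    have h2 : -d * (t - s₂) = -(x s₂ - l) := by rw [ht]; field_simp; ring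
    have h3 := hcon t ht0
    rw [h2] at h1
    linarith
  obtain ⟨t, ht0, ht⟩ := hreach
  obtain ⟨s, h1, h2, h3, h4⟩ := exists_first_hit hxc ht0 hl ht
  exact ⟨s, h1, h3, fun σ hσ => ⟨h4 σ hσ,
    (hneg' σ hσ.1 fun τ hτ => (h4 τ ⟨hτ.1, hτ.2.trans hσ.2⟩).le).2⟩⟩

/-- A solution in Mino time of the radial equation that starts at `(r₀, v₀)` and falls onto the
horizon. -/
def RadialInfall (a E L K r₀ v₀ : ℝ) : Prop :=
  ∃ (S : ℝ) (x v : ℝ → ℝ), 0 < S ∧ x 0 = r₀ ∧ v 0 = v₀ ∧ Continuous x ∧ Continuous v ∧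
    x S = rPlus a ∧ (∀ s ∈ Ico 0 S, rPlus a < x s) ∧
    ∀ s ∈ Icc 0 S, HasDerivAt x (v s) s ∧ HasDerivAt v (radForce a E L K (x s)) s ∧
      v s ^ 2 = radR a E L K (x s)

theorem radialInfall_of_inward {a E L K r₀ v₀ : ℝ} (hr₀ : rPlus a < r₀)
    (hE : v₀ ^ 2 = radR a E L K r₀) (hv₀ : v₀ < 0)
    (hR : ∀ r ∈ Icc (rPlus a) r₀, 0 < radR a E L K r) : RadialInfall a E L K r₀ v₀ := by
  obtain ⟨x, v, hx0, hv0, hx, hvc, hv, hen⟩ := exists_clamped_solution hr₀.le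
    (contDiff_radForce a E L K).contDiffOn (fun r _ => hasDerivAt_radR a E L K r) r₀ v₀ hE
  have hxc : Continuous x := continuous_iff_continuousAt.2 fun s => (hx s).continuousAt
  obtain ⟨S, hS, hxS, hin⟩ := exists_le_of_velocity_neg (V := radR a E L K) (s₂ := 0) hx hvc
    (by rwa [hx0]) (by rwa [hv0]) (continuous_radR a E L K).continuousOn (by rwa [hx0])
    (by rw [hx0]; exact hen)
  rw [hx0] at hin
  have hin' : ∀ s ∈ Icc 0 S, x s ∈ Icc (rPlus a) r₀ := by
    intro s hs
    rcases hs.2.lt_or_eq with h | h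
    · exact ⟨(hin s ⟨hs.1, h⟩).1.le, (hin s ⟨hs.1, h⟩).2⟩
    · rw [h, hxS]; exact ⟨le_rfl, hr₀.le⟩
  exact ⟨S, x, v, hS, hx0, hv0, hxc, hvc, hxS, fun s hs => (hin s hs).1, fun s hs =>
    ⟨hx s, hv s (hin' s hs), hen s hs.1 fun σ hσ => hin' σ ⟨hσ.1, hσ.2.trans hs.2⟩⟩⟩

/-- Here `v₀` may have any sign, or vanish at a turning point. The region `R < 0` at `u` keeps the
motion below `u`. It cannot move outwards forever, because along outward motion `v / P` decreases at
a rate bounded away from zero. Once `v < 0`, the potential is positive at that radius, hence by `hR`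
down to the horizon, and nothing stops the fall. -/
theorem radialInfall_of_barrier {a E L K r₀ v₀ u : ℝ} (hr₀ : rPlus a < r₀) (hu : r₀ < u)
    (hE : v₀ ^ 2 = radR a E L K r₀) (hK : 0 < K)
    (hP : ∀ r ∈ Icc (rPlus a) u, 0 < radP a E L r)
    (hG : ∀ r ∈ Icc r₀ u, 2 * E * r * kerrDelta a r - (r - 1) * radP a E L r < 0)
    (hRu : radR a E L K u < 0)
    (hR : ∀ y ∈ Ioo (rPlus a) u, 0 < radR a E L K y → ∀ r ∈ Icc (rPlus a) y, 0 < radR a E L K r) :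
    RadialInfall a E L K r₀ v₀ := by
  have hlu : rPlus a ≤ u := (hr₀.trans hu).le
  obtain ⟨x, v, hx0, hv0, hx, hvc, hv, hen⟩ := exists_clamped_solution hlu
    (contDiff_radForce a E L K).contDiffOn (fun r _ => hasDerivAt_radR a E L K r) r₀ v₀ hE
  have hxc : Continuous x := continuous_iff_continuousAt.2 fun s => (hx s).continuousAt
  have hlt : ∀ s, 0 ≤ s → (∀ σ ∈ Icc 0 s, rPlus a ≤ x σ) → x s < u := by
    intro s hs hge
    by_contra! hxs
    obtain ⟨s', h1, h2, h3, h4⟩ := exists_first_hit (f := fun s => -x s) hxc.neg hs (c := -u)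
      (by simp only [hx0]; linarith) (by linarith)
    have h5 : v s' ^ 2 = radR a E L K (x s') := hen s' h1.le fun σ hσ => by
      refine ⟨hge σ ⟨hσ.1, hσ.2.trans h2⟩, ?_⟩
      rcases hσ.2.lt_or_eq with h | h
      · have := h4 σ ⟨hσ.1, h⟩; linarith
      · rw [h]; linarith
    rw [neg_injective h3] at h5
    linarith [sq_nonneg (v s')]
  have hmem : ∀ s, 0 ≤ s → (∀ σ ∈ Icc 0 s, rPlus a ≤ x σ) → ∀ σ ∈ Icc 0 s, x σ ∈ Icc (rPlus a) u :=
    fun s hs hge σ hσ => ⟨hge σ hσ,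
      (hlt σ hσ.1 fun τ hτ => hge τ ⟨hτ.1, hτ.2.trans hσ.2⟩).le⟩
  have hreach : ∃ t, 0 ≤ t ∧ x t ≤ rPlus a := by
    by_contra! hcon
    have hge : ∀ s, 0 ≤ s → x s ∈ Ioo (rPlus a) u := fun s hs =>
      ⟨hcon s hs, hlt s hs fun σ hσ => (hcon σ hσ.1).le⟩
    have hge' : ∀ s, 0 ≤ s → x s ∈ Icc (rPlus a) u := fun s hs => Ioo_subset_Icc_self (hge s hs)
    have hen' : ∀ s, 0 ≤ s → v s ^ 2 = radR a E L K (x s) := fun s hs =>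
      hen s hs fun σ hσ => hge' σ hσ.1
    have hv2 : ∃ s₂, 0 ≤ s₂ ∧ v s₂ < 0 := by
      by_contra! hnn
      have hxr : ∀ s, 0 ≤ s → x s ∈ Icc r₀ u := fun s hs => by
        refine ⟨?_, (hge s hs).2.le⟩
        have := monotoneOn_of_deriv_nonneg (convex_Icc 0 s) hxc.continuousOn
          (fun y _ => (hx y).differentiableAt.differentiableWithinAt) (fun y hy => by
            rw [interior_Icc] at hy
            rw [(hx y).deriv]
            exact hnn y hy.1.le) ⟨le_rfl, hs⟩ ⟨hs, le_rfl⟩ hs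
        rwa [hx0] at this
      -- The rate of change of `v / P` along the motion; it is continuous and negative on the
      -- compact interval `[r₀, u]`, so its maximum there is negative.
      set W : ℝ → ℝ := fun r =>
        K * ((2 * E * r * kerrDelta a r - (r - 1) * radP a E L r) / radP a E L r ^ 2) with hW
      have hPne : ∀ r ∈ Icc r₀ u, radP a E L r ≠ 0 := fun r hr =>
        (hP r ⟨hr₀.le.trans hr.1, hr.2⟩).ne'
      have hWc : ContinuousOn W (Icc r₀ u) := by
        have h1 := continuous_radP a E L
        have h2 := continuous_kerrDelta a
        refine continuousOn_const.mul (ContinuousOn.div (by fun_prop) (by fun_prop) fun r hr =>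
          pow_ne_zero 2 (hPne r hr))
      obtain ⟨r₁, hr₁, hmax⟩ := isCompact_Icc.exists_isMaxOn (nonempty_Icc.2 hu.le) hWc
      have hW1 : W r₁ < 0 := mul_neg_of_pos_of_neg hK
        (div_neg_of_neg_of_pos (hG r₁ hr₁) (by have := hPne r₁ hr₁; positivity))
      have hw : ∀ s, 0 ≤ s → v s / radP a E L (x s) ≤ v 0 / radP a E L (x 0) + W r₁ * (s - 0) :=
        fun s hs => le_add_mul_of_hasDerivAt_le (f := fun s => v s / radP a E L (x s))
          (f' := fun s => W (x s)) hs
          (fun σ hσ => hasDerivAt_velocity_div_radP (hx σ) (hv σ (hge' σ hσ.1)) (hen' σ hσ.1)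
            (hPne _ (hxr σ hσ.1))) (fun σ hσ => hmax (hxr σ hσ.1))
      set c := v 0 / radP a E L (x 0) with hc
      have hc0 : 0 ≤ c := div_nonneg (hnn 0 le_rfl) (hP _ (hge' 0 le_rfl)).le
      -- By this time `v / P` would have dropped from `c` to at most `-1`.
      have h1 := hw ((c + 1) / (-W r₁)) (div_nonneg (by linarith) (by linarith))
      have h2 : 0 ≤ v ((c + 1) / (-W r₁)) / radP a E L (x ((c + 1) / (-W r₁))) :=
        div_nonneg (hnn _ (div_nonneg (by linarith) (by linarith)))
          (hP _ (hge' _ (div_nonneg (by linarith) (by linarith)))).le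
      have h3 : W r₁ * ((c + 1) / (-W r₁) - 0) = -(c + 1) := by
        have := hW1.ne
        field_simp
        ring
      rw [h3] at h1
      linarith
    obtain ⟨s₂, hs₂, hvs₂⟩ := hv2
    have hpos : 0 < radR a E L K (x s₂) := by
      rw [← hen' s₂ hs₂]; exact sq_pos_of_neg hvs₂
    obtain ⟨s, h1, h2, -⟩ := exists_le_of_velocity_neg (V := radR a E L K) hx hvc
      (hcon s₂ hs₂) hvs₂ (continuous_radR a E L K).continuousOn (hR _ (hge s₂ hs₂) hpos)
      (fun s hs _ => hen' s (hs₂.trans hs))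
    have := hcon s (hs₂.trans h1.le)
    linarith
  obtain ⟨t, ht0, ht⟩ := hreach
  obtain ⟨S, h1, h2, h3, h4⟩ := exists_first_hit hxc ht0 (by rwa [hx0]) ht
  have hge : ∀ σ ∈ Icc 0 S, rPlus a ≤ x σ := fun σ hσ => by
    rcases hσ.2.lt_or_eq with h | h
    · exact (h4 σ ⟨hσ.1, h⟩).le
    · rw [h, h3]
  have hin := hmem S h1.le hge
  exact ⟨S, x, v, h1, hx0, hv0, hxc, hvc, h3, h4, fun s hs =>
    ⟨hx s, hv s (hin s hs), hen s hs.1 fun σ hσ => hin σ ⟨hσ.1, hσ.2.trans hs.2⟩⟩⟩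

/-! ### The angular potential -/

/-- The angular potential `Θ(θ) = K - (L / sin θ - a E sin θ)²`. -/
def angPot (a E L K θ : ℝ) : ℝ := K - (L / sin θ - a * E * sin θ) ^ 2

/-- The angular force `Θ'(θ) / 2`. -/
def angForce (a E L θ : ℝ) : ℝ := cos θ * (L ^ 2 / sin θ ^ 3 - a ^ 2 * E ^ 2 * sin θ)

theorem hasDerivAt_angPot (a E L K : ℝ) {θ : ℝ} (h : sin θ ≠ 0 ∨ L = 0) :
    HasDerivAt (angPot a E L K) (2 * angForce a E L θ) θ := by
  rcases h with h | rfl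
  · have h1 := (((hasDerivAt_const θ L).div (hasDerivAt_sin θ) h).sub
      ((hasDerivAt_sin θ).const_mul (a * E))).pow 2 |>.const_sub K
    convert! h1 using 1
    simp only [angForce, Pi.div_apply, Pi.sub_apply]
    push_cast
    field_simp
    ring
  · have h1 := ((((hasDerivAt_sin θ).const_mul (a * E))).pow 2).const_sub K
    have h2 : angPot a E 0 K = fun θ => K - (a * E * sin θ) ^ 2 := by
      funext θ; simp [angPot]
    rw [h2]
    convert! h1 using 1
    simp only [angForce]
    push_cast
    ring

/-- The centrifugal term keeps beams with `L ≠ 0` off the axis. For such `θ` one has `|L| / sin θ ≥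
|L| + √K + |a E| + 1`, so the square in the potential exceeds `K` even after `a E sin θ` is
subtracted. The summand `|L|` in the denominator keeps the bound on `sin θ` below `1`. -/
theorem angPot_neg_of_sin_le {a E L K θ : ℝ} (hL : L ≠ 0) (hK : 0 ≤ K) (h0 : 0 < sin θ)
    (h : sin θ ≤ |L| / (|L| + √K + |a * E| + 1)) : angPot a E L K θ < 0 := by
  have hL0 : 0 < |L| := abs_pos.2 hL
  have hK0 := sqrt_nonneg K
  have h1 : 0 < |L| + √K + |a * E| + 1 := by positivity
  have h2 : |L| + √K + |a * E| + 1 ≤ |L| / sin θ := by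
    rw [le_div_iff₀ h0, mul_comm]; exact (le_div_iff₀ h1).1 h
  have h3 : |L| / sin θ - |a * E| * sin θ ≤ |L / sin θ - a * E * sin θ| := by
    have := abs_sub_abs_le_abs_sub (L / sin θ) (a * E * sin θ)
    rwa [abs_div, abs_mul (a * E), abs_of_pos h0] at this
  have h4 : |a * E| * sin θ ≤ |a * E| := mul_le_of_le_one_right (abs_nonneg _) (sin_le_one θ)
  have h5 : √K < |L / sin θ - a * E * sin θ| := by linarith
  have h6 : √K ^ 2 < |L / sin θ - a * E * sin θ| ^ 2 := by gcongr
  rw [sq_sqrt hK, sq_abs] at h6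
  unfold angPot; linarith

theorem exists_angular_motion {a E L K θ₀ u₀ : ℝ} (hθ₀ : θ₀ ∈ Ioo 0 π)
    (hu₀ : u₀ ^ 2 = angPot a E L K θ₀) :
    ∃ x u : ℝ → ℝ, x 0 = θ₀ ∧ u 0 = u₀ ∧ Continuous x ∧ Continuous u ∧
      ∀ s, 0 ≤ s → HasDerivAt x (u s) s ∧ HasDerivAt u (angForce a E L (x s)) s ∧
        (sin (x s) ≠ 0 ∨ L = 0) ∧ u s ^ 2 = angPot a E L K (x s) := by
  by_cases hL : L = 0
  -- Without angular momentum the force is `-a² E² cos θ sin θ`, bounded and Lipschitz on the whole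
  -- line, so the motion may cross the axis.
  · subst hL
    set c := a ^ 2 * E ^ 2
    have hc0 : 0 ≤ c := by positivity
    have hG : ∀ θ, HasDerivAt (angForce a E 0) (-c * (cos θ ^ 2 - sin θ ^ 2)) θ := fun θ => by
      have h1 := ((hasDerivAt_cos θ).mul (hasDerivAt_sin θ)).const_mul (-c)
      convert! h1 using 1
      · funext x; simp [angForce, c]; ring
      · ring
    have hlip : LipschitzWith c.toNNReal (angForce a E 0) := by
      refine lipschitzWith_of_nnnorm_deriv_le (fun θ => (hG θ).differentiableAt) fun θ => ?_
      rw [(hG θ).deriv, ← NNReal.coe_le_coe, Real.coe_toNNReal c hc0, coe_nnnorm, Real.norm_eq_abs, abs_mul, abs_neg,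
        abs_of_nonneg hc0]
      refine mul_le_of_le_one_right hc0 (abs_le.2 ⟨?_, ?_⟩) <;>
        nlinarith [sin_sq_add_cos_sq θ, sq_nonneg (sin θ), sq_nonneg (cos θ)]
    have hb : ∀ θ, |angForce a E 0 θ| ≤ c := fun θ => by
      have h1 : angForce a E 0 θ = -(c * (cos θ * sin θ)) := by simp [angForce, c]; ring
      rw [h1, abs_neg, abs_mul, abs_of_nonneg hc0, abs_mul]
      exact mul_le_of_le_one_right hc0
        (mul_le_one₀ (abs_cos_le_one θ) (abs_nonneg _) (abs_sin_le_one θ))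
    obtain ⟨x, u, hx0, hu0, hxu⟩ := exists_secondOrder_solution hlip hb θ₀ u₀
    refine ⟨x, u, hx0, hu0, continuous_iff_continuousAt.2 fun s => (hxu s).1.continuousAt,
      continuous_iff_continuousAt.2 fun s => (hxu s).2.continuousAt, fun s hs =>
      ⟨(hxu s).1, (hxu s).2, Or.inr rfl, ?_⟩⟩
    have h := eq_of_hasDerivAt_zero (f := fun σ => u σ ^ 2 - angPot a E 0 K (x σ)) hs fun σ _ => by
      have h1 := ((hxu σ).2.pow 2).sub
        ((hasDerivAt_angPot a E 0 K (Or.inr rfl)).comp σ (hxu σ).1)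
      convert! h1 using 1
      push_cast; ring
    simp only [hx0, hu0, hu₀] at h
    linarith
  · have hK : 0 ≤ K := by
      have := sq_nonneg u₀
      rw [hu₀, angPot] at this
      nlinarith [sq_nonneg (L / sin θ₀ - a * E * sin θ₀)]
    -- The motion is confined to `sin θ ≥ σ₁`: the potential is negative where `sin θ = σ₁`, which
    -- contradicts conservation of energy at a first arrival there.
    set σ₁ := |L| / (|L| + √K + |a * E| + 1) with hσ₁
    have hL0 : 0 < |L| := abs_pos.2 hL
    have hσ0 : 0 < σ₁ := by positivity
    have hσ1 : σ₁ < 1 := by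
      rw [hσ₁, div_lt_one (by positivity)]
      have := sqrt_nonneg K
      have := abs_nonneg (a * E)
      linarith
    set l := arcsin σ₁ with hl
    have hl0 : 0 < l := arcsin_pos.2 hσ0
    have hl1 : l < π / 2 := arcsin_lt_pi_div_two.2 hσ1
    have hsl : sin l = σ₁ := sin_arcsin (by linarith) hσ1.le
    have hge : ∀ θ ∈ Icc l (π - l), σ₁ ≤ sin θ := fun θ hθ => by
      rcases le_total θ (π / 2) with h | h
      · rw [← hsl]
        exact sin_le_sin_of_le_of_le_pi_div_two (by linarith) h hθ.1
      · rw [← hsl, ← sin_pi_sub θ]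
        exact sin_le_sin_of_le_of_le_pi_div_two (by linarith) (by linarith) (by linarith [hθ.2])
    have hne : ∀ θ ∈ Icc l (π - l), sin θ ≠ 0 := fun θ hθ => (hσ0.trans_le (hge θ hθ)).ne'
    have hsθ : σ₁ < sin θ₀ := by
      by_contra! h
      have := angPot_neg_of_sin_le (a := a) (E := E) hL hK (sin_pos_of_mem_Ioo hθ₀) h
      rw [← hu₀] at this
      linarith [sq_nonneg u₀]
    have hlθ : l < θ₀ := by
      by_contra! h
      have := sin_le_sin_of_le_of_le_pi_div_two (by linarith [hθ₀.1]) hl1.le h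
      linarith
    have hθl : θ₀ < π - l := by
      by_contra! h
      have := sin_le_sin_of_le_of_le_pi_div_two (x := π - θ₀) (y := l) (by linarith [hθ₀.2])
        hl1.le (by linarith)
      rw [sin_pi_sub] at this
      linarith
    have hVl : ∀ θ, sin θ = σ₁ → angPot a E L K θ < 0 := fun θ h =>
      angPot_neg_of_sin_le hL hK (by rw [h]; exact hσ0) h.le
    have hG : ContDiffOn ℝ 1 (angForce a E L) (Icc l (π - l)) := by
      unfold angForce
      refine contDiff_cos.contDiffOn.mul (ContDiffOn.sub (ContDiffOn.div contDiffOn_const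
        (contDiff_sin.contDiffOn.pow 3) fun θ hθ => pow_ne_zero 3 (hne θ hθ))
        (contDiffOn_const.mul contDiff_sin.contDiffOn))
    obtain ⟨x, u, hx0, hu0, hx, huc, hu, hen⟩ := exists_clamped_solution (by linarith) hG
      (fun θ hθ => hasDerivAt_angPot a E L K (Or.inl (hne θ hθ))) θ₀ u₀ hu₀
    have hxc : Continuous x := continuous_iff_continuousAt.2 fun s => (hx s).continuousAt
    have hmem : ∀ s, 0 ≤ s → x s ∈ Icc l (π - l) := by
      intro s hs
      by_contra hcon
      have hf : Continuous fun s => min (x s) (π - x s) := by fun_prop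
      obtain ⟨s', h1, h2, h3, h4⟩ := exists_first_hit hf hs (c := l)
        (by simp only [hx0]; exact lt_min hlθ (by linarith)) (by
          by_contra! h
          obtain ⟨h1, h2⟩ := lt_min_iff.1 h
          exact hcon ⟨h1.le, by linarith⟩)
      have h5 : sin (x s') = σ₁ := by
        rcases min_choice (x s') (π - x s') with h | h
        · rw [← hsl, ← h3, h]
        · rw [← hsl, ← h3, h, sin_pi_sub]
      have h6 := hen s' h1.le fun σ hσ => by
        have h7 : l ≤ min (x σ) (π - x σ) := by
          rcases hσ.2.lt_or_eq with h | h
          · exact (h4 σ ⟨hσ.1, h⟩).le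
          · rw [h, h3]
        obtain ⟨h8, h9⟩ := le_min_iff.1 h7
        exact ⟨h8, by linarith⟩
      have := hVl _ h5
      linarith [sq_nonneg (u s')]
    exact ⟨x, u, hx0, hu0, hxc, huc, fun s hs => ⟨hx s, hu s (hmem s hs),
      Or.inl (hne _ (hmem s hs)), hen s hs fun σ hσ => hmem σ hσ.1⟩⟩

/-! ### Hamilton's equations -/

theorem rPlus_pos (a : ℝ) : 0 < rPlus a := zero_lt_one.trans_le (one_le_rPlus a)

theorem one_le_rhoSq {a r θ : ℝ} (h : 1 ≤ r) : 1 ≤ rhoSq a r θ := by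
  unfold rhoSq
  nlinarith [sq_nonneg (a * cos θ)]

theorem rhoSq_pos {a r : ℝ} (θ : ℝ) (h : rPlus a < r) : 0 < rhoSq a r θ :=
  zero_lt_one.trans_le (one_le_rhoSq ((one_le_rPlus a).trans h.le))

theorem hamiltonian_expand (a : ℝ) (x p : Fin 4 → ℝ) :
    hamiltonian a x p = (1 / 2) *
      (-(kerrA a (x 1) (x 2) / (rhoSq a (x 1) (x 2) * kerrDelta a (x 1))) * p 0 ^ 2
        + 2 * -(2 * a * x 1 / (rhoSq a (x 1) (x 2) * kerrDelta a (x 1))) * p 0 * p 3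
        + kerrDelta a (x 1) / rhoSq a (x 1) (x 2) * p 1 ^ 2 + 1 / rhoSq a (x 1) (x 2) * p 2 ^ 2
        + (1 / sin (x 2) ^ 2 - a ^ 2 / kerrDelta a (x 1)) / rhoSq a (x 1) (x 2) * p 3 ^ 2) := by
  simp [hamiltonian, cometric, Matrix.mulVec, dotProduct, Fin.sum_univ_four]
  ring

/-- The separated form of the Hamiltonian. -/
theorem hamiltonian_eq {a : ℝ} {x p : Fin 4 → ℝ} (hx : rPlus a < x 1)
    (hs : sin (x 2) ≠ 0 ∨ p 3 = 0) :
    hamiltonian a x p = (kerrDelta a (x 1) * p 1 ^ 2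
      - radP a (p 0) (-p 3) (x 1) ^ 2 / kerrDelta a (x 1) + p 2 ^ 2
      - angPot a (p 0) (-p 3) 0 (x 2)) / (2 * rhoSq a (x 1) (x 2)) := by
  rw [hamiltonian_expand]
  have hΔ := (kerrDelta_pos hx).ne'
  have hρ := (rhoSq_pos (x 2) hx).ne'
  have hA : kerrA a (x 1) (x 2) =
    ((x 1) ^ 2 + a ^ 2) ^ 2 - a ^ 2 * kerrDelta a (x 1) * sin (x 2) ^ 2 := rfl
  have h2r : 2 * x 1 = (x 1) ^ 2 + a ^ 2 - kerrDelta a (x 1) := by unfold kerrDelta; ring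
  have h2 : 2 * -(2 * a * x 1 / (rhoSq a (x 1) (x 2) * kerrDelta a (x 1))) =
      -(2 * a * ((x 1) ^ 2 + a ^ 2 - kerrDelta a (x 1)) /
        (rhoSq a (x 1) (x 2) * kerrDelta a (x 1))) := by
    rw [← h2r]; ring
  rw [h2, hA, radP, angPot]
  generalize kerrDelta a (x 1) = Δ at *
  generalize rhoSq a (x 1) (x 2) = ρ at *
  rcases hs with hs | hs
  · field_simp
    ring
  · simp only [hs, neg_zero, zero_div]
    field_simp
    ring

theorem hasDerivAt_hamiltonian_p0 (a : ℝ) (x p : Fin 4 → ℝ) :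
    HasDerivAt (fun y => hamiltonian a x (Function.update p 0 y))
      (-(kerrA a (x 1) (x 2) / (rhoSq a (x 1) (x 2) * kerrDelta a (x 1))) * p 0
        - 2 * a * x 1 / (rhoSq a (x 1) (x 2) * kerrDelta a (x 1)) * p 3) (p 0) := by
  simp only [hamiltonian_expand]
  simp [Function.update]
  generalize kerrA a (x 1) (x 2) / (rhoSq a (x 1) (x 2) * kerrDelta a (x 1)) = A
  generalize 2 * a * x 1 / (rhoSq a (x 1) (x 2) * kerrDelta a (x 1)) = B
  generalize kerrDelta a (x 1) / rhoSq a (x 1) (x 2) * p 1 ^ 2 = C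
  generalize (rhoSq a (x 1) (x 2))⁻¹ * p 2 ^ 2 = D
  generalize (((sin (x 2) ^ 2)⁻¹ - a ^ 2 / kerrDelta a (x 1)) / rhoSq a (x 1) (x 2)) * p 3 ^ 2 = F
  have h := (((((((hasDerivAt_id (p 0)).pow 2).const_mul A).neg.sub
    (((hasDerivAt_id (p 0)).const_mul (2 * B)).mul_const (p 3))).add_const C).add_const
      D).add_const F).const_mul (1 / 2)
  convert! h using 1
  · funext y; simp; ring
  · simp; ring

theorem hasDerivAt_hamiltonian_p3 (a : ℝ) (x p : Fin 4 → ℝ) :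
    HasDerivAt (fun y => hamiltonian a x (Function.update p 3 y))
      (-(2 * a * x 1 / (rhoSq a (x 1) (x 2) * kerrDelta a (x 1))) * p 0
        + (1 / sin (x 2) ^ 2 - a ^ 2 / kerrDelta a (x 1)) / rhoSq a (x 1) (x 2) * p 3)
      (p 3) := by
  simp only [hamiltonian_expand]
  simp [Function.update]
  generalize kerrA a (x 1) (x 2) / (rhoSq a (x 1) (x 2) * kerrDelta a (x 1)) * p 0 ^ 2 = A
  generalize 2 * a * x 1 / (rhoSq a (x 1) (x 2) * kerrDelta a (x 1)) = B
  generalize kerrDelta a (x 1) / rhoSq a (x 1) (x 2) * p 1 ^ 2 = C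
  generalize (rhoSq a (x 1) (x 2))⁻¹ * p 2 ^ 2 = D
  generalize ((sin (x 2) ^ 2)⁻¹ - a ^ 2 / kerrDelta a (x 1)) / rhoSq a (x 1) (x 2) = F
  have h := (((((hasDerivAt_id (p 3)).pow 2).const_mul F).sub
    ((hasDerivAt_id (p 3)).const_mul (2 * B * p 0))).add_const (C + D - A)).const_mul (1 / 2)
  convert! h using 1
  · funext y; simp; ring
  · simp; ring

theorem hasDerivAt_hamiltonian_p1 (a : ℝ) (x p : Fin 4 → ℝ) :
    HasDerivAt (fun y => hamiltonian a x (Function.update p 1 y))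
      (kerrDelta a (x 1) * p 1 / rhoSq a (x 1) (x 2)) (p 1) := by
  simp only [hamiltonian_expand]
  simp [Function.update]
  have h := ((((((hasDerivAt_id (p 1)).pow 2).const_mul
    (kerrDelta a (x 1) / rhoSq a (x 1) (x 2))).const_add
    (-(kerrA a (x 1) (x 2) / (rhoSq a (x 1) (x 2) * kerrDelta a (x 1)) * p 0 ^ 2) +
      -(2 * (2 * a * x 1 / (rhoSq a (x 1) (x 2) * kerrDelta a (x 1))) * p 0 * p 3))).add_const
    ((rhoSq a (x 1) (x 2))⁻¹ * p 2 ^ 2)).add_const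
    (((sin (x 2) ^ 2)⁻¹ - a ^ 2 / kerrDelta a (x 1)) / rhoSq a (x 1) (x 2) * p 3 ^ 2)).const_mul
    (2⁻¹ : ℝ)
  convert! h using 1
  simp; ring

theorem hasDerivAt_hamiltonian_p2 (a : ℝ) (x p : Fin 4 → ℝ) :
    HasDerivAt (fun y => hamiltonian a x (Function.update p 2 y))
      (p 2 / rhoSq a (x 1) (x 2)) (p 2) := by
  simp only [hamiltonian_expand]
  simp [Function.update]
  have h := (((((hasDerivAt_id (p 2)).pow 2).const_mul
    ((rhoSq a (x 1) (x 2))⁻¹)).const_add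
    (-(kerrA a (x 1) (x 2) / (rhoSq a (x 1) (x 2) * kerrDelta a (x 1)) * p 0 ^ 2) +
      -(2 * (2 * a * x 1 / (rhoSq a (x 1) (x 2) * kerrDelta a (x 1))) * p 0 * p 3) +
      kerrDelta a (x 1) / rhoSq a (x 1) (x 2) * p 1 ^ 2)).add_const
    (((sin (x 2) ^ 2)⁻¹ - a ^ 2 / kerrDelta a (x 1)) / rhoSq a (x 1) (x 2) * p 3 ^ 2)).const_mul
    (2⁻¹ : ℝ)
  convert! h using 1
  simp; ring

theorem hasDerivAt_hamiltonian_x0 (a : ℝ) (x p : Fin 4 → ℝ) :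
    HasDerivAt (fun y => hamiltonian a (Function.update x 0 y) p) 0 (x 0) := by
  simp only [hamiltonian_expand]
  simp [Function.update]
  exact hasDerivAt_const _ _

theorem hasDerivAt_hamiltonian_x3 (a : ℝ) (x p : Fin 4 → ℝ) :
    HasDerivAt (fun y => hamiltonian a (Function.update x 3 y) p) 0 (x 3) := by
  simp only [hamiltonian_expand]
  simp [Function.update]
  exact hasDerivAt_const _ _

theorem hasDerivAt_rhoSq_r (a r θ : ℝ) : HasDerivAt (fun r => rhoSq a r θ) (2 * r) r := by
  have := ((hasDerivAt_id r).pow 2).add_const (a ^ 2 * cos θ ^ 2)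
  convert! this using 1
  simp

theorem hasDerivAt_rhoSq_θ (a r θ : ℝ) :
    HasDerivAt (fun θ => rhoSq a r θ) (-2 * a ^ 2 * cos θ * sin θ) θ := by
  have := (((hasDerivAt_cos θ).pow 2).const_mul (a ^ 2)).const_add (r ^ 2)
  convert! this using 1
  simp; ring

/-- The conformal factor `1 / ρ²` contributes a multiple of `H` itself. That term vanishes on null
beams, but it has to be kept, because conservation of `H` is derived from this formula. -/
theorem hasDerivAt_hamiltonian_x1 {a : ℝ} {x p : Fin 4 → ℝ} (hx : rPlus a < x 1)
    (hs : sin (x 2) ≠ 0 ∨ p 3 = 0) :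
    HasDerivAt (fun y => hamiltonian a (Function.update x 1 y) p)
      (((x 1 - 1) * p 1 ^ 2 - (radP a (p 0) (-p 3) (x 1) * (2 * p 0 * x 1) * kerrDelta a (x 1)
        - radP a (p 0) (-p 3) (x 1) ^ 2 * (x 1 - 1)) / kerrDelta a (x 1) ^ 2
        - 2 * hamiltonian a x p * x 1) / rhoSq a (x 1) (x 2)) (x 1) := by
  have hΔ := (kerrDelta_pos hx).ne'
  have hρ := (rhoSq_pos (x 2) hx).ne'
  have hev : (fun y => hamiltonian a (Function.update x 1 y) p) =ᶠ[𝓝 (x 1)] fun y =>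
      (kerrDelta a y * p 1 ^ 2 - radP a (p 0) (-p 3) y ^ 2 / kerrDelta a y + p 2 ^ 2
        - angPot a (p 0) (-p 3) 0 (x 2)) / (2 * rhoSq a y (x 2)) := by
    filter_upwards [Ioi_mem_nhds hx] with y hy
    rw [hamiltonian_eq (by simpa using hy) (by simpa using hs)]
    simp [Function.update]
  have h := (((((hasDerivAt_kerrDelta a (x 1)).mul_const (p 1 ^ 2)).sub
    (((hasDerivAt_radP a (p 0) (-p 3) (x 1)).pow 2).div (hasDerivAt_kerrDelta a (x 1)) hΔ)).add_const
    (p 2 ^ 2)).sub_const (angPot a (p 0) (-p 3) 0 (x 2))).div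
    ((hasDerivAt_rhoSq_r a (x 1) (x 2)).const_mul 2) (mul_ne_zero two_ne_zero hρ)
  refine (HasDerivAt.congr_of_eventuallyEq ?_ hev)
  rw [hamiltonian_eq hx hs]
  convert! h using 1
  simp only [Pi.sub_apply, Pi.div_apply, Pi.pow_apply]
  field_simp
  push_cast
  ring

theorem hasDerivAt_hamiltonian_x2 {a : ℝ} {x p : Fin 4 → ℝ} (hx : rPlus a < x 1)
    (hs : sin (x 2) ≠ 0 ∨ p 3 = 0) :
    HasDerivAt (fun y => hamiltonian a (Function.update x 2 y) p)
      ((-angForce a (p 0) (-p 3) (x 2) + 2 * hamiltonian a x p * a ^ 2 * cos (x 2) * sin (x 2)) /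
        rhoSq a (x 1) (x 2)) (x 2) := by
  have hρ := (rhoSq_pos (x 2) hx).ne'
  have hnhds : ∀ᶠ y in 𝓝 (x 2), sin y ≠ 0 ∨ p 3 = 0 := by
    rcases hs with hs | hs
    · filter_upwards [continuous_sin.continuousAt.eventually_ne hs] with y hy using Or.inl hy
    · exact Eventually.of_forall fun _ => Or.inr hs
  have hev : (fun y => hamiltonian a (Function.update x 2 y) p) =ᶠ[𝓝 (x 2)] fun y =>
      (kerrDelta a (x 1) * p 1 ^ 2 - radP a (p 0) (-p 3) (x 1) ^ 2 / kerrDelta a (x 1) + p 2 ^ 2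
        - angPot a (p 0) (-p 3) 0 y) / (2 * rhoSq a (x 1) y) := by
    filter_upwards [hnhds] with y hy
    rw [hamiltonian_eq (by simpa using hx) (by simpa using hy)]
    simp [Function.update]
  have h := ((hasDerivAt_angPot a (p 0) (-p 3) 0 (θ := x 2) (by simpa using hs)).const_sub
    (kerrDelta a (x 1) * p 1 ^ 2 - radP a (p 0) (-p 3) (x 1) ^ 2 / kerrDelta a (x 1) +
      p 2 ^ 2)).div
    ((hasDerivAt_rhoSq_θ a (x 1) (x 2)).const_mul 2) (mul_ne_zero two_ne_zero hρ)
  refine (HasDerivAt.congr_of_eventuallyEq ?_ hev)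
  rw [hamiltonian_eq hx hs]
  convert! h using 1
  field_simp
  ring

/-! ### Light beams that fall onto the horizon -/

/-- Change of the time parameter: the inverse of `s ↦ ∫₀ˢ f`. -/
theorem exists_time_change {f : ℝ → ℝ} (hf : Continuous f) (h1 : ∀ s, 1 ≤ f s) :
    ∃ σ : ℝ → ℝ, σ 0 = 0 ∧ StrictMono σ ∧ Function.Surjective σ ∧
      ∀ τ, HasDerivAt σ (f (σ τ))⁻¹ τ := by
  set F : ℝ → ℝ := fun s => ∫ x in (0 : ℝ)..s, f x with hF
  have hd : ∀ s, HasDerivAt F (f s) s := fun s =>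
    intervalIntegral.integral_hasDerivAt_right (hf.intervalIntegrable _ _)
      hf.aestronglyMeasurable.stronglyMeasurableAtFilter hf.continuousAt
  have hF0 : F 0 = 0 := by simp [hF]
  have hFc : Continuous F := continuous_iff_continuousAt.2 fun s => (hd s).continuousAt
  have hmono : StrictMono F := strictMono_of_deriv_pos fun s => by
    rw [(hd s).deriv]; linarith [h1 s]
  -- Since `f ≥ 1`, the primitive `F` grows at least as fast as the identity, which gives
  -- surjectivity.
  have hlin : Monotone fun s => F s - s := monotone_of_deriv_nonneg
    (fun s => ((hd s).sub (hasDerivAt_id s)).differentiableAt) fun s => by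
      have := ((hd s).sub (hasDerivAt_id s)).deriv
      have h2 : deriv (fun s => F s - s) s = f s - 1 := this
      rw [h2]; linarith [h1 s]
  have hsurj : Function.Surjective F := by
    refine hFc.surjective ?_ ?_
    · refine tendsto_atTop_mono' atTop ?_ tendsto_id
      filter_upwards [eventually_ge_atTop 0] with s hs
      have := hlin hs
      simp only [hF0, id] at this ⊢; linarith
    · refine tendsto_atBot_mono' atBot ?_ tendsto_id
      filter_upwards [eventually_le_atBot 0] with s hs
      have := hlin hs
      simp only [hF0, id] at this ⊢; linarith
  set e := hmono.orderIsoOfSurjective F hsurj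
  have he : ∀ s, e s = F s := fun s => rfl
  refine ⟨e.symm, ?_, e.symm.strictMono, e.symm.surjective, fun τ => ?_⟩
  · rw [OrderIso.symm_apply_eq, he, hF0]
  · refine HasDerivAt.of_local_left_inverse (f := F) e.symm.continuous.continuousAt (hd _)
      (by linarith [h1 (e.symm τ)]) (Eventually.of_forall fun y => ?_)
    rw [← he]; exact e.apply_symm_apply y

theorem hasDerivAt_integral_of_continuousOn_Iio {h : ℝ → ℝ} {T τ : ℝ} (hh : ContinuousOn h (Iio T))
    (hT : 0 < T) (hτ : τ < T) : HasDerivAt (fun u => ∫ x in (0 : ℝ)..u, h x) (h τ) τ := by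
  have hsub : uIcc 0 τ ⊆ Iio T := fun y hy => (hy.2.trans_lt (sup_lt_iff.2 ⟨hT, hτ⟩))
  exact intervalIntegral.integral_hasDerivAt_right (hh.mono hsub).intervalIntegrable
    (hh.stronglyMeasurableAtFilter isOpen_Iio τ hτ) (hh.continuousAt (Iio_mem_nhds hτ))

/-- The separated radial and angular motions in Mino time assemble into a solution of Hamilton's
equations: `p_r = v / Δ`, `p_θ = u`, the parameter is changed by `dτ = ρ² ds`, and `t`, `φ` are
quadratures. As `ρ²` is bounded on `[0, S]`, the horizon is reached at a finite `T`. The argument of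
the quadratures is frozen for `τ < 0` so that they are differentiable on both sides of `τ = 0`. -/
theorem evolvesOntoHorizon_of_radialInfall {a E L K r₀ θ₀ t₀ φ₀ v₀ u₀ : ℝ} {w : Fin 4 → ℝ}
    (hθ₀ : θ₀ ∈ Ioo 0 π) (hrad : RadialInfall a E L K r₀ v₀)
    (hu₀ : u₀ ^ 2 = angPot a E L K θ₀)
    (hw : Matrix.mulVec (metric a ![t₀, r₀, θ₀, φ₀]) w = ![E, v₀ / kerrDelta a r₀, u₀, -L]) :
    EvolvesOntoHorizon a ![t₀, r₀, θ₀, φ₀] w := by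
  obtain ⟨S, r, v, hS, hr0, hv0, hrc, hvc, hrS, hrlt, hrv⟩ := hrad
  obtain ⟨θ, u, hθ0, hu0, hθc, huc, hθu⟩ := exists_angular_motion hθ₀ hu₀
  have hrge : ∀ s ∈ Icc 0 S, rPlus a ≤ r s := fun s hs => by
    rcases hs.2.lt_or_eq with h | h
    · exact (hrlt s ⟨hs.1, h⟩).le
    · rw [h, hrS]
  -- The radial motion is controlled only on `[0, S]`; clamping makes the bound `ρ² ≥ 1` hold for
  -- all parameters.
  set cl : ℝ → ℝ := fun s => projIcc 0 S hS.le s with hcl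
  have hclc : Continuous cl := continuous_subtype_val.comp continuous_projIcc
  have hclm : ∀ s, cl s ∈ Icc 0 S := fun s => (projIcc 0 S hS.le s).2
  have hcl_eq : ∀ s ∈ Icc 0 S, cl s = s := fun s hs => by
    simp only [cl]; rw [projIcc_of_mem hS.le hs]
  set f : ℝ → ℝ := fun s => rhoSq a (r (cl s)) (θ (cl s)) with hf
  have hfc : Continuous f := by
    simp only [hf, rhoSq]
    have := hrc.comp hclc
    have := hθc.comp hclc
    fun_prop
  have hf1 : ∀ s, 1 ≤ f s := fun s =>
    one_le_rhoSq ((one_le_rPlus a).trans (hrge _ (hclm s)))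
  obtain ⟨σ, hσ0, hσm, hσs, hσd⟩ := exists_time_change hfc hf1
  have hσc : Continuous σ := continuous_iff_continuousAt.2 fun s => (hσd s).continuousAt
  obtain ⟨T, hT⟩ := hσs S
  have hT0 : 0 < T := by rw [← hσm.lt_iff_lt, hσ0, hT]; exact hS
  have hσmem : ∀ τ, 0 ≤ τ → τ < T → σ τ ∈ Ico 0 S := fun τ h0 h1 =>
    ⟨by rw [← hσ0]; exact hσm.monotone h0, by rw [← hT]; exact hσm h1⟩
  -- the coordinates `t` and `φ` are obtained by integration
  set σ' : ℝ → ℝ := fun τ => σ (max τ 0) with hσ'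
  have hσ'c : Continuous σ' := by fun_prop
  have hσ'm : ∀ τ ∈ Iio T, σ' τ ∈ Ico 0 S := fun τ hτ =>
    hσmem _ (le_max_right _ _) (max_lt hτ hT0)
  have hΔ' : ∀ τ ∈ Iio T, kerrDelta a (r (σ' τ)) ≠ 0 := fun τ hτ =>
    (kerrDelta_pos (hrlt _ (hσ'm τ hτ))).ne'
  have hρ' : ∀ τ ∈ Iio T, rhoSq a (r (σ' τ)) (θ (σ' τ)) ≠ 0 := fun τ hτ =>
    (rhoSq_pos _ (hrlt _ (hσ'm τ hτ))).ne'
  have hrσ' : Continuous fun τ => r (σ' τ) := hrc.comp hσ'c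
  have hθσ' : Continuous fun τ => θ (σ' τ) := hθc.comp hσ'c
  have hρc : Continuous fun τ => rhoSq a (r (σ' τ)) (θ (σ' τ)) := by unfold rhoSq; fun_prop
  have hΔc : Continuous fun τ => kerrDelta a (r (σ' τ)) := by unfold kerrDelta; fun_prop
  have hAc : Continuous fun τ => kerrA a (r (σ' τ)) (θ (σ' τ)) := by
    unfold kerrA kerrDelta; fun_prop
  set ht : ℝ → ℝ := fun τ =>
    -(kerrA a (r (σ' τ)) (θ (σ' τ)) /
        (rhoSq a (r (σ' τ)) (θ (σ' τ)) * kerrDelta a (r (σ' τ)))) * E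
      - 2 * a * r (σ' τ) / (rhoSq a (r (σ' τ)) (θ (σ' τ)) * kerrDelta a (r (σ' τ))) * -L with hht
  set hφ : ℝ → ℝ := fun τ =>
    -(2 * a * r (σ' τ) / (rhoSq a (r (σ' τ)) (θ (σ' τ)) * kerrDelta a (r (σ' τ)))) * E
      + (1 / sin (θ (σ' τ)) ^ 2 - a ^ 2 / kerrDelta a (r (σ' τ))) /
        rhoSq a (r (σ' τ)) (θ (σ' τ)) * -L with hhφ
  have htc : ContinuousOn ht (Iio T) := by
    have hne : ∀ τ ∈ Iio T, rhoSq a (r (σ' τ)) (θ (σ' τ)) * kerrDelta a (r (σ' τ)) ≠ 0 :=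
      fun τ hτ => mul_ne_zero (hρ' τ hτ) (hΔ' τ hτ)
    refine ((ContinuousOn.div hAc.continuousOn (hρc.mul hΔc).continuousOn hne).neg.mul
      continuousOn_const).sub ((ContinuousOn.div (by fun_prop) (hρc.mul hΔc).continuousOn hne).mul
      continuousOn_const)
  have hφc : ContinuousOn hφ (Iio T) := by
    have hne : ∀ τ ∈ Iio T, rhoSq a (r (σ' τ)) (θ (σ' τ)) * kerrDelta a (r (σ' τ)) ≠ 0 :=
      fun τ hτ => mul_ne_zero (hρ' τ hτ) (hΔ' τ hτ)
    refine ((ContinuousOn.div (by fun_prop) (hρc.mul hΔc).continuousOn hne).neg.mul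
      continuousOn_const).add ?_
    by_cases hL : L = 0
    · simp only [hL, neg_zero, mul_zero]; exact continuousOn_const
    · refine (ContinuousOn.div ((ContinuousOn.div continuousOn_const (by fun_prop) ?_).sub
        (ContinuousOn.div continuousOn_const hΔc.continuousOn hΔ')) hρc.continuousOn hρ').mul
        continuousOn_const
      intro τ hτ
      have := (hθu _ (hσ'm τ hτ).1).2.2.1
      exact pow_ne_zero 2 (this.resolve_right hL)
  refine ⟨(T : EReal), fun τ => ![t₀ + ∫ y in (0 : ℝ)..τ, ht y, r (σ τ), θ (σ τ),
      φ₀ + ∫ y in (0 : ℝ)..τ, hφ y],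
    fun τ => ![E, v (σ τ) / kerrDelta a (r (σ τ)), u (σ τ), -L], by exact_mod_cast hT0, ?_, ?_,
    ?_, ?_⟩
  · simp [hσ0, hr0, hθ0]
  · rw [hw]; simp [hσ0, hr0, hv0, hu0]
  · intro τ hτ0 hτT
    have hτT' : τ < T := by exact_mod_cast hτT
    have hs := hσmem τ hτ0 hτT'
    have hs' : σ τ ∈ Icc 0 S := Ico_subset_Icc_self hs
    have hrs : rPlus a < r (σ τ) := hrlt _ hs
    have hΔ := (kerrDelta_pos hrs).ne'
    have hρ := (rhoSq_pos (θ (σ τ)) hrs).ne'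
    have hσ'τ : σ' τ = σ τ := by simp only [hσ', max_eq_left hτ0]
    have hfσ : f (σ τ) = rhoSq a (r (σ τ)) (θ (σ τ)) := by simp only [hf, hcl_eq _ hs']
    have hσd' := hσd τ
    rw [hfσ] at hσd'
    obtain ⟨hdr, hdv, hev⟩ := hrv _ hs'
    obtain ⟨hdθ, hdu, hsin, heu⟩ := hθu _ hs.1
    have hdrτ := hdr.comp τ hσd'
    have hdvτ := hdv.comp τ hσd'
    have hdθτ := hdθ.comp τ hσd'
    have hduτ := hdu.comp τ hσd'
    set X : Fin 4 → ℝ := ![t₀ + ∫ y in (0 : ℝ)..τ, ht y, r (σ τ), θ (σ τ),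
      φ₀ + ∫ y in (0 : ℝ)..τ, hφ y] with hX
    set P : Fin 4 → ℝ := ![E, v (σ τ) / kerrDelta a (r (σ τ)), u (σ τ), -L] with hPdef
    have hX1 : X 1 = r (σ τ) := rfl
    have hX2 : X 2 = θ (σ τ) := rfl
    have hP0 : P 0 = E := rfl
    have hP1 : P 1 = v (σ τ) / kerrDelta a (r (σ τ)) := rfl
    have hP2 : P 2 = u (σ τ) := rfl
    have hP3 : P 3 = -L := rfl
    have hsin' : sin (X 2) ≠ 0 ∨ P 3 = 0 := by rw [hX2, hP3, neg_eq_zero]; exact hsin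
    -- In the separated form, the radial and the angular energy relations contribute `-K` and `K`.
    have hH : hamiltonian a X P = 0 := by
      rw [hamiltonian_eq (by rwa [hX1]) hsin', hX1, hX2, hP0, hP1, hP2, hP3, neg_neg, heu, div_pow,
        hev, div_eq_zero_iff]
      left
      unfold angPot radR
      field_simp
      ring
    refine ⟨hrs, fun i => ?_⟩
    fin_cases i
    · refine ⟨?_, ?_⟩
      · refine HasDerivAt.hasDerivWithinAt ?_
        have h1 := (hasDerivAt_hamiltonian_p0 a X P).deriv
        have h2 := (hasDerivAt_integral_of_continuousOn_Iio htc hT0 hτT').const_add t₀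
        change HasDerivAt (fun τ => t₀ + ∫ y in (0 : ℝ)..τ, ht y)
          (deriv (fun y => hamiltonian a X (Function.update P 0 y)) (P 0)) τ
        rw [h1]
        simp only [hht, hσ'τ] at h2
        exact h2
      · change HasDerivWithinAt (fun _ => E)
          (-deriv (fun y => hamiltonian a (Function.update X 0 y) P) (X 0)) _ _
        rw [(hasDerivAt_hamiltonian_x0 a X P).deriv, neg_zero]
        exact hasDerivWithinAt_const _ _ _
    · refine ⟨?_, ?_⟩
      · change HasDerivWithinAt (fun τ => r (σ τ))
          (deriv (fun y => hamiltonian a X (Function.update P 1 y)) (P 1)) _ _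
        rw [(hasDerivAt_hamiltonian_p1 a X P).deriv, hX1, hX2, hP1]
        convert! hdrτ.hasDerivWithinAt using 1
        field_simp
      · change HasDerivWithinAt (fun τ => v (σ τ) / kerrDelta a (r (σ τ)))
          (-deriv (fun y => hamiltonian a (Function.update X 1 y) P) (X 1)) _ _
        rw [(hasDerivAt_hamiltonian_x1 (by rwa [hX1]) hsin').deriv, hH, mul_zero,
          zero_mul, sub_zero, hX1, hX2, hP0, hP1, hP3,
          neg_neg]
        have hdΔ : HasDerivAt (fun τ => kerrDelta a (r (σ τ))) (2 * (r (σ τ) - 1) *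
            (v (σ τ) * (rhoSq a (r (σ τ)) (θ (σ τ)))⁻¹)) τ :=
          HasDerivAt.comp (h₂ := kerrDelta a) (h := fun τ => r (σ τ)) τ
            (hasDerivAt_kerrDelta a (r (σ τ))) hdrτ
        have h := hdvτ.div hdΔ hΔ
        convert! h.hasDerivWithinAt using 1
        simp only [Function.comp]
        rw [div_pow, hev]
        have h3 : v (σ τ) * (2 * (r (σ τ) - 1) * (v (σ τ) * (rhoSq a (r (σ τ)) (θ (σ τ)))⁻¹)) =
          2 * (r (σ τ) - 1) * radR a E L K (r (σ τ)) * (rhoSq a (r (σ τ)) (θ (σ τ)))⁻¹ := by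
          rw [← hev]; ring
        rw [h3]
        unfold radR radForce
        field_simp
        ring
    · refine ⟨?_, ?_⟩
      · change HasDerivWithinAt (fun τ => θ (σ τ))
          (deriv (fun y => hamiltonian a X (Function.update P 2 y)) (P 2)) _ _
        rw [(hasDerivAt_hamiltonian_p2 a X P).deriv, hX1, hX2, hP2]
        convert! hdθτ.hasDerivWithinAt using 1
      · change HasDerivWithinAt (fun τ => u (σ τ))
          (-deriv (fun y => hamiltonian a (Function.update X 2 y) P) (X 2)) _ _
        rw [(hasDerivAt_hamiltonian_x2 (by rwa [hX1]) hsin').deriv, hH, hX1, hX2, hP0, hP3,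
          neg_neg]
        convert! hduτ.hasDerivWithinAt using 1
        ring
    · refine ⟨?_, ?_⟩
      · refine HasDerivAt.hasDerivWithinAt ?_
        have h1 := (hasDerivAt_hamiltonian_p3 a X P).deriv
        have h2 := (hasDerivAt_integral_of_continuousOn_Iio hφc hT0 hτT').const_add φ₀
        change HasDerivAt (fun τ => φ₀ + ∫ y in (0 : ℝ)..τ, hφ y)
          (deriv (fun y => hamiltonian a X (Function.update P 3 y)) (P 3)) τ
        rw [h1]
        simp only [hhφ, hσ'τ] at h2
        exact h2
      · change HasDerivWithinAt (fun _ => -L)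
          (-deriv (fun y => hamiltonian a (Function.update X 3 y) P) (X 3)) _ _
        rw [(hasDerivAt_hamiltonian_x3 a X P).deriv, neg_zero]
        exact hasDerivWithinAt_const _ _ _
  · have h1 : Tendsto (fun τ => r (σ τ)) (𝓝 T) (𝓝 (rPlus a)) := by
      have := (hrc.comp hσc).tendsto T
      simpa [hT, hrS, Function.comp_def] using this
    refine h1.mono_left ?_
    have h2 : comap (fun τ : ℝ => (τ : EReal)) (𝓝 (T : EReal)) = 𝓝 T :=
      (EReal.isEmbedding_coe.nhds_eq_comap T).symm
    rw [← h2]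
    exact comap_mono nhdsWithin_le_nhds

/-! ### Conserved quantities and light beams that do not fall onto the horizon -/

theorem continuousOn_of_hasDerivWithinAt_Ici {f f' : ℝ → ℝ} {b : ℝ}
    (hf : ∀ s ∈ Icc 0 b, HasDerivWithinAt f (f' s) (Ici 0) s) : ContinuousOn f (Icc 0 b) :=
  fun s hs => (hf s hs).continuousWithinAt.mono Icc_subset_Ici_self

theorem eq_of_hasDerivWithinAt_zero {f : ℝ → ℝ} {b : ℝ} (hb : 0 ≤ b)
    (hf : ∀ s ∈ Icc 0 b, HasDerivWithinAt f 0 (Ici 0) s) : f b = f 0 :=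
  constant_of_has_deriv_right_zero (continuousOn_of_hasDerivWithinAt_Ici (f' := 0) hf)
    (fun s hs => (hf s ⟨hs.1, hs.2.le⟩).mono (Ici_subset_Ici.2 hs.1)) b ⟨hb, le_rfl⟩

theorem exists_first_hit_Icc {f : ℝ → ℝ} {t c : ℝ} (h0t : 0 ≤ t) (hf : ContinuousOn f (Icc 0 t))
    (h0 : c < f 0) (ht : f t ≤ c) : ∃ s, 0 < s ∧ s ≤ t ∧ f s = c ∧ ∀ τ ∈ Ico 0 s, c < f τ := by
  have hc : Continuous (IccExtend h0t ((Icc 0 t).domRestrict f)) :=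
    (continuousOn_iff_continuous_domRestrict.1 hf).Icc_extend'
  have he : ∀ s ∈ Icc 0 t, IccExtend h0t ((Icc 0 t).domRestrict f) s = f s := fun s hs => by
    rw [IccExtend_of_mem _ _ hs]; rfl
  obtain ⟨s, h1, h2, h3, h4⟩ := exists_first_hit hc h0t (c := c)
    (by rwa [he 0 ⟨le_rfl, h0t⟩]) (by rwa [he t ⟨h0t, le_rfl⟩])
  refine ⟨s, h1, h2, by rw [← he s ⟨h1.le, h2⟩, h3], fun τ hτ => ?_⟩
  rw [← he τ ⟨hτ.1, hτ.2.le.trans h2⟩]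
  exact h4 τ hτ

/-- The separated form of `H` is available only off the axis or for `L = 0`, hence the hypothesis
along the whole path. Differentiation gives `H' = 0`, and the initial data give `H = 0`. Then
Carter's constant is conserved, and `H = 0` turns it into the radial relation. -/
theorem IsGeodesic.conserved_aux {a E L K : ℝ} {T : EReal} {x p : ℝ → Fin 4 → ℝ} {t : ℝ}
    (hg : IsGeodesic a T x p) (h0t : 0 ≤ t) (htT : (t : EReal) < T)
    (hp0 : p 0 0 = E) (hp3 : p 0 3 = -L) (hK : p 0 2 ^ 2 = angPot a E L K (x 0 2))
    (hR : (kerrDelta a (x 0 1) * p 0 1) ^ 2 = radR a E L K (x 0 1))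
    (hsin : ∀ τ ∈ Icc 0 t, sin (x τ 2) ≠ 0 ∨ L = 0) :
    p t 0 = E ∧ p t 3 = -L ∧ p t 2 ^ 2 = angPot a E L K (x t 2) ∧
      (kerrDelta a (x t 1) * p t 1) ^ 2 = radR a E L K (x t 1) := by
  have hg' : ∀ τ ∈ Icc 0 t, _ := fun τ hτ =>
    hg τ hτ.1 ((EReal.coe_le_coe_iff.2 hτ.2).trans_lt htT)
  have hc0 : ∀ τ ∈ Icc 0 t, p τ 0 = E := fun τ hτ => by
    rw [← hp0]
    refine eq_of_hasDerivWithinAt_zero (f := fun σ => p σ 0) hτ.1 fun σ hσ => ?_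
    have h := ((hg' σ ⟨hσ.1, hσ.2.trans hτ.2⟩).2 0).2
    rwa [(hasDerivAt_hamiltonian_x0 a _ _).deriv, neg_zero] at h
  have hc3 : ∀ τ ∈ Icc 0 t, p τ 3 = -L := fun τ hτ => by
    rw [← hp3]
    refine eq_of_hasDerivWithinAt_zero (f := fun σ => p σ 3) hτ.1 fun σ hσ => ?_
    have h := ((hg' σ ⟨hσ.1, hσ.2.trans hτ.2⟩).2 3).2
    rwa [(hasDerivAt_hamiltonian_x3 a _ _).deriv, neg_zero] at h
  set H : ℝ → ℝ := fun τ => (kerrDelta a (x τ 1) * p τ 1 ^ 2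
      - radP a E L (x τ 1) ^ 2 / kerrDelta a (x τ 1) + p τ 2 ^ 2
      - angPot a E L 0 (x τ 2)) / (2 * rhoSq a (x τ 1) (x τ 2)) with hHdef
  have hHeq : ∀ τ ∈ Icc 0 t, hamiltonian a (x τ) (p τ) = H τ := fun τ hτ => by
    rw [hamiltonian_eq (hg' τ hτ).1
      (by rw [hc3 τ hτ, neg_eq_zero]; exact hsin τ hτ), hc0 τ hτ, hc3 τ hτ, neg_neg]
  have hdr : ∀ τ ∈ Icc 0 t, HasDerivWithinAt (fun σ => x σ 1)
      (kerrDelta a (x τ 1) * p τ 1 / rhoSq a (x τ 1) (x τ 2)) (Ici 0) τ := fun τ hτ => by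
    have h := ((hg' τ hτ).2 1).1
    rwa [(hasDerivAt_hamiltonian_p1 a _ _).deriv] at h
  have hdθ : ∀ τ ∈ Icc 0 t, HasDerivWithinAt (fun σ => x σ 2)
      (p τ 2 / rhoSq a (x τ 1) (x τ 2)) (Ici 0) τ := fun τ hτ => by
    have h := ((hg' τ hτ).2 2).1
    rwa [(hasDerivAt_hamiltonian_p2 a _ _).deriv] at h
  have hdp1 : ∀ τ ∈ Icc 0 t, HasDerivWithinAt (fun σ => p σ 1)
      (-(((x τ 1 - 1) * p τ 1 ^ 2 - (radP a E L (x τ 1) * (2 * E * x τ 1) * kerrDelta a (x τ 1)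
        - radP a E L (x τ 1) ^ 2 * (x τ 1 - 1)) / kerrDelta a (x τ 1) ^ 2
        - 2 * H τ * x τ 1) / rhoSq a (x τ 1) (x τ 2))) (Ici 0) τ := fun τ hτ => by
    have h := ((hg' τ hτ).2 1).2
    rwa [(hasDerivAt_hamiltonian_x1 (hg' τ hτ).1
      (by rw [hc3 τ hτ, neg_eq_zero]; exact hsin τ hτ)).deriv, hHeq τ hτ, hc0 τ hτ, hc3 τ hτ,
      neg_neg] at h
  have hdp2 : ∀ τ ∈ Icc 0 t, HasDerivWithinAt (fun σ => p σ 2)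
      (-((-angForce a E L (x τ 2) + 2 * H τ * a ^ 2 * cos (x τ 2) * sin (x τ 2)) /
        rhoSq a (x τ 1) (x τ 2))) (Ici 0) τ := fun τ hτ => by
    have h := ((hg' τ hτ).2 2).2
    rwa [(hasDerivAt_hamiltonian_x2 (hg' τ hτ).1
      (by rw [hc3 τ hτ, neg_eq_zero]; exact hsin τ hτ)).deriv, hHeq τ hτ, hc0 τ hτ, hc3 τ hτ,
      neg_neg] at h
  have hdΘ : ∀ τ ∈ Icc 0 t, HasDerivWithinAt (fun σ => angPot a E L 0 (x σ 2))
      (2 * angForce a E L (x τ 2) * (p τ 2 / rhoSq a (x τ 1) (x τ 2))) (Ici 0) τ := fun τ hτ =>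
    HasDerivAt.comp_hasDerivWithinAt (h₂ := angPot a E L 0) (h := fun σ => x σ 2) τ
      (hasDerivAt_angPot a E L 0 (hsin τ hτ)) (hdθ τ hτ)
  have hdH : ∀ τ ∈ Icc 0 t, HasDerivWithinAt H 0 (Ici 0) τ := fun τ hτ => by
    have hΔ := (kerrDelta_pos (hg' τ hτ).1).ne'
    have hρ := (rhoSq_pos (x τ 2) (hg' τ hτ).1).ne'
    have h1 : HasDerivWithinAt (fun σ => kerrDelta a (x σ 1)) _ (Ici 0) τ :=
      HasDerivAt.comp_hasDerivWithinAt (h₂ := kerrDelta a) (h := fun σ => x σ 1) τ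
        (hasDerivAt_kerrDelta a _) (hdr τ hτ)
    have h2 : HasDerivWithinAt (fun σ => radP a E L (x σ 1)) _ (Ici 0) τ :=
      HasDerivAt.comp_hasDerivWithinAt (h₂ := radP a E L) (h := fun σ => x σ 1) τ
        (hasDerivAt_radP a E L _) (hdr τ hτ)
    have h3 := ((hdr τ hτ).pow 2).add ((((hasDerivAt_cos _).comp_hasDerivWithinAt τ
      (hdθ τ hτ)).pow 2).const_mul (a ^ 2))
    have h4 := ((((h1.mul ((hdp1 τ hτ).pow 2)).sub ((h2.pow 2).div h1 hΔ)).add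
      ((hdp2 τ hτ).pow 2)).sub (hdΘ τ hτ)).div (h3.const_mul 2) (mul_ne_zero two_ne_zero hρ)
    convert! h4 using 1
    simp only [Pi.sub_apply, Pi.div_apply, Pi.pow_apply, Pi.mul_apply, Pi.add_apply,
      Function.comp_apply]
    rw [show x τ 1 ^ 2 + a ^ 2 * cos (x τ 2) ^ 2 = rhoSq a (x τ 1) (x τ 2) from rfl, hHdef]
    field_simp
    push_cast
    ring
  have hH0 : ∀ τ ∈ Icc 0 t, H τ = 0 := fun τ hτ => by
    rw [eq_of_hasDerivWithinAt_zero hτ.1 fun σ hσ => hdH σ ⟨hσ.1, hσ.2.trans hτ.2⟩]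
    have hΔ := (kerrDelta_pos (hg' 0 ⟨le_rfl, h0t⟩).1).ne'
    simp only [hHdef]
    rw [div_eq_zero_iff]
    left
    have h1 : kerrDelta a (x 0 1) * p 0 1 ^ 2 = radR a E L K (x 0 1) / kerrDelta a (x 0 1) := by
      rw [← hR]; field_simp
    rw [h1, hK]
    unfold radR angPot
    field_simp
    ring
  -- The derivative of `p_θ² - Θ` is a multiple of `H`, so Carter's constant is conserved because
  -- the beam is null.
  have hKt := eq_of_hasDerivWithinAt_zero (f := fun σ => p σ 2 ^ 2 - angPot a E L 0 (x σ 2)) h0t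
    fun σ hσ => by
      have h := ((hdp2 σ hσ).pow 2).sub (hdΘ σ hσ)
      convert! h using 1
      rw [hH0 σ hσ]
      push_cast
      ring
  have hK2 : p t 2 ^ 2 = angPot a E L K (x t 2) := by
    have h1 : ∀ θ, angPot a E L K θ = K + angPot a E L 0 θ := fun θ => by unfold angPot; ring
    simp only [hK, h1] at hKt ⊢
    linarith
  have ht : t ∈ Icc 0 t := ⟨h0t, le_rfl⟩
  refine ⟨hc0 t ht, hc3 t ht, hK2, ?_⟩
  have hΔ := (kerrDelta_pos (hg' t ht).1).ne'
  have h1 := hH0 t ht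
  simp only [hHdef] at h1
  rw [div_eq_zero_iff, or_iff_left (mul_ne_zero two_ne_zero (rhoSq_pos (x t 2) (hg' t ht).1).ne'),
    hK2] at h1
  have h2 : kerrDelta a (x t 1) * (kerrDelta a (x t 1) * p t 1 ^ 2) =
      kerrDelta a (x t 1) * (radP a E L (x t 1) ^ 2 / kerrDelta a (x t 1) - K) := by
    congr 1
    unfold angPot at h1
    linarith
  rw [mul_sub, mul_div_cancel₀ _ hΔ] at h2
  unfold radR
  linarith

/-- Along a light beam the energy `E`, the angular momentum `L` and Carter's constant `K` are
conserved, and the radial motion obeys `(Δ p_r)² = R(r)`. -/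
theorem IsGeodesic.conserved {a E L K : ℝ} {T : EReal} {x p : ℝ → Fin 4 → ℝ}
    (hg : IsGeodesic a T x p) (hθ₀ : sin (x 0 2) ≠ 0)
    (hp0 : p 0 0 = E) (hp3 : p 0 3 = -L) (hK : p 0 2 ^ 2 = angPot a E L K (x 0 2))
    (hR : (kerrDelta a (x 0 1) * p 0 1) ^ 2 = radR a E L K (x 0 1))
    {t : ℝ} (h0t : 0 ≤ t) (htT : (t : EReal) < T) :
    (kerrDelta a (x t 1) * p t 1) ^ 2 = radR a E L K (x t 1) := by
  have hlt : ∀ τ ≤ t, (τ : EReal) < T := fun τ hτ =>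
    (EReal.coe_le_coe_iff.2 hτ).trans_lt htT
  have hθc : ContinuousOn (fun σ => x σ 2) (Icc 0 t) :=
    continuousOn_of_hasDerivWithinAt_Ici fun τ hτ => ((hg τ hτ.1 (hlt τ hτ.2)).2 2).1
  refine (hg.conserved_aux h0t htT hp0 hp3 hK hR fun τ hτ => ?_).2.2.2
  by_contra! hcon
  obtain ⟨hsin, hL⟩ := hcon
  have hfc : ContinuousOn (fun σ => |sin (x σ 2)|) (Icc 0 t) :=
    (continuous_sin.comp_continuousOn hθc).abs
  obtain ⟨s, h1, h2, h3, h4⟩ := exists_first_hit_Icc hτ.1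
    (hfc.mono (Icc_subset_Icc_right hτ.2)) (c := 0) (abs_pos.2 hθ₀) (by simp [hsin])
  have hst : s ≤ t := h2.trans hτ.2
  -- Before the first arrival at the axis, Carter's constant bounds `|L| / |sin θ|`. The bound
  -- passes to the limit, where `sin θ = 0` would force `L = 0`.
  have hbound : ∀ σ ∈ Ico 0 s, |L| ≤ |sin (x σ 2)| * (√K + |a * E|) := fun σ hσ => by
    have h5 := (hg.conserved_aux hσ.1 (hlt σ (hσ.2.le.trans hst)) hp0 hp3 hK hR fun y hy =>
      Or.inl (abs_pos.1 (h4 y ⟨hy.1, hy.2.trans_lt hσ.2⟩))).2.2.1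
    have h6 : (L / sin (x σ 2) - a * E * sin (x σ 2)) ^ 2 ≤ K := by
      have := sq_nonneg (p σ 2)
      rw [h5, angPot] at this
      linarith
    have hs0 : sin (x σ 2) ≠ 0 := abs_pos.1 (h4 σ hσ)
    have h7 := abs_le_sqrt h6
    have h8 : |L / sin (x σ 2)| ≤ √K + |a * E| := by
      have h9 := abs_add_le (L / sin (x σ 2) - a * E * sin (x σ 2)) (a * E * sin (x σ 2))
      rw [sub_add_cancel, abs_mul (a * E)] at h9
      have h10 : |a * E| * |sin (x σ 2)| ≤ |a * E| :=
        mul_le_of_le_one_right (abs_nonneg _) (abs_sin_le_one _)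
      linarith
    rw [abs_div, div_le_iff₀ (h4 σ hσ), mul_comm] at h8
    exact h8
  have hcl : IsClosed {σ ∈ Icc 0 s | |L| ≤ |sin (x σ 2)| * (√K + |a * E|)} :=
    isClosed_Icc.isClosed_le continuousOn_const
      ((hfc.mono (Icc_subset_Icc_right hst)).mul continuousOn_const)
  have hsub : Ico 0 s ⊆ {σ ∈ Icc 0 s | |L| ≤ |sin (x σ 2)| * (√K + |a * E|)} :=
    fun σ hσ => ⟨Ico_subset_Icc_self hσ, hbound σ hσ⟩
  have hmem : s ∈ {σ ∈ Icc 0 s | |L| ≤ |sin (x σ 2)| * (√K + |a * E|)} :=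
    closure_minimal hsub hcl (by rw [closure_Ico h1.ne]; exact right_mem_Icc.2 h1.le)
  have h5 := hmem.2
  rw [h3, zero_mul] at h5
  exact hL (abs_eq_zero.1 (le_antisymm h5 (abs_nonneg _)))

/-- The initial data at `(t₀, r₀, θ₀, φ₀)` of a light beam with constants of motion `E`, `L`, `K`. -/
structure BeamData (a E L K r₀ θ₀ v₀ u₀ : ℝ) : Prop where
  radial : v₀ ^ 2 = radR a E L K r₀
  angular : u₀ ^ 2 = angPot a E L K θ₀

/-- Evolution onto the horizon asserts the existence of some solution, so every solution with the
given data must be excluded. The relation `v² = R(r)` and the sign of the initial velocity suffice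
for this, and no uniqueness theorem is needed. A uniform bound `c > r₊` on the radius contradicts
the limit. -/
theorem not_evolvesOntoHorizon_of_forall {a E L K r₀ θ₀ t₀ φ₀ v₀ u₀ c : ℝ} {w : Fin 4 → ℝ}
    (hr₀ : rPlus a < r₀) (hθ₀ : θ₀ ∈ Ioo 0 π) (hd : BeamData a E L K r₀ θ₀ v₀ u₀)
    (hw : Matrix.mulVec (metric a ![t₀, r₀, θ₀, φ₀]) w = ![E, v₀ / kerrDelta a r₀, u₀, -L])
    (hc : rPlus a < c)
    (h : ∀ (t : ℝ) (r v ρ : ℝ → ℝ), 0 ≤ t → r 0 = r₀ → v 0 = v₀ → ContinuousOn v (Icc 0 t) →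
      (∀ τ ∈ Icc 0 t, 0 < ρ τ ∧ HasDerivWithinAt r (v τ / ρ τ) (Ici 0) τ ∧
        v τ ^ 2 = radR a E L K (r τ)) → c ≤ r t) :
    ¬ EvolvesOntoHorizon a ![t₀, r₀, θ₀, φ₀] w := by
  rintro ⟨T, x, p, hT, hx0, hp0, hg, hlim⟩
  rw [hw] at hp0
  have hΔ := (kerrDelta_pos hr₀).ne'
  have hge : ∀ t : ℝ, 0 ≤ t → (t : EReal) < T → c ≤ x t 1 := by
    intro t h0t htT
    have hlt : ∀ τ ≤ t, (τ : EReal) < T := fun τ hτ =>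
      (EReal.coe_le_coe_iff.2 hτ).trans_lt htT
    have hr : ∀ τ ∈ Icc 0 t, HasDerivWithinAt (fun σ => x σ 1)
        (kerrDelta a (x τ 1) * p τ 1 / rhoSq a (x τ 1) (x τ 2)) (Ici 0) τ := fun τ hτ => by
      have h := ((hg τ hτ.1 (hlt τ hτ.2)).2 1).1
      rwa [(hasDerivAt_hamiltonian_p1 a _ _).deriv] at h
    have hp1c : ContinuousOn (fun σ => p σ 1) (Icc 0 t) :=
      continuousOn_of_hasDerivWithinAt_Ici fun τ hτ => ((hg τ hτ.1 (hlt τ hτ.2)).2 1).2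
    refine h t (fun τ => x τ 1) (fun τ => kerrDelta a (x τ 1) * p τ 1)
      (fun τ => rhoSq a (x τ 1) (x τ 2)) h0t (by simp [hx0]) ?_
      (((continuous_kerrDelta a).comp_continuousOn (continuousOn_of_hasDerivWithinAt_Ici hr)).mul
        hp1c) fun τ hτ => ⟨rhoSq_pos _ (hg τ hτ.1 (hlt τ hτ.2)).1, hr τ hτ, ?_⟩
    · simp only [hx0, hp0]
      simp
      field_simp
    · refine hg.conserved (E := E) (L := L) ?_ ?_ ?_ ?_ ?_ hτ.1 (hlt τ hτ.2)
      · simpa [hx0] using (sin_pos_of_mem_Ioo hθ₀).ne'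
      · simp [hp0]
      · simp [hp0]
      · simpa [hp0, hx0] using hd.angular
      · simp only [hp0, hx0]
        simp
        rw [mul_div_cancel₀ _ hΔ, hd.radial]
  have h1 : {τ : ℝ | x τ 1 < c} ∈ comap (fun τ : ℝ => (τ : EReal)) (𝓝[<] T) :=
    hlim (Iio_mem_nhds hc)
  obtain ⟨U, hU, hUs⟩ := h1
  obtain ⟨l, hl, hlU⟩ := (mem_nhdsLT_iff_exists_Ioo_subset' hT).1 hU
  -- The end `T` may be infinite; a nonnegative real parameter close to it is all that is used.
  obtain ⟨τ, h2, h3⟩ := EReal.lt_iff_exists_real_btwn.1 (max_lt hl hT)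
  have h4 : (0 : ℝ) ≤ τ := by
    have := (le_max_right l 0).trans h2.le
    exact_mod_cast this
  have h5 : x τ 1 < c := hUs (hlU ⟨(le_max_left _ _).trans_lt h2, h3⟩)
  exact absurd (hge τ h4 h3) (not_le.2 h5)

theorem not_evolvesOntoHorizon_of_barrier {a E L K r₀ θ₀ t₀ φ₀ v₀ u₀ c : ℝ} {w : Fin 4 → ℝ}
    (hr₀ : rPlus a < r₀) (hθ₀ : θ₀ ∈ Ioo 0 π) (hd : BeamData a E L K r₀ θ₀ v₀ u₀)
    (hw : Matrix.mulVec (metric a ![t₀, r₀, θ₀, φ₀]) w = ![E, v₀ / kerrDelta a r₀, u₀, -L])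
    (hc : rPlus a < c) (hcr : c < r₀) (hR : radR a E L K c < 0) :
    ¬ EvolvesOntoHorizon a ![t₀, r₀, θ₀, φ₀] w := by
  refine not_evolvesOntoHorizon_of_forall hr₀ hθ₀ hd hw hc fun t r v ρ h0t hr0 _ _ h => ?_
  by_contra! hlt
  obtain ⟨s, h1, h2, h3, -⟩ := exists_first_hit_Icc h0t
    (continuousOn_of_hasDerivWithinAt_Ici fun τ hτ => (h τ hτ).2.1) (by rwa [hr0]) hlt.le
  have h4 := (h s ⟨h1.le, h2⟩).2.2
  rw [h3] at h4
  linarith [sq_nonneg (v s)]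

/-- Until `v` first vanishes the radius does not decrease, so it stays in `[r₀, ∞)`; but `R > 0`
there forbids a zero of `v`. -/
theorem not_evolvesOntoHorizon_of_outward {a E L K r₀ θ₀ t₀ φ₀ v₀ u₀ : ℝ} {w : Fin 4 → ℝ}
    (hr₀ : rPlus a < r₀) (hθ₀ : θ₀ ∈ Ioo 0 π) (hd : BeamData a E L K r₀ θ₀ v₀ u₀)
    (hw : Matrix.mulVec (metric a ![t₀, r₀, θ₀, φ₀]) w = ![E, v₀ / kerrDelta a r₀, u₀, -L])
    (hv₀ : 0 < v₀) (hR : ∀ r, r₀ ≤ r → 0 < radR a E L K r) :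
    ¬ EvolvesOntoHorizon a ![t₀, r₀, θ₀, φ₀] w := by
  refine not_evolvesOntoHorizon_of_forall hr₀ hθ₀ hd hw hr₀ fun t r v ρ h0t hr0 hv0 hvc h => ?_
  have hmono : ∀ s ∈ Icc 0 t, (∀ τ ∈ Ico 0 s, 0 < v τ) → r₀ ≤ r s := by
    intro s hs hpos
    have hd' : ∀ τ ∈ Ioo 0 s, HasDerivAt r (v τ / ρ τ) τ := fun τ hτ =>
      (h τ ⟨hτ.1.le, hτ.2.le.trans hs.2⟩).2.1.hasDerivAt (Ici_mem_nhds hτ.1)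
    rw [← hr0]
    refine monotoneOn_of_deriv_nonneg (convex_Icc 0 s) ?_ ?_ ?_ ⟨le_rfl, hs.1⟩ ⟨hs.1, le_rfl⟩ hs.1
    · exact continuousOn_of_hasDerivWithinAt_Ici fun τ hτ => (h τ ⟨hτ.1, hτ.2.trans hs.2⟩).2.1
    · rw [interior_Icc]
      exact fun τ hτ => (hd' τ hτ).differentiableAt.differentiableWithinAt
    · rw [interior_Icc]
      intro τ hτ
      rw [(hd' τ hτ).deriv]
      exact div_nonneg (hpos τ ⟨hτ.1.le, hτ.2⟩).le (h τ ⟨hτ.1.le, hτ.2.le.trans hs.2⟩).1.le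
  refine hmono t ⟨h0t, le_rfl⟩ fun τ hτ => ?_
  by_contra! hle
  obtain ⟨s, h1, h2, h3, h4⟩ := exists_first_hit_Icc hτ.1
    (hvc.mono (Icc_subset_Icc_right hτ.2.le)) (by rwa [hv0]) hle
  have hs : s ∈ Icc 0 t := ⟨h1.le, h2.trans hτ.2.le⟩
  have h5 := (h s hs).2.2
  have h6 := hR _ (hmono s hs h4)
  rw [h3] at h5
  linarith

/-! ### The critical radius of a family of light beams with given `L / E` -/

/-- `a² - a λ(r)`, the ratio `(a² E - a L) / E` on the spherical orbit of radius `r`. -/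
def critRatio (a r : ℝ) : ℝ := (r ^ 3 - 3 * r ^ 2 + 2 * a ^ 2 * r) / (r - 1)

/-- `Δ^{3/2}` times the derivative of `P / √Δ`. -/
def radSlope (a E L r : ℝ) : ℝ := 2 * E * r * kerrDelta a r - (r - 1) * radP a E L r

/-- This factorization locates the critical radius: for `E > 0` the sign of the slope of `P/√Δ`
compares `critRatio a r` with the constant `a² - a L / E`. -/
theorem radSlope_eq {a E L r : ℝ} (hr : 1 < r) :
    radSlope a E L r = (r - 1) * (E * critRatio a r - (E * a ^ 2 - a * L)) := by
  have : r - 1 ≠ 0 := by linarith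
  unfold radSlope critRatio radP kerrDelta
  field_simp
  ring

/-- In powers of `r - 1` the monotonicity is visible term by term, since `1 - a² ≥ 0`. -/
theorem critRatio_eq {a r : ℝ} (hr : 1 < r) :
    critRatio a r = (r - 1) ^ 2 - 1 - 2 * (1 - a ^ 2) - 2 * (1 - a ^ 2) / (r - 1) := by
  have : r - 1 ≠ 0 := by linarith
  unfold critRatio
  field_simp
  ring

theorem critRatio_strictMonoOn {a : ℝ} (ha : a ^ 2 ≤ 1) : StrictMonoOn (critRatio a) (Ioi 1) := by
  intro x hx y hy hxy
  rw [mem_Ioi] at hx hy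
  rw [critRatio_eq hx, critRatio_eq hy]
  have h1 : 2 * (1 - a ^ 2) / (y - 1) ≤ 2 * (1 - a ^ 2) / (x - 1) :=
    div_le_div_of_nonneg_left (by linarith) (by linarith) (by linarith)
  have h2 : (x - 1) ^ 2 < (y - 1) ^ 2 := by
    have : 0 ≤ x - 1 := by linarith
    gcongr
  linarith

theorem continuousOn_critRatio (a : ℝ) : ContinuousOn (critRatio a) (Ioi 1) := by
  unfold critRatio
  refine ContinuousOn.div (by fun_prop) (by fun_prop) fun r hr => ?_
  rw [mem_Ioi] at hr; linarith

theorem one_lt_of_rPlus_lt {a r : ℝ} (h : rPlus a < r) : 1 < r := (one_le_rPlus a).trans_lt h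

theorem neg_rPlus_sq_lt_critRatio {a r : ℝ} (ha : a ^ 2 ≤ 1) (hr : rPlus a < r) :
    -rPlus a ^ 2 < critRatio a r := by
  rw [critRatio_eq (one_lt_of_rPlus_lt hr)]
  have hh0 := sqrt_nonneg (1 - a ^ 2)
  have hh2 := sq_sqrt (show 0 ≤ 1 - a ^ 2 by linarith)
  unfold rPlus at *
  generalize √(1 - a ^ 2) = h at *
  rw [← hh2]
  have hz : 0 < r - 1 := by linarith
  have h1 : 2 * h ^ 2 / (r - 1) ≤ 2 * h := by
    rw [div_le_iff₀ hz]; nlinarith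
  nlinarith

/-- The bound `-r₊²` is the value of `critRatio` at the horizon, and the function is unbounded
above, so the intermediate value theorem applies when `r₊ > 1`. For `a² = 1` the defining quotient
is singular at `r₊ = 1`, but it reduces to `(r - 1)² - 1`, which is inverted explicitly. -/
theorem exists_critRatio_eq {a c : ℝ} (ha : a ^ 2 ≤ 1) (hc : -rPlus a ^ 2 < c) :
    ∃ r, rPlus a < r ∧ critRatio a r = c := by
  have hh0 := sqrt_nonneg (1 - a ^ 2)
  have hh2 := sq_sqrt (show 0 ≤ 1 - a ^ 2 by linarith)
  have hh1 : √(1 - a ^ 2) ≤ 1 := sqrt_le_one.2 (by nlinarith [sq_nonneg a])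
  rcases hh0.eq_or_lt with h0 | h0
  · have ha1 : 1 - a ^ 2 = 0 := by rw [← hh2, ← h0]; ring
    have hr1 : rPlus a = 1 := by unfold rPlus; rw [← h0, add_zero]
    rw [hr1] at hc ⊢
    have h1 : 0 < √(c + 1) := sqrt_pos.2 (by linarith)
    refine ⟨1 + √(c + 1), by linarith, ?_⟩
    rw [critRatio_eq (by linarith), ha1, add_sub_cancel_left, sq_sqrt (by linarith)]
    simp
  · have hr1 : 1 < rPlus a := by unfold rPlus; linarith
    set M := rPlus a + |c| + 3 with hM
    have hcont : ContinuousOn (critRatio a) (Icc (rPlus a) M) :=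
      (continuousOn_critRatio a).mono fun r hr => hr1.trans_le hr.1
    have hlow : critRatio a (rPlus a) = -rPlus a ^ 2 := by
      rw [critRatio_eq hr1]
      unfold rPlus
      rw [← hh2, add_sub_cancel_left, sqrt_sq h0.le]
      field_simp
      ring
    have hhigh : c < critRatio a M := by
      have hM1 : |c| + 3 < M - 1 := by linarith
      have hc0 := abs_nonneg c
      rw [critRatio_eq (by linarith)]
      have h2 : 2 * (1 - a ^ 2) / (M - 1) ≤ 2 := by
        rw [div_le_iff₀ (by linarith)]; nlinarith [sq_nonneg a]
      have h3 : (|c| + 3) ^ 2 < (M - 1) ^ 2 := by gcongr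
      nlinarith [le_abs_self c, sq_nonneg a]
    obtain ⟨r, hr, hrc⟩ := intermediate_value_Icc (by linarith [abs_nonneg c]) hcont
      (show c ∈ Icc _ _ from ⟨by rw [hlow]; exact hc.le, hhigh.le⟩)
    refine ⟨r, lt_of_le_of_ne hr.1 ?_, hrc⟩
    rintro rfl
    rw [hlow] at hrc
    linarith

/-! ### Monotonicity of `P / √Δ` -/

theorem hasDerivAt_radP_div_sqrt {a r : ℝ} (E L : ℝ) (hr : rPlus a < r) :
    HasDerivAt (fun r => radP a E L r / √(kerrDelta a r))
      (radSlope a E L r / (kerrDelta a r * √(kerrDelta a r))) r := by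
  have hΔ := kerrDelta_pos hr
  have hs : √(kerrDelta a r) ≠ 0 := (sqrt_pos.2 hΔ).ne'
  have h := (hasDerivAt_radP a E L r).div ((hasDerivAt_kerrDelta a r).sqrt hΔ.ne') hs
  convert! h using 1
  have h2 : √(kerrDelta a r) ^ 2 = kerrDelta a r := sq_sqrt hΔ.le
  unfold radSlope
  rw [← h2]
  rw [sqrt_sq (sqrt_nonneg _)]
  field_simp

theorem continuousOn_radP_div_sqrt (a E L : ℝ) :
    ContinuousOn (fun r => radP a E L r / √(kerrDelta a r)) (Ioi (rPlus a)) := fun _ hr =>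
  (hasDerivAt_radP_div_sqrt E L hr).continuousAt.continuousWithinAt

theorem radP_div_sqrt_anti {a E L x y : ℝ} (hx : rPlus a < x) (hxy : x < y)
    (hS : ∀ r ∈ Ioo x y, radSlope a E L r < 0) :
    radP a E L y / √(kerrDelta a y) < radP a E L x / √(kerrDelta a x) := by
  refine strictAntiOn_of_deriv_neg (convex_Icc x y) ((continuousOn_radP_div_sqrt a E L).mono
    fun r hr => hx.trans_le hr.1) (fun r hr => ?_) ⟨le_rfl, hxy.le⟩ ⟨hxy.le, le_rfl⟩ hxy
  rw [interior_Icc] at hr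
  have hr' := hx.trans hr.1
  have hΔ := kerrDelta_pos hr'
  rw [(hasDerivAt_radP_div_sqrt E L hr').deriv]
  exact div_neg_of_neg_of_pos (hS r hr) (by positivity)

theorem radP_div_sqrt_mono {a E L x y : ℝ} (hx : rPlus a < x) (hxy : x < y)
    (hS : ∀ r ∈ Ioo x y, 0 < radSlope a E L r) :
    radP a E L x / √(kerrDelta a x) < radP a E L y / √(kerrDelta a y) := by
  refine strictMonoOn_of_deriv_pos (convex_Icc x y) ((continuousOn_radP_div_sqrt a E L).mono
    fun r hr => hx.trans_le hr.1) (fun r hr => ?_) ⟨le_rfl, hxy.le⟩ ⟨hxy.le, le_rfl⟩ hxy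
  rw [interior_Icc] at hr
  have hr' := hx.trans hr.1
  have hΔ := kerrDelta_pos hr'
  rw [(hasDerivAt_radP_div_sqrt E L hr').deriv]
  exact div_pos (hS r hr) (by positivity)

/-! ### Stable criteria for capture and for escape -/

/-- A condition, stable under perturbations, that guarantees that the light beam is captured. -/
def Captured (a r₀ E L κ v : ℝ) : Prop :=
  (v < 0 ∧ ∀ r ∈ Icc (rPlus a) r₀, κ * √(kerrDelta a r) < radP a E L r) ∨
  0 < κ ∧ ∃ r, r₀ < r ∧ radSlope a E L r < 0 ∧ radP a E L r < κ * √(kerrDelta a r)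

/-- A condition, stable under perturbations, that guarantees that the light beam is not captured. -/
def Escaping (a r₀ E L κ v : ℝ) : Prop :=
  (∃ r, rPlus a < r ∧ r < r₀ ∧ |radP a E L r| < κ * √(kerrDelta a r)) ∨
  (0 < v ∧ 0 < E ∧ ∃ r, r₀ < r ∧ 0 < radSlope a E L r ∧
    ∀ x ∈ Icc r₀ r, κ * √(kerrDelta a x) < radP a E L x)

theorem radR_pos_of_lt {a E L κ r : ℝ} (hκ : 0 ≤ κ) (hΔ : 0 ≤ kerrDelta a r)
    (h : κ * √(kerrDelta a r) < radP a E L r) : 0 < radR a E L (κ ^ 2) r := by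
  have h1 : (κ * √(kerrDelta a r)) ^ 2 < radP a E L r ^ 2 := by
    have := sqrt_nonneg (kerrDelta a r)
    gcongr
  rw [mul_pow, sq_sqrt hΔ] at h1
  unfold radR; linarith

theorem radR_neg_of_lt {a E L κ r : ℝ} (hΔ : 0 ≤ kerrDelta a r)
    (h : |radP a E L r| < κ * √(kerrDelta a r)) : radR a E L (κ ^ 2) r < 0 := by
  have h1 : |radP a E L r| ^ 2 < (κ * √(kerrDelta a r)) ^ 2 := by gcongr
  rw [sq_abs, mul_pow, sq_sqrt hΔ] at h1
  unfold radR; linarith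

theorem kerrDelta_nonneg {a r : ℝ} (ha : a ^ 2 ≤ 1) (h : rPlus a ≤ r) : 0 ≤ kerrDelta a r := by
  rcases h.eq_or_lt with h | h
  · rw [← h, kerrDelta_rPlus ha]
  · exact (kerrDelta_pos h).le

/-- Positivity of `P(r₀)` reads `E a² - a L > |E| r₀²`, whereas `E critRatio(r) ≤ |E| r₊² ≤ |E|
r₀²`. -/
theorem radSlope_neg_of_nonpos {a E L r₀ r : ℝ} (ha : a ^ 2 ≤ 1) (hr₀ : rPlus a < r₀)
    (hP : 0 < radP a E L r₀) (hE : E ≤ 0) (hr : rPlus a < r) : radSlope a E L r < 0 := by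
  rw [radSlope_eq (one_lt_of_rPlus_lt hr)]
  have h1 := neg_rPlus_sq_lt_critRatio ha hr
  have h2 : rPlus a ^ 2 < r₀ ^ 2 := by
    have := rPlus_pos a
    gcongr
  unfold radP at hP
  refine mul_neg_of_pos_of_neg (by linarith [one_lt_of_rPlus_lt hr]) ?_
  nlinarith

theorem radSlope_neg_of_lt {a E L x y r₀ : ℝ} (ha : a ^ 2 ≤ 1) (hr₀ : rPlus a < r₀)
    (hP : 0 < radP a E L r₀) (hx : rPlus a < x) (hxy : x ≤ y) (hy : radSlope a E L y < 0) :
    radSlope a E L x < 0 := by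
  rcases le_or_gt E 0 with hE | hE
  · exact radSlope_neg_of_nonpos ha hr₀ hP hE hx
  · have hx1 := one_lt_of_rPlus_lt hx
    have hy1 := hx1.trans_le hxy
    rw [radSlope_eq hx1]
    rw [radSlope_eq hy1] at hy
    have h1 := (critRatio_strictMonoOn ha).monotoneOn hx1 hy1 hxy
    have h2 : E * critRatio a y - (E * a ^ 2 - a * L) < 0 := by
      by_contra! h
      have := mul_nonneg (show 0 ≤ y - 1 by linarith) h
      linarith
    refine mul_neg_of_pos_of_neg (by linarith) ?_
    have := mul_le_mul_of_nonneg_left h1 hE.le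
    linarith

theorem radSlope_pos_of_gt {a E L x y : ℝ} (ha : a ^ 2 ≤ 1) (hE : 0 < E)
    (hx : rPlus a < x) (hxy : x ≤ y) (h : 0 < radSlope a E L x) :
    0 < radSlope a E L y := by
  have hx1 := one_lt_of_rPlus_lt hx
  have hy1 := hx1.trans_le hxy
  rw [radSlope_eq hy1]
  rw [radSlope_eq hx1] at h
  have h1 := (critRatio_strictMonoOn ha).monotoneOn hx1 hy1 hxy
  have h2 := pos_of_mul_pos_right h (by linarith)
  refine mul_pos (by linarith) ?_
  have := mul_le_mul_of_nonneg_left h1 hE.le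
  linarith

theorem radP_mono {a E x y : ℝ} (L : ℝ) (hE : 0 ≤ E) (hx : 0 ≤ x) (hxy : x ≤ y) :
    radP a E L x ≤ radP a E L y := by
  unfold radP
  gcongr

/-- The criterion `Captured` implies that the radial motion falls onto the horizon. -/
theorem Captured.radialInfall {a r₀ E L κ v : ℝ} (h : Captured a r₀ E L κ v) (ha : a ^ 2 ≤ 1)
    (hr₀ : rPlus a < r₀) (hκ : 0 ≤ κ) (hP : 0 < radP a E L r₀)
    (hv : v ^ 2 = radR a E L (κ ^ 2) r₀) : RadialInfall a E L (κ ^ 2) r₀ v := by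
  rcases h with ⟨hv0, h⟩ | ⟨hκ0, rb, hrb, hS, hlt⟩
  · exact radialInfall_of_inward hr₀ hv hv0 fun r hr =>
      radR_pos_of_lt hκ (kerrDelta_nonneg ha hr.1) (h r hr)
  set q : ℝ → ℝ := fun r => radP a E L r / √(kerrDelta a r) with hq
  have hrb' := hr₀.trans hrb
  have hsq : ∀ {r}, rPlus a < r → 0 < √(kerrDelta a r) := fun hr => sqrt_pos.2 (kerrDelta_pos hr)
  have hSneg : ∀ r, rPlus a < r → r ≤ rb → radSlope a E L r < 0 := fun r h1 h2 =>
    radSlope_neg_of_lt ha hr₀ hP h1 h2 hS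
  have hanti : ∀ x y, rPlus a < x → x < y → y ≤ rb → q y < q x := fun x y hx hxy hy =>
    radP_div_sqrt_anti hx hxy fun r hr => hSneg r (hx.trans hr.1) (hr.2.le.trans hy)
  have hqb : q rb < κ := by rw [hq]; exact (div_lt_iff₀ (hsq hrb')).2 hlt
  have hq0 : κ ≤ q r₀ := by
    have h1 : (κ * √(kerrDelta a r₀)) ^ 2 ≤ radP a E L r₀ ^ 2 := by
      rw [mul_pow, sq_sqrt (kerrDelta_pos hr₀).le]
      have := sq_nonneg v
      rw [hv, radR] at this
      linarith
    exact (le_div_iff₀ (hsq hr₀)).2 (le_of_sq_le_sq h1 hP.le)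
  -- At `rb` the function `P` may be negative. The barrier is then moved inwards to a point where `q
  -- = κ / 2`, so that `P > 0` up to the barrier and `v / P` makes sense.
  obtain ⟨u, hu0, hub, hqu, hqu0⟩ : ∃ u, r₀ < u ∧ u ≤ rb ∧ q u < κ ∧ 0 < q u := by
    rcases le_or_gt (κ / 2) (q rb) with h1 | h1
    · exact ⟨rb, hrb, le_rfl, hqb, by linarith⟩
    · obtain ⟨u, hu, hqu⟩ := intermediate_value_Icc' hrb.le
        ((continuousOn_radP_div_sqrt a E L).mono fun r hr => hr₀.trans_le hr.1)
        (show κ / 2 ∈ Icc (q rb) (q r₀) from ⟨h1.le, by linarith⟩)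
      have hqu' : q u = κ / 2 := hqu
      refine ⟨u, lt_of_le_of_ne hu.1 ?_, hu.2, by linarith, by linarith⟩
      rintro rfl
      linarith
  have hu' := hr₀.trans hu0
  have hPpos : ∀ r ∈ Icc (rPlus a) u, 0 < radP a E L r := by
    have h1 : ∀ r, rPlus a < r → r ≤ u → 0 < radP a E L r := fun r hr hru => by
      have h2 : 0 < q r := by
        rcases hru.eq_or_lt with h | h
        · rwa [h]
        · exact hqu0.trans (hanti r u hr h hub)
      by_contra! h3
      exact absurd (div_nonpos_of_nonpos_of_nonneg h3 (sqrt_nonneg _)) (not_le.2 h2)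
    intro r hr
    -- At the horizon `q` is singular, so positivity of `P` there is proved directly: from `P(r₀)`
    -- if `E ≤ 0`, and from the lower bound on `critRatio` if `E > 0`.
    rcases hr.1.eq_or_lt with h | h
    · rw [← h]
      rcases le_or_gt E 0 with hE | hE
      · refine hP.trans_le ?_
        unfold radP
        have : (rPlus a) ^ 2 ≤ r₀ ^ 2 := by
          have := (rPlus_pos a).le
          gcongr
        nlinarith
      · have h2 := hSneg rb hrb' le_rfl
        rw [radSlope_eq (one_lt_of_rPlus_lt hrb')] at h2
        have h3 := neg_rPlus_sq_lt_critRatio ha hrb'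
        have h4 : E * critRatio a rb - (E * a ^ 2 - a * L) < 0 := by
          by_contra! h
          have := mul_nonneg (show 0 ≤ rb - 1 by linarith [one_lt_of_rPlus_lt hrb']) h
          linarith
        unfold radP
        nlinarith
    · exact h1 r h hr.2
  refine radialInfall_of_barrier hr₀ hu0 hv (by positivity) hPpos
    (fun r hr => hSneg r (hr₀.trans_le hr.1) (hr.2.trans hub)) ?_ ?_
  · refine radR_neg_of_lt (kerrDelta_pos hu').le ?_
    rw [abs_of_pos (hPpos u ⟨hu'.le, le_rfl⟩)]
    exact (div_lt_iff₀ (hsq hu')).1 hqu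
  · intro y hy hRy r hr
    have hqy : κ < q y := by
      rw [hq]
      refine (lt_div_iff₀ (hsq hy.1)).2 ?_
      refine lt_of_pow_lt_pow_left₀ 2 (hPpos y ⟨hy.1.le, hy.2.le⟩).le ?_
      rw [mul_pow, sq_sqrt (kerrDelta_pos hy.1).le]
      unfold radR at hRy
      linarith
    refine radR_pos_of_lt hκ (kerrDelta_nonneg ha hr.1) ?_
    rcases hr.1.eq_or_lt with h | h
    · rw [← h, kerrDelta_rPlus ha, sqrt_zero, mul_zero]
      exact hPpos _ ⟨le_rfl, hu'.le⟩
    · refine (lt_div_iff₀ (hsq h)).1 ?_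
      rcases hr.2.eq_or_lt with h2 | h2
      · rwa [h2]
      · exact hqy.trans (hanti r y h h2 (hy.2.le.trans hub))

theorem Captured.evolvesOntoHorizon {a r₀ θ₀ t₀ φ₀ E L κ v u : ℝ} {w : Fin 4 → ℝ}
    (h : Captured a r₀ E L κ v) (ha : a ^ 2 ≤ 1) (hr₀ : rPlus a < r₀) (hθ₀ : θ₀ ∈ Ioo 0 π)
    (hκ : 0 ≤ κ) (hP : 0 < radP a E L r₀) (hd : BeamData a E L (κ ^ 2) r₀ θ₀ v u)
    (hw : Matrix.mulVec (metric a ![t₀, r₀, θ₀, φ₀]) w = ![E, v / kerrDelta a r₀, u, -L]) :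
    EvolvesOntoHorizon a ![t₀, r₀, θ₀, φ₀] w :=
  evolvesOntoHorizon_of_radialInfall hθ₀ (h.radialInfall ha hr₀ hκ hP hd.radial) hd.angular hw

theorem Escaping.not_evolvesOntoHorizon {a r₀ θ₀ t₀ φ₀ E L κ v u : ℝ} {w : Fin 4 → ℝ}
    (h : Escaping a r₀ E L κ v) (ha : a ^ 2 ≤ 1) (hr₀ : rPlus a < r₀) (hθ₀ : θ₀ ∈ Ioo 0 π)
    (hκ : 0 ≤ κ) (hd : BeamData a E L (κ ^ 2) r₀ θ₀ v u)
    (hw : Matrix.mulVec (metric a ![t₀, r₀, θ₀, φ₀]) w = ![E, v / kerrDelta a r₀, u, -L]) :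
    ¬ EvolvesOntoHorizon a ![t₀, r₀, θ₀, φ₀] w := by
  rcases h with ⟨r, hr, hrr, hlt⟩ | ⟨hv, hE, r, hr, hS, h⟩
  · exact not_evolvesOntoHorizon_of_barrier hr₀ hθ₀ hd hw hr hrr
      (radR_neg_of_lt (kerrDelta_pos hr).le hlt)
  · refine not_evolvesOntoHorizon_of_outward hr₀ hθ₀ hd hw hv fun x hx => ?_
    have hx0 := hr₀.trans_le hx
    refine radR_pos_of_lt hκ (kerrDelta_pos hx0).le ?_
    rcases le_or_gt x r with hxr | hxr
    · exact h x ⟨hx, hxr⟩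
    · have hr0 := hr₀.trans hr
      have h1 := radP_div_sqrt_mono (E := E) (L := L) hr0 hxr
        fun y hy => radSlope_pos_of_gt ha hE hr0 hy.1.le hS
      have h2 := (lt_div_iff₀ (sqrt_pos.2 (kerrDelta_pos hr0))).2 (h r ⟨hr.le, le_rfl⟩)
      exact (lt_div_iff₀ (sqrt_pos.2 (kerrDelta_pos hx0))).1 (h2.trans h1)

/-! ### Classification of the light beams -/

/-- For `E ≤ 0` the function `P` does not increase outwards while `√Δ` grows, so there is a barrier
outside `r₀`. The chosen radius gives `√Δ ≥ r₀ + P₀ / κ`, hence `κ √Δ > P₀`. -/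
theorem captured_of_energy_nonpos {a r₀ E L κ : ℝ} (v : ℝ) (ha : a ^ 2 ≤ 1) (hr₀ : rPlus a < r₀)
    (hκ : 0 < κ) (hP : 0 < radP a E L r₀) (hE : E ≤ 0) : Captured a r₀ E L κ v := by
  set P₀ := radP a E L r₀ with hP₀
  have hr₀1 := one_lt_of_rPlus_lt hr₀
  have hq : 0 < P₀ / κ := by positivity
  set r := r₀ + 2 + P₀ / κ with hr
  have hr1 : r₀ < r := by linarith
  refine Or.inr ⟨hκ, r, hr1, radSlope_neg_of_nonpos ha hr₀ hP hE (hr₀.trans hr1), ?_⟩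
  have h1 : radP a E L r ≤ P₀ := by
    rw [hP₀]; unfold radP
    have : r₀ ^ 2 ≤ r ^ 2 := by gcongr
    nlinarith
  have h2 : r₀ + P₀ / κ ≤ √(kerrDelta a r) := by
    refine le_sqrt_of_sq_le ?_
    rw [kerrDelta_eq]
    nlinarith [sq_nonneg a]
  have h3 : P₀ < κ * √(kerrDelta a r) := by
    have : κ * (r₀ + P₀ / κ) = κ * r₀ + P₀ := by field_simp
    have h4 := mul_le_mul_of_nonneg_left h2 hκ.le
    have h5 : 0 < κ * r₀ := by positivity
    linarith
  linarith

/-- The hypothesis `hb` says `P(r₊) ≤ 0`. If it is strict, `P` vanishes between the horizon and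
`r₀`, where `R = -Δ κ² < 0`. In the case of equality, `P` and `Δ` share the factor `r - r₊`, and `P²
< κ² Δ` just outside the horizon because `Δ` has a simple zero. For `a² = 1` the zero is double and
`P/√Δ` tends to `2E`, hence `hext`. -/
theorem escaping_of_ratio_le {a r₀ E L κ : ℝ} (v : ℝ) (ha : a ^ 2 ≤ 1) (hr₀ : rPlus a < r₀)
    (hκ : 0 < κ) (hP : 0 < radP a E L r₀) (hE : 0 < E)
    (hb : E * a ^ 2 - a * L ≤ -(E * rPlus a ^ 2))
    (hext : a ^ 2 = 1 → E * a ^ 2 - a * L = -(E * rPlus a ^ 2) → 2 * E < κ) :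
    Escaping a r₀ E L κ v := by
  left
  rcases hb.lt_or_eq with hb' | hb'
  · obtain ⟨r, hr, hPr⟩ := intermediate_value_Ioo hr₀.le (continuous_radP a E L).continuousOn
      (show (0 : ℝ) ∈ Ioo (radP a E L (rPlus a)) (radP a E L r₀) from
        ⟨by unfold radP; linarith, hP⟩)
    refine ⟨r, hr.1, hr.2, ?_⟩
    rw [hPr, abs_zero]
    exact mul_pos hκ (sqrt_pos.2 (kerrDelta_pos hr.1))
  · set h := √(1 - a ^ 2) with hh
    have hh2 : h ^ 2 = 1 - a ^ 2 := sq_sqrt (by linarith)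
    have hh0 : 0 ≤ h := sqrt_nonneg _
    have hrp : rPlus a = 1 + h := rfl
    have key : (E ^ 2 * ((rPlus a - rPlus a) * (rPlus a + rPlus a) ^ 2) <
        κ ^ 2 * (rPlus a - 1 + h) ∧ 0 < h) ∨ (h = 0 ∧ 2 * E < κ) := by
      rcases hh0.eq_or_lt with h0 | h0
      · right
        exact ⟨h0.symm, hext (by rw [← h0] at hh2; linarith) hb'⟩
      · left
        refine ⟨?_, h0⟩
        rw [hrp]; simp; positivity
    have hPr : ∀ r, radP a E L r = E * (r - rPlus a) * (r + rPlus a) := fun r => by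
      unfold radP; linear_combination hb'
    have hΔr : ∀ r, kerrDelta a r = (r - rPlus a) * (r - 1 + h) := fun r => by
      rw [kerrDelta_eq, hrp]; linear_combination hh2
    have hfin : ∃ r, rPlus a < r ∧ r < r₀ ∧
        E ^ 2 * (r - rPlus a) * (r + rPlus a) ^ 2 < κ ^ 2 * (r - 1 + h) := by
      rcases key with ⟨h1, -⟩ | ⟨h0, h1⟩
      · have hc : ∀ᶠ r in 𝓝 (rPlus a),
            E ^ 2 * ((r - rPlus a) * (r + rPlus a) ^ 2) < κ ^ 2 * (r - 1 + h) :=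
          ContinuousAt.eventually_lt (by fun_prop) (by fun_prop) h1
        obtain ⟨r, hr1, hr2⟩ := ((hc.filter_mono nhdsWithin_le_nhds).and
          (Ioo_mem_nhdsGT hr₀)).exists
        exact ⟨r, hr2.1, hr2.2, by linarith⟩
      · have hrp1 : rPlus a = 1 := by rw [hrp, h0, add_zero]
        have hc : ∀ᶠ r in 𝓝 (rPlus a), E * (r + rPlus a) < κ :=
          ContinuousAt.eventually_lt (by fun_prop) (by fun_prop) (by rw [hrp1]; linarith)
        obtain ⟨r, hr1, hr2⟩ := ((hc.filter_mono nhdsWithin_le_nhds).and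
          (Ioo_mem_nhdsGT hr₀)).exists
        refine ⟨r, hr2.1, hr2.2, ?_⟩
        have h2 : (E * (r + rPlus a)) ^ 2 < κ ^ 2 := by
          have h3 : 0 ≤ r + rPlus a := by linarith [hr2.1]
          gcongr
        rw [h0, hrp1] at *
        have h4 : 0 < r - 1 := by linarith [hr2.1]
        nlinarith
    obtain ⟨r, hr1, hr2, hlt⟩ := hfin
    refine ⟨r, hr1, hr2, ?_⟩
    have hd : 0 < r - rPlus a := by linarith
    refine lt_of_pow_lt_pow_left₀ 2 (by positivity) ?_
    rw [sq_abs, mul_pow, sq_sqrt (kerrDelta_pos hr1).le, hPr, hΔr]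
    have := mul_lt_mul_of_pos_left hlt hd
    linarith

/-- Positive energy and a critical radius `rc`: the data common to the classification lemmas. -/
structure CriticalRadius (a E L rc : ℝ) : Prop where
  energy_pos : 0 < E
  gt : rPlus a < rc
  eq : E * critRatio a rc = E * a ^ 2 - a * L

namespace CriticalRadius

variable {a E L rc : ℝ}

theorem radP_pos (h : CriticalRadius a E L rc) (ha : a ^ 2 ≤ 1) {r : ℝ} (hr : rPlus a ≤ r) :
    0 < radP a E L r := by
  refine lt_of_lt_of_le ?_ (radP_mono L h.energy_pos.le (rPlus_pos a).le hr)
  have h1 := neg_rPlus_sq_lt_critRatio ha h.gt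
  have h2 := mul_lt_mul_of_pos_left h1 h.energy_pos
  rw [h.eq] at h2
  unfold radP; linarith

theorem radSlope_neg (h : CriticalRadius a E L rc) (ha : a ^ 2 ≤ 1) {r : ℝ} (hr : rPlus a < r)
    (hrc : r < rc) : radSlope a E L r < 0 := by
  have hr1 := one_lt_of_rPlus_lt hr
  rw [radSlope_eq hr1, ← h.eq]
  have := mul_lt_mul_of_pos_left (critRatio_strictMonoOn ha hr1 (hr1.trans hrc) hrc) h.energy_pos
  exact mul_neg_of_pos_of_neg (by linarith) (by linarith)

theorem radSlope_pos (h : CriticalRadius a E L rc) (ha : a ^ 2 ≤ 1) {r : ℝ} (hrc : rc < r) :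
    0 < radSlope a E L r := by
  have hr1 := one_lt_of_rPlus_lt h.gt
  rw [radSlope_eq (hr1.trans hrc), ← h.eq]
  have := mul_lt_mul_of_pos_left (critRatio_strictMonoOn ha hr1 (hr1.trans hrc) hrc) h.energy_pos
  exact mul_pos (by linarith) (by linarith)

theorem min_le (h : CriticalRadius a E L rc) (ha : a ^ 2 ≤ 1) {r : ℝ} (hr : rPlus a < r) :
    radP a E L rc / √(kerrDelta a rc) ≤ radP a E L r / √(kerrDelta a r) := by
  rcases lt_trichotomy r rc with h1 | h1 | h1
  · exact (radP_div_sqrt_anti hr h1 fun x hx => h.radSlope_neg ha (hr.trans hx.1) hx.2).le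
  · rw [h1]
  · exact (radP_div_sqrt_mono h.gt h1 fun x hx => h.radSlope_pos ha hx.1).le

end CriticalRadius

/-- The value of `-Δ p_r` that separates captured from escaping beams. -/
def threshold (a r₀ E L rc : ℝ) : ℝ :=
  SignType.sign (r₀ - rc) * √(radR a E L (radP a E L rc ^ 2 / kerrDelta a rc) r₀)

section threshold

variable {a r₀ E L rc κ v : ℝ}

theorem CriticalRadius.radR_eq (hr₀ : rPlus a < r₀) (K : ℝ) :
    radR a E L K r₀ =
      kerrDelta a r₀ * ((radP a E L r₀ / √(kerrDelta a r₀)) ^ 2 - K) := by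
  have h1 := kerrDelta_pos hr₀
  rw [div_pow, sq_sqrt h1.le]
  unfold radR
  field_simp

theorem CriticalRadius.radR_nonneg (h : CriticalRadius a E L rc) (ha : a ^ 2 ≤ 1)
    (hr₀ : rPlus a < r₀) : 0 ≤ radR a E L (radP a E L rc ^ 2 / kerrDelta a rc) r₀ := by
  rw [CriticalRadius.radR_eq hr₀]
  have h1 := kerrDelta_pos hr₀
  have h2 := h.min_le ha hr₀
  have h3 : 0 ≤ radP a E L rc / √(kerrDelta a rc) :=
    div_nonneg (h.radP_pos ha h.gt.le).le (sqrt_nonneg _)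
  have h4 : (radP a E L rc / √(kerrDelta a rc)) ^ 2 ≤ (radP a E L r₀ / √(kerrDelta a r₀)) ^ 2 := by
    gcongr
  rw [div_pow, sq_sqrt (kerrDelta_pos h.gt).le] at h4
  exact mul_nonneg h1.le (by linarith)

/-- Since `τ² - v² = Δ(r₀) (κ² - q(r_c)²)`, comparing `|v|` with `τ` compares `κ` with `q(r_c)`.
Inside `r_c`, an inward beam meets increasing `q`, and a beam with `0 ≤ v < τ` is turned back before
`r_c`. At or outside `r_c`, the inequality `v < -τ` gives `κ < q(r_c)`, and no turning point exists.
-/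
theorem CriticalRadius.captured (h : CriticalRadius a E L rc) (ha : a ^ 2 ≤ 1)
    (hr₀ : rPlus a < r₀) (hκ : 0 ≤ κ) (hv : v ^ 2 = radR a E L (κ ^ 2) r₀)
    (hlt : v < -threshold a r₀ E L rc) : Captured a r₀ E L κ v := by
  set q : ℝ → ℝ := fun r => radP a E L r / √(kerrDelta a r) with hq
  have hsq : ∀ {r}, rPlus a < r → 0 < √(kerrDelta a r) := fun hr => sqrt_pos.2 (kerrDelta_pos hr)
  have hΔ := kerrDelta_pos hr₀
  have hq0 : ∀ {r}, rPlus a < r → 0 < q r := fun hr => div_pos (h.radP_pos ha hr.le) (hsq hr)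
  have hmin : ∀ {r}, rPlus a < r → q rc ≤ q r := fun hr => h.min_le ha hr
  have hqc2 : q rc ^ 2 = radP a E L rc ^ 2 / kerrDelta a rc := by
    simp only [hq]; rw [div_pow, sq_sqrt (kerrDelta_pos h.gt).le]
  set τ := √(radR a E L (radP a E L rc ^ 2 / kerrDelta a rc) r₀) with hτ
  have hτ2 : τ ^ 2 = kerrDelta a r₀ * (q r₀ ^ 2 - q rc ^ 2) := by
    rw [hτ, sq_sqrt (h.radR_nonneg ha hr₀), CriticalRadius.radR_eq hr₀, ← hqc2]
  have hτ0 : 0 ≤ τ := sqrt_nonneg _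
  have hv2 : v ^ 2 = kerrDelta a r₀ * (q r₀ ^ 2 - κ ^ 2) := by
    rw [hv, CriticalRadius.radR_eq hr₀]
  have hcap : v < 0 → (∀ r, rPlus a < r → r ≤ r₀ → κ < q r) → Captured a r₀ E L κ v := by
    refine fun hv0 hall => Or.inl ⟨hv0, fun r hr => ?_⟩
    rcases hr.1.eq_or_lt with h1 | h1
    · rw [← h1, kerrDelta_rPlus ha, sqrt_zero, mul_zero]; exact h.radP_pos ha le_rfl
    · exact (lt_div_iff₀ (hsq h1)).1 (hall r h1 hr.2)
  unfold threshold at hlt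
  rcases lt_or_ge r₀ rc with hc | hc
  · rw [sign_neg (by linarith)] at hlt
    simp only [SignType.coe_neg, SignType.coe_one, neg_one_mul, neg_neg] at hlt
    rw [← hτ] at hlt
    rcases lt_or_ge v 0 with hv0 | hv0
    · refine hcap hv0 fun r hr hrr => ?_
      have h1 : κ < q r₀ := by
        refine lt_of_pow_lt_pow_left₀ 2 (hq0 hr₀).le ?_
        have h2 : 0 < v ^ 2 := sq_pos_of_neg hv0
        rw [hv2] at h2
        have := pos_of_mul_pos_right h2 hΔ.le
        linarith
      rcases hrr.eq_or_lt with h3 | h3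
      · rwa [h3]
      · exact h1.trans (radP_div_sqrt_anti hr h3 fun x hx =>
          h.radSlope_neg ha (hr.trans hx.1) (hx.2.trans hc))
    · have h1 : q rc < κ := by
        refine lt_of_pow_lt_pow_left₀ 2 hκ ?_
        have h2 : v ^ 2 < τ ^ 2 := by gcongr
        rw [hv2, hτ2] at h2
        have := lt_of_mul_lt_mul_left h2 hΔ.le
        linarith
      -- At `r_c` itself the slope vanishes; the barrier is placed slightly to its left, where the
      -- slope is negative.
      have h2 : ∀ᶠ r in 𝓝 rc, q r < κ :=
        ((continuousOn_radP_div_sqrt a E L).continuousAt (Ioi_mem_nhds h.gt)).eventually_lt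
          continuousAt_const h1
      obtain ⟨r, h3, h4⟩ := ((h2.filter_mono nhdsWithin_le_nhds).and
        (Ioo_mem_nhdsLT hc)).exists
      have hr := hr₀.trans h4.1
      exact Or.inr ⟨(hq0 h.gt).trans h1, r, h4.1, h.radSlope_neg ha hr h4.2,
        (div_lt_iff₀ (hsq hr)).1 h3⟩
  · have hs : (0 : ℝ) ≤ (SignType.sign (r₀ - rc) : ℝ) ∧
        (SignType.sign (r₀ - rc) : ℝ) * τ = τ := by
      rcases hc.eq_or_lt with h1 | h1
      · have h2 : τ = 0 := by
          rw [← sq_eq_zero_iff, hτ2, h1]; ring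
        rw [h2, h1]; simp
      · rw [sign_pos (by linarith)]; simp
    rw [hs.2] at hlt
    have hv0 : v < 0 := by linarith
    refine hcap hv0 fun r hr hrr => lt_of_lt_of_le ?_ (hmin hr)
    refine lt_of_pow_lt_pow_left₀ 2 (hq0 h.gt).le ?_
    have h2 : τ ^ 2 < v ^ 2 := by nlinarith
    rw [hv2, hτ2] at h2
    have := lt_of_mul_lt_mul_left h2 hΔ.le
    linarith

/-- The mirror image of `CriticalRadius.captured`. Outside `r_c`, an outward beam meets increasing
`q`, and a beam with `-τ < v ≤ 0` finds `R < 0` at `r_c`. At or inside `r_c`, the inequality `v > τ`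
gives `κ < q(r_c)`, so `R > 0` all the way out. -/
theorem CriticalRadius.escaping (h : CriticalRadius a E L rc) (ha : a ^ 2 ≤ 1)
    (hr₀ : rPlus a < r₀) (hκ : 0 ≤ κ) (hv : v ^ 2 = radR a E L (κ ^ 2) r₀)
    (hlt : -threshold a r₀ E L rc < v) : Escaping a r₀ E L κ v := by
  set q : ℝ → ℝ := fun r => radP a E L r / √(kerrDelta a r) with hq
  have hsq : ∀ {r}, rPlus a < r → 0 < √(kerrDelta a r) := fun hr => sqrt_pos.2 (kerrDelta_pos hr)
  have hΔ := kerrDelta_pos hr₀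
  have hq0 : ∀ {r}, rPlus a < r → 0 < q r := fun hr => div_pos (h.radP_pos ha hr.le) (hsq hr)
  have hmin : ∀ {r}, rPlus a < r → q rc ≤ q r := fun hr => h.min_le ha hr
  have hqc2 : q rc ^ 2 = radP a E L rc ^ 2 / kerrDelta a rc := by
    simp only [hq]; rw [div_pow, sq_sqrt (kerrDelta_pos h.gt).le]
  set τ := √(radR a E L (radP a E L rc ^ 2 / kerrDelta a rc) r₀) with hτ
  have hτ2 : τ ^ 2 = kerrDelta a r₀ * (q r₀ ^ 2 - q rc ^ 2) := by
    rw [hτ, sq_sqrt (h.radR_nonneg ha hr₀), CriticalRadius.radR_eq hr₀, ← hqc2]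
  have hτ0 : 0 ≤ τ := sqrt_nonneg _
  have hv2 : v ^ 2 = kerrDelta a r₀ * (q r₀ ^ 2 - κ ^ 2) := by
    rw [hv, CriticalRadius.radR_eq hr₀]
  have hesc : 0 < v → ∀ r, r₀ < r → rc < r → (∀ x, r₀ ≤ x → κ < q x) → Escaping a r₀ E L κ v :=
    fun hv0 r hr hrc hall => Or.inr ⟨hv0, h.energy_pos, r, hr, h.radSlope_pos ha hrc, fun x hx =>
      (lt_div_iff₀ (hsq (hr₀.trans_le hx.1))).1 (hall x hx.1)⟩
  unfold threshold at hlt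
  rcases lt_or_ge rc r₀ with hc | hc
  · rw [sign_pos (by linarith)] at hlt
    simp only [SignType.coe_one, one_mul] at hlt
    rw [← hτ] at hlt
    rcases lt_or_ge 0 v with hv0 | hv0
    · refine hesc hv0 (r₀ + 1) (by linarith) (by linarith) fun r hr => ?_
      have h1 : κ < q r₀ := by
        refine lt_of_pow_lt_pow_left₀ 2 (hq0 hr₀).le ?_
        have h2 : 0 < v ^ 2 := by positivity
        rw [hv2] at h2
        have := pos_of_mul_pos_right h2 hΔ.le
        linarith
      rcases hr.eq_or_lt with h3 | h3
      · rwa [← h3]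
      · exact h1.trans (radP_div_sqrt_mono hr₀ h3 fun x hx => h.radSlope_pos ha (hc.trans hx.1))
    · have h1 : q rc < κ := by
        refine lt_of_pow_lt_pow_left₀ 2 hκ ?_
        have h2 : v ^ 2 < τ ^ 2 := by nlinarith
        rw [hv2, hτ2] at h2
        have := lt_of_mul_lt_mul_left h2 hΔ.le
        linarith
      refine Or.inl ⟨rc, h.gt, hc, ?_⟩
      rw [abs_of_pos (h.radP_pos ha h.gt.le)]
      exact (div_lt_iff₀ (hsq h.gt)).1 h1
  · have hs : (SignType.sign (r₀ - rc) : ℝ) * τ = -τ := by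
      rcases hc.eq_or_lt with h1 | h1
      · have h2 : τ = 0 := by
          rw [← sq_eq_zero_iff, hτ2, h1]; ring
        rw [h2, h1]; simp
      · rw [sign_neg (by linarith)]; simp
    rw [hs, neg_neg] at hlt
    have hv0 : 0 < v := by linarith
    refine hesc hv0 (rc + 1) (by linarith) (by linarith) fun r hr =>
      lt_of_lt_of_le ?_ (hmin (hr₀.trans_le hr))
    refine lt_of_pow_lt_pow_left₀ 2 (hq0 h.gt).le ?_
    have h2 : τ ^ 2 < v ^ 2 := by gcongr
    rw [hv2, hτ2] at h2
    have := lt_of_mul_lt_mul_left h2 hΔ.le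
    linarith

end threshold

/-! ### Constants of motion of the light beams seen by the observer -/

/-- The data of a stationary observer outside the horizon. -/
structure IsObserver (a r₀ θ₀ Ω : ℝ) : Prop where
  a_pos : 0 < a
  a_le : a ≤ 1
  gt : rPlus a < r₀
  mem : θ₀ ∈ Ioo 0 π
  mem_Omega : Ω ∈ Ioo (OmegaMinus a r₀ θ₀) (OmegaPlus a r₀ θ₀)

/-- `-g(∂_t + Ω ∂_φ, ∂_t + Ω ∂_φ) ρ²`. -/
def uDen (a r₀ θ₀ Ω : ℝ) : ℝ :=
  kerrDelta a r₀ * (1 - a * Ω * sin θ₀ ^ 2) ^ 2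
    - sin θ₀ ^ 2 * (Ω * (r₀ ^ 2 + a ^ 2) - a) ^ 2

theorem rhoSq_eq (a r θ : ℝ) : rhoSq a r θ = r ^ 2 + a ^ 2 - a ^ 2 * sin θ ^ 2 := by
  unfold rhoSq; rw [cos_sq']; ring

theorem uZero_eq (a r₀ θ₀ Ω : ℝ) :
    uZero a r₀ θ₀ Ω = √(rhoSq a r₀ θ₀) / √(uDen a r₀ θ₀ Ω) := by
  unfold uZero uDen kerrA kerrDelta
  congr 2
  ring

theorem kerrA_pos {a r : ℝ} (θ : ℝ) (hr : rPlus a < r) : 0 < kerrA a r θ := by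
  have h1 : kerrA a r θ = (r ^ 2 + a ^ 2) * rhoSq a r θ + 2 * r * (a ^ 2 * sin θ ^ 2) := by
    unfold kerrA kerrDelta; rw [rhoSq_eq]; ring
  have h2 := rhoSq_pos θ hr
  have h3 := (rPlus_pos a).trans hr
  rw [h1]; positivity

namespace IsObserver

variable {a r₀ θ₀ Ω : ℝ}

theorem sin_pos (h : IsObserver a r₀ θ₀ Ω) : 0 < sin θ₀ := sin_pos_of_mem_Ioo h.mem

theorem sq_le (h : IsObserver a r₀ θ₀ Ω) : a ^ 2 ≤ 1 := by
  have := h.a_pos; have := h.a_le; nlinarith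

/-- The endpoints `Ω_±` are the angular velocities for which the two sides agree, that is, for which
the worldline is null. In between, the azimuthal component of the velocity in the Carter frame is
smaller than the time component. -/
theorem abs_lt (h : IsObserver a r₀ θ₀ Ω) :
    |sin θ₀ * (Ω * (r₀ ^ 2 + a ^ 2) - a)| < √(kerrDelta a r₀) * (1 - a * Ω * sin θ₀ ^ 2) := by
  obtain ⟨h1, h2⟩ := h.mem_Omega
  have hs := h.sin_pos
  have ha := h.a_pos
  have hr := (rPlus_pos a).trans h.gt
  have hδ : 0 < √(kerrDelta a r₀) := sqrt_pos.2 (kerrDelta_pos h.gt)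
  have hδ2 : √(kerrDelta a r₀) ^ 2 = kerrDelta a r₀ := sq_sqrt (kerrDelta_pos h.gt).le
  have hδr : √(kerrDelta a r₀) ^ 2 < r₀ ^ 2 + a ^ 2 := by rw [hδ2]; unfold kerrDelta; linarith
  have hs1 := sin_le_one θ₀
  unfold OmegaMinus at h1
  unfold OmegaPlus at h2
  generalize √(kerrDelta a r₀) = δ at *
  generalize sin θ₀ = s at *
  have hm : 0 < r₀ ^ 2 + a ^ 2 - a * δ * s := by
    have h3 : a * δ * s ≤ a * δ := mul_le_of_le_one_right (by positivity) hs1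
    nlinarith [sq_nonneg (a - δ), sq_nonneg r₀]
  have hp : 0 < r₀ ^ 2 + a ^ 2 + a * δ * s := by positivity
  rw [one_div_mul_eq_div, div_lt_iff₀ hm] at h1
  rw [one_div_mul_eq_div, lt_div_iff₀ hp] at h2
  have h3 := mul_lt_mul_of_pos_left h1 hs
  have h4 := mul_lt_mul_of_pos_left h2 hs
  have h5 : s * (a - δ / s) = s * a - δ := by field_simp
  have h6 : s * (a + δ / s) = s * a + δ := by field_simp
  rw [h5] at h3
  rw [h6] at h4
  rw [_root_.abs_lt]
  constructor <;> nlinarith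

theorem one_sub_pos (h : IsObserver a r₀ θ₀ Ω) : 0 < 1 - a * Ω * sin θ₀ ^ 2 :=
  pos_of_mul_pos_right ((abs_nonneg _).trans_lt h.abs_lt) (sqrt_nonneg _)

theorem uDen_pos (h : IsObserver a r₀ θ₀ Ω) : 0 < uDen a r₀ θ₀ Ω := by
  have h1 : |sin θ₀ * (Ω * (r₀ ^ 2 + a ^ 2) - a)| ^ 2 <
      (√(kerrDelta a r₀) * (1 - a * Ω * sin θ₀ ^ 2)) ^ 2 :=
    pow_lt_pow_left₀ h.abs_lt (abs_nonneg _) two_ne_zero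
  rw [sq_abs, mul_pow, mul_pow, sq_sqrt (kerrDelta_pos h.gt).le] at h1
  unfold uDen; linarith

theorem uZero_pos (h : IsObserver a r₀ θ₀ Ω) : 0 < uZero a r₀ θ₀ Ω := by
  rw [uZero_eq]
  exact div_pos (sqrt_pos.2 (rhoSq_pos _ h.gt)) (sqrt_pos.2 h.uDen_pos)

theorem uZero_sq (h : IsObserver a r₀ θ₀ Ω) :
    uZero a r₀ θ₀ Ω ^ 2 * uDen a r₀ θ₀ Ω = rhoSq a r₀ θ₀ := by
  rw [uZero_eq, div_pow, sq_sqrt (rhoSq_pos _ h.gt).le, sq_sqrt h.uDen_pos.le]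
  field_simp [h.uDen_pos.ne']

end IsObserver

/-- Lorentz factor of the observer in the Carter frame. -/
def boostC (a r₀ θ₀ Ω : ℝ) : ℝ :=
  uZero a r₀ θ₀ Ω * √(kerrDelta a r₀) * (1 - a * Ω * sin θ₀ ^ 2) / √(rhoSq a r₀ θ₀)

/-- Azimuthal velocity of the observer in the Carter frame times the Lorentz factor. -/
def boostS (a r₀ θ₀ Ω : ℝ) : ℝ :=
  uZero a r₀ θ₀ Ω * sin θ₀ * (Ω * (r₀ ^ 2 + a ^ 2) - a) / √(rhoSq a r₀ θ₀)

/-- Energy in the Carter frame of a beam with `N₂ = y`. -/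
def carterEnergy (a r₀ θ₀ Ω y : ℝ) : ℝ := boostC a r₀ θ₀ Ω - boostS a r₀ θ₀ Ω * y

/-- Azimuthal momentum in the Carter frame of a beam with `N₂ = y`. -/
def carterMomentum (a r₀ θ₀ Ω y : ℝ) : ℝ := boostS a r₀ θ₀ Ω - boostC a r₀ θ₀ Ω * y

/-- The constant of motion `E` of a beam with `N₂ = y`. -/
def beamE (a r₀ θ₀ Ω W y : ℝ) : ℝ :=
  W * (√(kerrDelta a r₀) * carterEnergy a r₀ θ₀ Ω y + a * sin θ₀ * carterMomentum a r₀ θ₀ Ω y) /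
    √(rhoSq a r₀ θ₀)

/-- The constant of motion `L` of a beam with `N₂ = y`. -/
def beamL (a r₀ θ₀ Ω W y : ℝ) : ℝ :=
  W * sin θ₀ * √(rhoSq a r₀ θ₀) * carterMomentum a r₀ θ₀ Ω y
    + a * beamE a r₀ θ₀ Ω W y * sin θ₀ ^ 2

/-- The square root of Carter's constant of a beam with `N₁ = x`, `N₂ = y`. -/
def beamκ (a r₀ θ₀ Ω W x y : ℝ) : ℝ :=
  W * √(rhoSq a r₀ θ₀) * √(x ^ 2 + carterMomentum a r₀ θ₀ Ω y ^ 2)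

/-- The initial value of `Δ p_r` of a beam with `N₃ = n`. -/
def beamV (a r₀ θ₀ W n : ℝ) : ℝ := -(W * √(rhoSq a r₀ θ₀) * √(kerrDelta a r₀) * n)

theorem sq_add_sq_add_sq (N : CelestialSphere) : N.1 0 ^ 2 + N.1 1 ^ 2 + N.1 2 ^ 2 = 1 := by
  have h := mem_sphere_zero_iff_norm.1 N.2
  rw [EuclideanSpace.norm_eq, sqrt_eq_one, Fin.sum_univ_three] at h
  simpa using h

theorem mem_celestialSphere {x : EuclideanSpace ℝ (Fin 3)}
    (h : x 0 ^ 2 + x 1 ^ 2 + x 2 ^ 2 = 1) : x ∈ Metric.sphere (0 : EuclideanSpace ℝ (Fin 3)) 1 := by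
  rw [mem_sphere_zero_iff_norm, EuclideanSpace.norm_eq, sqrt_eq_one, Fin.sum_univ_three]
  simpa using h

namespace IsObserver

variable {a r₀ θ₀ Ω : ℝ}

theorem boost_sq (h : IsObserver a r₀ θ₀ Ω) :
    boostC a r₀ θ₀ Ω ^ 2 - boostS a r₀ θ₀ Ω ^ 2 = 1 := by
  have hρ := rhoSq_pos θ₀ h.gt
  unfold boostC boostS
  rw [div_pow, div_pow, sq_sqrt hρ.le, ← sub_div, div_eq_one_iff_eq hρ.ne', ← h.uZero_sq, uDen]
  rw [mul_pow, mul_pow, sq_sqrt (kerrDelta_pos h.gt).le]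
  ring

theorem boostC_pos (h : IsObserver a r₀ θ₀ Ω) : 0 < boostC a r₀ θ₀ Ω :=
  div_pos (mul_pos (mul_pos h.uZero_pos (sqrt_pos.2 (kerrDelta_pos h.gt))) h.one_sub_pos)
    (sqrt_pos.2 (rhoSq_pos _ h.gt))

/-- The change from the observer's tetrad to the Carter frame is a Lorentz boost in the azimuthal
direction, which preserves the quadratic form. -/
theorem carter_sq (h : IsObserver a r₀ θ₀ Ω) (y : ℝ) :
    carterEnergy a r₀ θ₀ Ω y ^ 2 - carterMomentum a r₀ θ₀ Ω y ^ 2 = 1 - y ^ 2 := by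
  unfold carterEnergy carterMomentum
  linear_combination (1 - y ^ 2) * h.boost_sq

theorem carterEnergy_pos (h : IsObserver a r₀ θ₀ Ω) {y : ℝ} (hy : y ^ 2 ≤ 1) :
    0 < carterEnergy a r₀ θ₀ Ω y := by
  have h1 := h.boost_sq
  have h2 := h.boostC_pos
  have h3 : (boostS a r₀ θ₀ Ω * y) ^ 2 < boostC a r₀ θ₀ Ω ^ 2 := by
    rw [mul_pow]; nlinarith [sq_nonneg (boostS a r₀ θ₀ Ω)]
  have := lt_of_pow_lt_pow_left₀ 2 h2.le h3
  unfold carterEnergy; linarith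

theorem beamE_eq (h : IsObserver a r₀ θ₀ Ω) (W y : ℝ) : beamE a r₀ θ₀ Ω W y =
    W * uZero a r₀ θ₀ Ω * ((kerrDelta a r₀ * (1 - a * Ω * sin θ₀ ^ 2)
      + a * sin θ₀ ^ 2 * (Ω * (r₀ ^ 2 + a ^ 2) - a)) / rhoSq a r₀ θ₀
      - √(kerrDelta a r₀) * sin θ₀ * Ω * y) := by
  have hρ := rhoSq_pos θ₀ h.gt
  have hρ' : √(rhoSq a r₀ θ₀) ^ 2 = r₀ ^ 2 + a ^ 2 - a ^ 2 * sin θ₀ ^ 2 := by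
    rw [sq_sqrt hρ.le, rhoSq_eq]
  have hδ : √(kerrDelta a r₀) ^ 2 = kerrDelta a r₀ := sq_sqrt (kerrDelta_pos h.gt).le
  unfold beamE carterEnergy carterMomentum boostC boostS
  have hne : √(rhoSq a r₀ θ₀) ≠ 0 := (sqrt_pos.2 hρ).ne'
  rw [← hδ, show rhoSq a r₀ θ₀ = √(rhoSq a r₀ θ₀) ^ 2 from (sq_sqrt hρ.le).symm,
    sqrt_sq (sqrt_nonneg _), sqrt_sq (sqrt_nonneg _)]
  field_simp
  rw [hρ']
  ring

theorem beamL_eq (h : IsObserver a r₀ θ₀ Ω) (W y : ℝ) : beamL a r₀ θ₀ Ω W y =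
    W * uZero a r₀ θ₀ Ω * sin θ₀ * (sin θ₀ * (Ω * (r₀ ^ 2 + a ^ 2) - a)
      - √(kerrDelta a r₀) * (1 - a * Ω * sin θ₀ ^ 2) * y)
      + a * beamE a r₀ θ₀ Ω W y * sin θ₀ ^ 2 := by
  have hne : √(rhoSq a r₀ θ₀) ≠ 0 := (sqrt_pos.2 (rhoSq_pos θ₀ h.gt)).ne'
  unfold beamL carterMomentum boostC boostS
  field_simp

theorem radP_beam (h : IsObserver a r₀ θ₀ Ω) (W y : ℝ) :
    radP a (beamE a r₀ θ₀ Ω W y) (beamL a r₀ θ₀ Ω W y) r₀ =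
      W * √(rhoSq a r₀ θ₀) * √(kerrDelta a r₀) * carterEnergy a r₀ θ₀ Ω y := by
  have hρ := rhoSq_pos θ₀ h.gt
  have hρ' : √(rhoSq a r₀ θ₀) ^ 2 = r₀ ^ 2 + a ^ 2 - a ^ 2 * sin θ₀ ^ 2 := by
    rw [sq_sqrt hρ.le, rhoSq_eq]
  have hne : √(rhoSq a r₀ θ₀) ≠ 0 := (sqrt_pos.2 hρ).ne'
  unfold radP beamL
  have h1 : beamE a r₀ θ₀ Ω W y * (√(rhoSq a r₀ θ₀) ^ 2) = W * √(rhoSq a r₀ θ₀) *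
      (√(kerrDelta a r₀) * carterEnergy a r₀ θ₀ Ω y
        + a * sin θ₀ * carterMomentum a r₀ θ₀ Ω y) := by
    unfold beamE; field_simp
  rw [hρ'] at h1
  linear_combination h1

/-- The left side is the contraction of the covector of the beam with `e_(t)`. It fixes the scale of
`E` and `L` once their ratio is known. -/
theorem uZero_mul (h : IsObserver a r₀ θ₀ Ω) (W y : ℝ) :
    uZero a r₀ θ₀ Ω * (beamE a r₀ θ₀ Ω W y - Ω * beamL a r₀ θ₀ Ω W y) = W := by
  have hρ := (rhoSq_pos θ₀ h.gt).ne'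
  have hu := h.uZero_sq
  rw [h.beamL_eq, h.beamE_eq]
  rw [rhoSq_eq] at *
  unfold uDen at hu
  field_simp
  linear_combination W * hu

theorem mulVec_beamVector (h : IsObserver a r₀ θ₀ Ω) (t₀ φ₀ W : ℝ) (N : CelestialSphere) :
    Matrix.mulVec (metric a ![t₀, r₀, θ₀, φ₀]) (beamVector a r₀ θ₀ Ω W N) =
      ![beamE a r₀ θ₀ Ω W (N.1 1), beamV a r₀ θ₀ W (N.1 2) / kerrDelta a r₀,
        -(W * √(rhoSq a r₀ θ₀) * N.1 0), -beamL a r₀ θ₀ Ω W (N.1 1)] := by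
  have hρ := rhoSq_pos θ₀ h.gt
  have hΔ := kerrDelta_pos h.gt
  have hA := (kerrA_pos θ₀ h.gt).ne'
  have hs := h.sin_pos.ne'
  have hδ : √(kerrDelta a r₀) ≠ 0 := (sqrt_pos.2 hΔ).ne'
  have hδ2 : √(kerrDelta a r₀) ^ 2 = kerrDelta a r₀ := sq_sqrt hΔ.le
  have hρ' : √(rhoSq a r₀ θ₀) ≠ 0 := (sqrt_pos.2 hρ).ne'
  have hρ2 : √(rhoSq a r₀ θ₀) ^ 2 = rhoSq a r₀ θ₀ := sq_sqrt hρ.le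
  have hinv : (√(kerrDelta a r₀))⁻¹ = √(kerrDelta a r₀) / kerrDelta a r₀ := by
    rw [eq_div_iff hΔ.ne', ← hδ2, sqrt_sq (sqrt_nonneg _)]; field_simp
  have hg00 : -(rhoSq a r₀ θ₀ * kerrDelta a r₀ / kerrA a r₀ θ₀)
      + kerrA a r₀ θ₀ / rhoSq a r₀ θ₀ * sin θ₀ ^ 2 * kerrOmega a r₀ θ₀ ^ 2 =
      -(kerrDelta a r₀ - a ^ 2 * sin θ₀ ^ 2) / rhoSq a r₀ θ₀ := by
    have hρ0 := hρ.ne'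
    unfold kerrOmega
    field_simp
    rw [rhoSq_eq]; unfold kerrA kerrDelta; ring
  have hg03 : kerrA a r₀ θ₀ / rhoSq a r₀ θ₀ * sin θ₀ ^ 2 * kerrOmega a r₀ θ₀ =
      2 * r₀ * a * sin θ₀ ^ 2 / rhoSq a r₀ θ₀ := by
    have hρ0 := hρ.ne'
    unfold kerrOmega
    field_simp
  have hk : uZero a r₀ θ₀ Ω / (sin θ₀ * √(kerrDelta a r₀)) =
      uZero a r₀ θ₀ Ω * √(kerrDelta a r₀) / (sin θ₀ * kerrDelta a r₀) := by
    rw [div_mul_eq_div_div, div_eq_mul_inv _ √_, hinv]; field_simp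
  have he0 : kerrA a r₀ θ₀ * sin θ₀ ^ 2 / rhoSq a r₀ θ₀ * (Ω - kerrOmega a r₀ θ₀) =
      sin θ₀ ^ 2 / rhoSq a r₀ θ₀ * (kerrA a r₀ θ₀ * Ω - 2 * r₀ * a) := by
    have hρ0 := hρ.ne'
    unfold kerrOmega
    field_simp
  ext i
  fin_cases i
  · simp [metric, beamVector, eT, eR, eTheta, ePhi, Matrix.mulVec, dotProduct, Fin.sum_univ_four]
    rw [hg00, hg03, hk, he0, h.beamE_eq]
    have hρ0 := hρ.ne'
    have hΔ0 := hΔ.ne'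
    field_simp
    rw [rhoSq_eq]; unfold kerrA kerrDelta; ring
  · simp [metric, beamVector, eT, eR, eTheta, ePhi, Matrix.mulVec, dotProduct, Fin.sum_univ_four,
      beamV]
    rw [← hρ2, sqrt_sq (sqrt_nonneg _)]
    field_simp
  · simp [metric, beamVector, eT, eR, eTheta, ePhi, Matrix.mulVec, dotProduct, Fin.sum_univ_four]
    rw [← hρ2, sqrt_sq (sqrt_nonneg _)]
    field_simp
  · simp [metric, beamVector, eT, eR, eTheta, ePhi, Matrix.mulVec, dotProduct, Fin.sum_univ_four]
    rw [hg03, hk, he0, h.beamL_eq, h.beamE_eq]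
    have hρ0 := hρ.ne'
    have hΔ0 := hΔ.ne'
    field_simp
    rw [rhoSq_eq]; unfold kerrA kerrDelta; ring

theorem beamκ_sq (h : IsObserver a r₀ θ₀ Ω) (W x y : ℝ) : beamκ a r₀ θ₀ Ω W x y ^ 2 =
    W ^ 2 * rhoSq a r₀ θ₀ * (x ^ 2 + carterMomentum a r₀ θ₀ Ω y ^ 2) := by
  unfold beamκ
  rw [mul_pow, mul_pow, sq_sqrt (rhoSq_pos _ h.gt).le, sq_sqrt (by positivity)]

theorem beamV_sq (h : IsObserver a r₀ θ₀ Ω) (W : ℝ) {x y n : ℝ} (hN : x ^ 2 + y ^ 2 + n ^ 2 = 1) :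
    beamV a r₀ θ₀ W n ^ 2 = radR a (beamE a r₀ θ₀ Ω W y) (beamL a r₀ θ₀ Ω W y)
      (beamκ a r₀ θ₀ Ω W x y ^ 2) r₀ := by
  rw [radR, h.radP_beam, h.beamκ_sq, beamV]
  have h1 : √(rhoSq a r₀ θ₀) ^ 2 = rhoSq a r₀ θ₀ := sq_sqrt (rhoSq_pos _ h.gt).le
  have h2 : √(kerrDelta a r₀) ^ 2 = kerrDelta a r₀ := sq_sqrt (kerrDelta_pos h.gt).le
  have h3 := h.carter_sq y
  simp only [neg_sq, mul_pow, h1, h2]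
  linear_combination (W ^ 2 * rhoSq a r₀ θ₀ * kerrDelta a r₀) * (hN - h3)

theorem angPot_beam (h : IsObserver a r₀ θ₀ Ω) (W x y : ℝ) :
    angPot a (beamE a r₀ θ₀ Ω W y) (beamL a r₀ θ₀ Ω W y) (beamκ a r₀ θ₀ Ω W x y ^ 2) θ₀ =
      (-(W * √(rhoSq a r₀ θ₀) * x)) ^ 2 := by
  have hs := h.sin_pos.ne'
  have h1 : √(rhoSq a r₀ θ₀) ^ 2 = rhoSq a r₀ θ₀ := sq_sqrt (rhoSq_pos _ h.gt).le
  have h2 : beamL a r₀ θ₀ Ω W y / sin θ₀ - a * beamE a r₀ θ₀ Ω W y * sin θ₀ =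
      W * √(rhoSq a r₀ θ₀) * carterMomentum a r₀ θ₀ Ω y := by
    unfold beamL; field_simp; ring
  rw [angPot, h2, h.beamκ_sq, neg_sq, mul_pow, mul_pow, mul_pow, mul_pow, h1]
  ring

theorem beamData (h : IsObserver a r₀ θ₀ Ω) (W : ℝ) (N : CelestialSphere) :
    BeamData a (beamE a r₀ θ₀ Ω W (N.1 1)) (beamL a r₀ θ₀ Ω W (N.1 1))
      (beamκ a r₀ θ₀ Ω W (N.1 0) (N.1 1) ^ 2) r₀ θ₀ (beamV a r₀ θ₀ W (N.1 2))
      (-(W * √(rhoSq a r₀ θ₀) * N.1 0)) :=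
  ⟨h.beamV_sq W (sq_add_sq_add_sq N), (h.angPot_beam W _ _).symm⟩

theorem radP_beam_pos (h : IsObserver a r₀ θ₀ Ω) {W : ℝ} (hW : 0 < W) (N : CelestialSphere) :
    0 < radP a (beamE a r₀ θ₀ Ω W (N.1 1)) (beamL a r₀ θ₀ Ω W (N.1 1)) r₀ := by
  rw [h.radP_beam]
  have h1 := h.carterEnergy_pos (y := N.1 1) (by
    have := sq_add_sq_add_sq N
    nlinarith [sq_nonneg (N.1 0), sq_nonneg (N.1 2)])
  have h2 := sqrt_pos.2 (rhoSq_pos θ₀ h.gt)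
  have h3 := sqrt_pos.2 (kerrDelta_pos h.gt)
  positivity

theorem beamκ_nonneg {W : ℝ} (hW : 0 < W) (x y : ℝ) : 0 ≤ beamκ a r₀ θ₀ Ω W x y := by
  unfold beamκ; positivity

end IsObserver

/-! ### The frontier of the shadow -/

/-- Compactness of the interval makes the strict inequality stable uniformly in `r`. -/
theorem isOpen_forall_Icc {X : Type*} [TopologicalSpace X] {F : X → ℝ → ℝ}
    (hF : Continuous fun p : X × ℝ => F p.1 p.2) (l u : ℝ) :
    IsOpen {x | ∀ r ∈ Icc l u, 0 < F x r} := by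
  rw [isOpen_iff_mem_nhds]
  intro x hx
  refine isCompact_Icc.eventually_forall_of_forall_eventually fun r hr => ?_
  exact (continuousAt_const (y := (0 : ℝ))).eventually_lt hF.continuousAt (hx r hr)

theorem isOpen_captured {X : Type*} [TopologicalSpace X] {E L κ v : X → ℝ} (hE : Continuous E)
    (hL : Continuous L) (hκ : Continuous κ) (hv : Continuous v) (a r₀ : ℝ) :
    IsOpen {x | Captured a r₀ (E x) (L x) (κ x) (v x)} := by
  have h1 : IsOpen {x | ∀ r ∈ Icc (rPlus a) r₀,
      0 < radP a (E x) (L x) r - κ x * √(kerrDelta a r)} :=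
    isOpen_forall_Icc (by unfold radP kerrDelta; fun_prop) _ _
  have h2 : ∀ r, IsOpen {x | radSlope a (E x) (L x) r < 0 ∧
      radP a (E x) (L x) r < κ x * √(kerrDelta a r)} := fun r => by
    have h4 : IsOpen {x | radSlope a (E x) (L x) r < 0} :=
      isOpen_lt (by unfold radSlope radP; fun_prop) continuous_const
    have h5 : IsOpen {x | radP a (E x) (L x) r < κ x * √(kerrDelta a r)} :=
      isOpen_lt (by unfold radP; fun_prop) (by fun_prop)
    exact h4.inter h5
  have h3 : {x | Captured a r₀ (E x) (L x) (κ x) (v x)} =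
      ({x | v x < 0} ∩ {x | ∀ r ∈ Icc (rPlus a) r₀,
        0 < radP a (E x) (L x) r - κ x * √(kerrDelta a r)}) ∪
      ({x | 0 < κ x} ∩ ⋃ r ∈ Ioi r₀, {x | radSlope a (E x) (L x) r < 0 ∧
        radP a (E x) (L x) r < κ x * √(kerrDelta a r)}) := by
    ext x; simp [Captured, and_left_comm]
  rw [h3]
  exact ((isOpen_lt hv continuous_const).inter h1).union
    ((isOpen_lt continuous_const hκ).inter (isOpen_biUnion fun r _ => h2 r))

theorem isOpen_escaping {X : Type*} [TopologicalSpace X] {E L κ v : X → ℝ} (hE : Continuous E)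
    (hL : Continuous L) (hκ : Continuous κ) (hv : Continuous v) (a r₀ : ℝ) :
    IsOpen {x | Escaping a r₀ (E x) (L x) (κ x) (v x)} := by
  have h1 : ∀ u, IsOpen {x | ∀ r ∈ Icc r₀ u,
      0 < radP a (E x) (L x) r - κ x * √(kerrDelta a r)} := fun u =>
    isOpen_forall_Icc (by unfold radP kerrDelta; fun_prop) _ _
  have h2 : ∀ r, IsOpen {x | |radP a (E x) (L x) r| < κ x * √(kerrDelta a r)} := fun r =>
    isOpen_lt (by unfold radP; fun_prop) (by fun_prop)
  have h4 : ∀ r, IsOpen {x | 0 < radSlope a (E x) (L x) r} := fun r =>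
    isOpen_lt continuous_const (by unfold radSlope radP; fun_prop)
  have h3 : {x | Escaping a r₀ (E x) (L x) (κ x) (v x)} =
      (⋃ r ∈ Ioo (rPlus a) r₀, {x | |radP a (E x) (L x) r| < κ x * √(kerrDelta a r)}) ∪
      ({x | 0 < v x} ∩ {x | 0 < E x} ∩ ⋃ r ∈ Ioi r₀, ({x | 0 < radSlope a (E x) (L x) r} ∩
        {x | ∀ y ∈ Icc r₀ r, 0 < radP a (E x) (L x) y - κ x * √(kerrDelta a y)})) := by
    ext x; simp [Escaping, and_assoc, and_left_comm]
  rw [h3]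
  exact (isOpen_biUnion fun r _ => h2 r).union
    (((isOpen_lt continuous_const hv).inter (isOpen_lt continuous_const hE)).inter
      (isOpen_biUnion fun r _ => (h4 r).inter (h1 r)))

/-- The directions of the beams that satisfy the criterion for capture. -/
def capturedSet (a r₀ θ₀ Ω W : ℝ) : Set CelestialSphere :=
  {N | Captured a r₀ (beamE a r₀ θ₀ Ω W (N.1 1)) (beamL a r₀ θ₀ Ω W (N.1 1))
    (beamκ a r₀ θ₀ Ω W (N.1 0) (N.1 1)) (beamV a r₀ θ₀ W (N.1 2))}

/-- The directions of the beams that satisfy the criterion for escape. -/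
def escapingSet (a r₀ θ₀ Ω W : ℝ) : Set CelestialSphere :=
  {N | Escaping a r₀ (beamE a r₀ θ₀ Ω W (N.1 1)) (beamL a r₀ θ₀ Ω W (N.1 1))
    (beamκ a r₀ θ₀ Ω W (N.1 0) (N.1 1)) (beamV a r₀ θ₀ W (N.1 2))}

/-- The directions of the beams that are asymptotic to a spherical orbit of radius `rc`. -/
def IsCritical (a r₀ θ₀ Ω W rc : ℝ) (N : CelestialSphere) : Prop :=
  CriticalRadius a (beamE a r₀ θ₀ Ω W (N.1 1)) (beamL a r₀ θ₀ Ω W (N.1 1)) rc ∧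
    beamV a r₀ θ₀ W (N.1 2) =
      -threshold a r₀ (beamE a r₀ θ₀ Ω W (N.1 1)) (beamL a r₀ θ₀ Ω W (N.1 1)) rc

theorem continuous_beamE (a r₀ θ₀ Ω W : ℝ) : Continuous (beamE a r₀ θ₀ Ω W) := by
  unfold beamE carterEnergy carterMomentum
  refine Continuous.div_const ?_ _
  fun_prop

theorem continuous_beamL (a r₀ θ₀ Ω W : ℝ) : Continuous (beamL a r₀ θ₀ Ω W) := by
  have := continuous_beamE a r₀ θ₀ Ω W
  unfold beamL carterMomentum
  fun_prop

theorem continuous_coord (i : Fin 3) : Continuous fun N : CelestialSphere => N.1 i :=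
  (EuclideanSpace.proj (𝕜 := ℝ) i).continuous.comp continuous_subtype_val

theorem continuous_beamκ (a r₀ θ₀ Ω W : ℝ) :
    Continuous fun N : CelestialSphere => beamκ a r₀ θ₀ Ω W (N.1 0) (N.1 1) := by
  have h0 := continuous_coord 0
  have h1 := continuous_coord 1
  unfold beamκ carterMomentum
  fun_prop

theorem continuous_beamV (a r₀ θ₀ W : ℝ) :
    Continuous fun N : CelestialSphere => beamV a r₀ θ₀ W (N.1 2) := by
  have h0 := continuous_coord 2
  unfold beamV
  fun_prop

/-- Rotation of a direction about the `φ` axis of the tetrad. -/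
def rotate (N : CelestialSphere) (t : ℝ) : CelestialSphere :=
  ⟨!₂[N.1 0 * cos t - N.1 2 * sin t, N.1 1, N.1 0 * sin t + N.1 2 * cos t],
    mem_celestialSphere (by
      have h := sq_add_sq_add_sq N
      simp
      linear_combination h + (N.1 0 ^ 2 + N.1 2 ^ 2) * sin_sq_add_cos_sq t)⟩

theorem tendsto_rotate (N : CelestialSphere) : Tendsto (rotate N) (𝓝 0) (𝓝 N) := by
  have h0 : rotate N 0 = N := by
    apply Subtype.ext
    ext i
    fin_cases i <;> simp [rotate]
  have hc : Continuous (rotate N) := by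
    unfold rotate
    refine Continuous.subtype_mk ?_ _
    refine (PiLp.continuous_toLp 2 _).comp (continuous_pi fun i => ?_)
    fin_cases i <;> simp <;> fun_prop
  have := hc.tendsto 0
  rwa [h0] at this

/-- The component `N₃` has derivative `N₁ ≠ 0` along the rotation, so the value at `t = 0` is not a
local extremum. -/
theorem rotate_frequently {N : CelestialSphere} (h : N.1 0 ≠ 0) :
    (∃ᶠ t in 𝓝 0, N.1 2 < (rotate N t).1 2) ∧ ∃ᶠ t in 𝓝 0, (rotate N t).1 2 < N.1 2 := by
  have h0 : (rotate N 0).1 2 = N.1 2 := by simp [rotate]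
  have hd : HasDerivAt (fun t => (rotate N t).1 2) (N.1 0) 0 := by
    have h1 := ((hasDerivAt_sin 0).const_mul (N.1 0)).add ((hasDerivAt_cos 0).const_mul (N.1 2))
    convert! h1 using 1
    simp
  constructor
  · intro hcon
    have hmax : IsLocalMax (fun t => (rotate N t).1 2) 0 := by
      filter_upwards [hcon] with t ht
      rw [h0]; exact not_lt.1 ht
    exact h (hmax.hasDerivAt_eq_zero hd)
  · intro hcon
    have hmin : IsLocalMin (fun t => (rotate N t).1 2) 0 := by
      filter_upwards [hcon] with t ht
      rw [h0]; exact not_lt.1 ht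
    exact h (hmin.hasDerivAt_eq_zero hd)

namespace IsObserver

variable {a r₀ θ₀ Ω W : ℝ}

theorem capturedSet_subset (h : IsObserver a r₀ θ₀ Ω) (hW : 0 < W) (φ₀ t₀ : ℝ) :
    capturedSet a r₀ θ₀ Ω W ⊆ shadow a r₀ θ₀ Ω φ₀ t₀ W := fun N hN =>
  Captured.evolvesOntoHorizon hN h.sq_le h.gt h.mem (beamκ_nonneg hW _ _) (h.radP_beam_pos hW N)
    (h.beamData W N) (h.mulVec_beamVector t₀ _ W N)

theorem escapingSet_subset (h : IsObserver a r₀ θ₀ Ω) (hW : 0 < W) (φ₀ t₀ : ℝ) :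
    escapingSet a r₀ θ₀ Ω W ⊆ (shadow a r₀ θ₀ Ω φ₀ t₀ W)ᶜ := fun N hN =>
  Escaping.not_evolvesOntoHorizon hN h.sq_le h.gt h.mem (beamκ_nonneg hW _ _)
    (h.beamData W N) (h.mulVec_beamVector t₀ _ W N)

theorem isOpen_capturedSet (a r₀ θ₀ Ω W : ℝ) : IsOpen (capturedSet a r₀ θ₀ Ω W) :=
  isOpen_captured ((continuous_beamE a r₀ θ₀ Ω W).comp (continuous_coord 1))
    ((continuous_beamL a r₀ θ₀ Ω W).comp (continuous_coord 1)) (continuous_beamκ a r₀ θ₀ Ω W)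
    (continuous_beamV a r₀ θ₀ W) a r₀

theorem isOpen_escapingSet (a r₀ θ₀ Ω W : ℝ) : IsOpen (escapingSet a r₀ θ₀ Ω W) :=
  isOpen_escaping ((continuous_beamE a r₀ θ₀ Ω W).comp (continuous_coord 1))
    ((continuous_beamL a r₀ θ₀ Ω W).comp (continuous_coord 1)) (continuous_beamκ a r₀ θ₀ Ω W)
    (continuous_beamV a r₀ θ₀ W) a r₀

/-- Beams with `E ≤ 0` are captured, those with `P(r₊) ≤ 0` escape, and all others possess a
critical radius, where the trichotomy for `Δ p_r` against the threshold decides. -/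
theorem classification (h : IsObserver a r₀ θ₀ Ω) (hW : 0 < W)
    (hext : a = 1 → 2 * sin θ₀ < 1 + cos θ₀ ^ 2) (N : CelestialSphere) :
    N ∈ capturedSet a r₀ θ₀ Ω W ∨ N ∈ escapingSet a r₀ θ₀ Ω W ∨
      ∃ rc, IsCritical a r₀ θ₀ Ω W rc N := by
  have ha := h.sq_le
  have hs := h.sin_pos
  have hP := h.radP_beam_pos hW N
  have hκ := beamκ_nonneg (a := a) (r₀ := r₀) (θ₀ := θ₀) (Ω := Ω) hW (N.1 0) (N.1 1)
  have hv := h.beamV_sq W (sq_add_sq_add_sq N)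
  have hρ := sqrt_pos.2 (rhoSq_pos θ₀ h.gt)
  have hδ := sqrt_pos.2 (kerrDelta_pos h.gt)
  have hε := h.carterEnergy_pos (y := N.1 1) (by
    have := sq_add_sq_add_sq N
    nlinarith [sq_nonneg (N.1 0), sq_nonneg (N.1 2)])
  have hD : beamL a r₀ θ₀ Ω W (N.1 1) - a * beamE a r₀ θ₀ Ω W (N.1 1) * sin θ₀ ^ 2 =
      W * sin θ₀ * √(rhoSq a r₀ θ₀) * carterMomentum a r₀ θ₀ Ω (N.1 1) := by
    unfold beamL; ring
  have hκμ : W * √(rhoSq a r₀ θ₀) * carterMomentum a r₀ θ₀ Ω (N.1 1) ≤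
      beamκ a r₀ θ₀ Ω W (N.1 0) (N.1 1) := by
    unfold beamκ
    refine mul_le_mul_of_nonneg_left (le_sqrt_of_sq_le ?_) (by positivity)
    linarith [sq_nonneg (N.1 0)]
  -- If `κ = 0`, then `N₁` and the Carter azimuthal momentum vanish, so `L = a E sin² θ₀` with `E >
  -- 0`, and `E a² - a L = E a² cos² θ₀ ≥ 0`. This excludes both cases.
  have hκpos : beamE a r₀ θ₀ Ω W (N.1 1) ≤ 0 ∨ beamE a r₀ θ₀ Ω W (N.1 1) * a ^ 2
      - a * beamL a r₀ θ₀ Ω W (N.1 1) ≤ -(beamE a r₀ θ₀ Ω W (N.1 1) * rPlus a ^ 2) →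
      0 < beamκ a r₀ θ₀ Ω W (N.1 0) (N.1 1) := by
    intro hcase
    refine lt_of_le_of_ne hκ fun h0 => ?_
    have h1 := h.beamκ_sq W (N.1 0) (N.1 1)
    rw [← h0, zero_pow two_ne_zero] at h1
    have h2 : N.1 0 ^ 2 + carterMomentum a r₀ θ₀ Ω (N.1 1) ^ 2 = 0 := by
      have := rhoSq_pos θ₀ h.gt
      rcases mul_eq_zero.1 h1.symm with h3 | h3
      · exact absurd h3 (by positivity)
      · exact h3
    have h3 : carterMomentum a r₀ θ₀ Ω (N.1 1) = 0 := by
      have := sq_nonneg (N.1 0)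
      have h4 := sq_nonneg (carterMomentum a r₀ θ₀ Ω (N.1 1))
      exact pow_eq_zero_iff two_ne_zero |>.1 (by linarith)
    have hE : 0 < beamE a r₀ θ₀ Ω W (N.1 1) := by
      unfold beamE; rw [h3]; simp only [mul_zero, add_zero]; positivity
    rw [h3, mul_zero, sub_eq_zero] at hD
    rcases hcase with h4 | h4
    · linarith
    · have h5 : beamE a r₀ θ₀ Ω W (N.1 1) * a ^ 2 - a * beamL a r₀ θ₀ Ω W (N.1 1) =
          beamE a r₀ θ₀ Ω W (N.1 1) * (a ^ 2 * cos θ₀ ^ 2) := by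
        rw [hD, cos_sq']; ring
      have h6 : 0 ≤ beamE a r₀ θ₀ Ω W (N.1 1) * (a ^ 2 * cos θ₀ ^ 2) := by positivity
      have h7 : 0 < beamE a r₀ θ₀ Ω W (N.1 1) * rPlus a ^ 2 := by
        have := rPlus_pos a; positivity
      linarith
  rcases le_or_gt (beamE a r₀ θ₀ Ω W (N.1 1)) 0 with hE | hE
  · exact Or.inl (captured_of_energy_nonpos _ ha h.gt (hκpos (Or.inl hE)) hP hE)
  rcases le_or_gt (beamE a r₀ θ₀ Ω W (N.1 1) * a ^ 2 - a * beamL a r₀ θ₀ Ω W (N.1 1))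
    (-(beamE a r₀ θ₀ Ω W (N.1 1) * rPlus a ^ 2)) with hb | hb
  · refine Or.inr (Or.inl (escaping_of_ratio_le _ ha h.gt (hκpos (Or.inr hb)) hP hE hb
      fun ha1 hbe => ?_))
    have ha' : a = 1 := by
      have := h.a_pos
      nlinarith [h.a_le]
    have hr1 : rPlus a = 1 := by unfold rPlus; rw [ha1]; simp
    rw [hr1, ha'] at hbe
    have h1 := hext ha'
    -- In the extremal borderline case `L = 2E`, so `κ sin θ₀ ≥ L - E sin² θ₀ = E (1 + cos² θ₀) > 2
    -- E sin θ₀` by `hext`.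
    have h2 : W * sin θ₀ * √(rhoSq a r₀ θ₀) * carterMomentum a r₀ θ₀ Ω (N.1 1) =
        beamE a r₀ θ₀ Ω W (N.1 1) * (1 + cos θ₀ ^ 2) := by
      rw [← hD, cos_sq', ha']
      linear_combination -hbe
    have h3 := mul_le_mul_of_nonneg_left hκμ hs.le
    have h4 := mul_lt_mul_of_pos_left h1 hE
    have h5 : sin θ₀ * (2 * beamE a r₀ θ₀ Ω W (N.1 1)) <
        sin θ₀ * beamκ a r₀ θ₀ Ω W (N.1 0) (N.1 1) := by linarith
    exact lt_of_mul_lt_mul_left h5 hs.le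
  · obtain ⟨rc, hrc, hrceq⟩ := exists_critRatio_eq (a := a) (c := (beamE a r₀ θ₀ Ω W (N.1 1) * a ^ 2
      - a * beamL a r₀ θ₀ Ω W (N.1 1)) / beamE a r₀ θ₀ Ω W (N.1 1)) ha (by
        rw [lt_div_iff₀ hE]; linarith)
    have hcr : CriticalRadius a (beamE a r₀ θ₀ Ω W (N.1 1)) (beamL a r₀ θ₀ Ω W (N.1 1)) rc :=
      ⟨hE, hrc, by rw [hrceq]; field_simp⟩
    rcases lt_trichotomy (beamV a r₀ θ₀ W (N.1 2)) (-threshold a r₀ (beamE a r₀ θ₀ Ω W (N.1 1))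
      (beamL a r₀ θ₀ Ω W (N.1 1)) rc) with h1 | h1 | h1
    · exact Or.inl (hcr.captured ha h.gt hκ hv h1)
    · exact Or.inr (Or.inr ⟨rc, hcr, h1⟩)
    · exact Or.inr (Or.inl (hcr.escaping ha h.gt hκ hv h1))

theorem exists_isCritical_of_mem_frontier (h : IsObserver a r₀ θ₀ Ω) (hW : 0 < W)
    (hext : a = 1 → 2 * sin θ₀ < 1 + cos θ₀ ^ 2) {φ₀ t₀ : ℝ} {N : CelestialSphere}
    (hN : N ∈ frontier (shadow a r₀ θ₀ Ω φ₀ t₀ W)) : ∃ rc, IsCritical a r₀ θ₀ Ω W rc N := by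
  rcases h.classification hW hext N with h1 | h1 | h1
  · exact absurd (interior_maximal (h.capturedSet_subset hW φ₀ t₀) (isOpen_capturedSet ..) h1) hN.2
  · rw [frontier_eq_closure_inter_closure] at hN
    have h2 := interior_maximal (h.escapingSet_subset hW φ₀ t₀) (isOpen_escapingSet ..) h1
    rw [interior_compl] at h2
    exact absurd hN.1 h2
  · exact h1

/-- The rotation fixes `N₂`, so `E`, `L` and the threshold stay the same while `N₃` takes values on
both sides of the critical one arbitrarily close to `N`. -/
theorem mem_frontier_of_isCritical (h : IsObserver a r₀ θ₀ Ω) (hW : 0 < W) {φ₀ t₀ rc : ℝ}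
    {N : CelestialSphere} (hN : IsCritical a r₀ θ₀ Ω W rc N) (h0 : N.1 0 ≠ 0) :
    N ∈ frontier (shadow a r₀ θ₀ Ω φ₀ t₀ W) := by
  have ha := h.sq_le
  obtain ⟨hcr, hth⟩ := hN
  have hpos : 0 < W * √(rhoSq a r₀ θ₀) * √(kerrDelta a r₀) := by
    have h2 := sqrt_pos.2 (rhoSq_pos θ₀ h.gt)
    have h3 := sqrt_pos.2 (kerrDelta_pos h.gt)
    positivity
  have h1 : ∀ t, (rotate N t).1 1 = N.1 1 := fun t => by simp [rotate]
  have hv : ∀ t, beamV a r₀ θ₀ W ((rotate N t).1 2) ^ 2 = radR a (beamE a r₀ θ₀ Ω W (N.1 1))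
      (beamL a r₀ θ₀ Ω W (N.1 1)) (beamκ a r₀ θ₀ Ω W ((rotate N t).1 0) (N.1 1) ^ 2) r₀ :=
    fun t => by
      have := h.beamV_sq W (sq_add_sq_add_sq (rotate N t))
      rwa [h1] at this
  rw [frontier_eq_closure_inter_closure]
  constructor
  · refine closure_mono (h.capturedSet_subset hW φ₀ t₀) (mem_closure_iff_frequently.2 ?_)
    refine (tendsto_rotate N).frequently ((rotate_frequently h0).1.mono fun t ht => ?_)
    change Captured _ _ _ _ _ _
    rw [h1]
    refine hcr.captured ha h.gt (beamκ_nonneg hW _ _) (hv t) ?_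
    rw [← hth]
    unfold beamV
    have := mul_lt_mul_of_pos_left ht hpos
    linarith
  · refine closure_mono (h.escapingSet_subset hW φ₀ t₀) (mem_closure_iff_frequently.2 ?_)
    refine (tendsto_rotate N).frequently ((rotate_frequently h0).2.mono fun t ht => ?_)
    change Escaping _ _ _ _ _ _
    rw [h1]
    refine hcr.escaping ha h.gt (beamκ_nonneg hW _ _) (hv t) ?_
    rw [← hth]
    unfold beamV
    have := mul_lt_mul_of_pos_left ht hpos
    linarith

end IsObserver

/-! ### The zeros of `Θ_*` -/

theorem lam_eq {a r : ℝ} (ha : a ≠ 0) (hr : 1 < r) : lam a r = (a ^ 2 - critRatio a r) / a := by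
  have h1 : r - 1 ≠ 0 := by linarith
  have h2 : 1 - r ≠ 0 := by linarith
  unfold lam critRatio
  field_simp
  ring

theorem critRatio_eq_sub {a r : ℝ} (hr : 1 < r) :
    critRatio a r = 2 * r * kerrDelta a r / (r - 1) - r ^ 2 := by
  have h1 : r - 1 ≠ 0 := by linarith
  unfold critRatio kerrDelta
  field_simp
  ring

theorem eta_eq {a r : ℝ} (ha : a ≠ 0) (hr : 1 < r) :
    eta a r = 4 * r ^ 2 * kerrDelta a r / (r - 1) ^ 2 - (lam a r - a) ^ 2 := by
  have h1 : r - 1 ≠ 0 := by linarith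
  have h2 : 1 - r ≠ 0 := by linarith
  rw [lam_eq ha hr]
  unfold critRatio eta kerrDelta
  field_simp
  ring

/-- This identifies `Θ_*` as the angular potential at `θ₀` for `E = 1`, `L = λ(r)` and the Carter
constant `P²/Δ` of the spherical orbit. -/
theorem ThetaStar_eq_sub {a θ₀ r : ℝ} (ha : a ≠ 0) (hs : sin θ₀ ≠ 0) (hr : 1 < r) :
    ThetaStar a θ₀ r =
      4 * r ^ 2 * kerrDelta a r / (r - 1) ^ 2 - (lam a r / sin θ₀ - a * sin θ₀) ^ 2 := by
  rw [ThetaStar, eta_eq ha hr, cos_sq']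
  field_simp
  ring

/-- A strictly increasing function that takes the values `± a sin θ₀` at the zeros of `Θ_*`. -/
def thetaMono (a θ₀ r : ℝ) : ℝ :=
  √(kerrDelta a r) - (r ^ 2 + a ^ 2 * cos θ₀ ^ 2) * (r - 1) / (2 * r * √(kerrDelta a r))

/-- Both squares in `ThetaStar_eq_sub` contain the same factor, because `r² + a² - a λ = 2 r Δ / (r
- 1)`. -/
theorem ThetaStar_eq_mul {a θ₀ r : ℝ} (ha : a ≠ 0) (hs : sin θ₀ ≠ 0) (hr : rPlus a < r) :
    ThetaStar a θ₀ r = (2 * r * √(kerrDelta a r) / ((r - 1) * (a * sin θ₀))) ^ 2 *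
      ((a * sin θ₀) ^ 2 - thetaMono a θ₀ r ^ 2) := by
  have hr1 := one_lt_of_rPlus_lt hr
  have h1 : r - 1 ≠ 0 := by linarith
  have hr0 : r ≠ 0 := by linarith
  have hΔ := kerrDelta_pos hr
  have hδ : √(kerrDelta a r) ≠ 0 := (sqrt_pos.2 hΔ).ne'
  have hδ2 : √(kerrDelta a r) ^ 2 = kerrDelta a r := sq_sqrt hΔ.le
  rw [ThetaStar_eq_sub ha hs hr1, lam_eq ha hr1, critRatio_eq_sub hr1, thetaMono, ← hδ2,
    sqrt_sq (sqrt_nonneg _)]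
  generalize √(kerrDelta a r) = δ at *
  have hc : cos θ₀ ^ 2 = 1 - sin θ₀ ^ 2 := cos_sq' θ₀
  rw [hc]
  field_simp
  ring

theorem thetaMono_strictMonoOn {a : ℝ} (ha : a ^ 2 ≤ 1) (θ₀ : ℝ) :
    StrictMonoOn (thetaMono a θ₀) (Ioi (rPlus a)) := by
  intro x hx y hy hxy
  rw [mem_Ioi] at hx hy
  set j := 1 - a ^ 2 with hj
  have hj0 : 0 ≤ j := by linarith
  have hδ : ∀ {r}, rPlus a < r → 0 < √(kerrDelta a r) := fun hr => sqrt_pos.2 (kerrDelta_pos hr)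
  have hδ2 : ∀ {r}, rPlus a < r → √(kerrDelta a r) ^ 2 = (r - 1) ^ 2 - j := fun hr => by
    rw [sq_sqrt (kerrDelta_pos hr).le, kerrDelta_eq]
  have hx1 := one_lt_of_rPlus_lt hx
  have hy1 := one_lt_of_rPlus_lt hy
  have hlt : √(kerrDelta a x) < √(kerrDelta a y) := by
    refine sqrt_lt_sqrt (kerrDelta_pos hx).le ?_
    rw [kerrDelta_eq, kerrDelta_eq]
    nlinarith
  -- With `Δ = (r - 1)² - j` every term becomes monotone: `√Δ` increases strictly, and the
  -- subtracted quotients do not increase.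
  have heq : ∀ {r}, rPlus a < r → 2 * thetaMono a θ₀ r = √(kerrDelta a r) - j / √(kerrDelta a r)
      - (r - 1) / √(kerrDelta a r) * (1 + a ^ 2 * cos θ₀ ^ 2 / r) := fun {r} hr => by
    have h1 := (hδ hr).ne'
    have h2 : r ≠ 0 := by linarith [one_lt_of_rPlus_lt hr]
    have h3 := hδ2 hr
    unfold thetaMono
    field_simp
    linear_combination r * h3
  have h1 : j / √(kerrDelta a y) ≤ j / √(kerrDelta a x) :=
    div_le_div_of_nonneg_left hj0 (hδ hx) hlt.le
  have h2 : (y - 1) / √(kerrDelta a y) ≤ (x - 1) / √(kerrDelta a x) := by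
    rw [div_le_div_iff₀ (hδ hy) (hδ hx)]
    refine le_of_sq_le_sq ?_ (mul_nonneg (by linarith) (hδ hy).le)
    rw [mul_pow, mul_pow, hδ2 hx, hδ2 hy]
    have : (x - 1) ^ 2 ≤ (y - 1) ^ 2 := by
      have : 0 ≤ x - 1 := by linarith
      gcongr
    nlinarith
  have h3 : a ^ 2 * cos θ₀ ^ 2 / y ≤ a ^ 2 * cos θ₀ ^ 2 / x :=
    div_le_div_of_nonneg_left (by positivity) (by linarith) hxy.le
  have h4 : (y - 1) / √(kerrDelta a y) * (1 + a ^ 2 * cos θ₀ ^ 2 / y) ≤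
      (x - 1) / √(kerrDelta a x) * (1 + a ^ 2 * cos θ₀ ^ 2 / x) := by
    have h5 : 0 ≤ a ^ 2 * cos θ₀ ^ 2 / y := div_nonneg (by positivity) (by linarith)
    have h6 : 0 ≤ (x - 1) / √(kerrDelta a x) := div_nonneg (by linarith) (hδ hx).le
    gcongr
  have := heq hx
  have := heq hy
  linarith

section zeros

variable {a θ₀ r : ℝ}

theorem ThetaStar_eq_zero_iff (ha : 0 < a) (hs : 0 < sin θ₀) (hr : rPlus a < r) :
    ThetaStar a θ₀ r = 0 ↔ thetaMono a θ₀ r = a * sin θ₀ ∨ thetaMono a θ₀ r = -(a * sin θ₀) := by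
  have hr1 := one_lt_of_rPlus_lt hr
  have hδ := sqrt_pos.2 (kerrDelta_pos hr)
  have h1 : 0 < r - 1 := by linarith
  have h0 : 0 < 2 * r * √(kerrDelta a r) / ((r - 1) * (a * sin θ₀)) := by positivity
  rw [ThetaStar_eq_mul ha.ne' hs.ne' hr, mul_eq_zero, or_iff_right (by positivity), sub_eq_zero,
    eq_comm, sq_eq_sq_iff_eq_or_eq_neg]

theorem thetaMono_of_zeros (ha : 0 < a) (ha1 : a ≤ 1) (hs : 0 < sin θ₀) {r₁ r₂ : ℝ}
    (h1 : rPlus a < r₁) (h12 : r₁ < r₂) (hz1 : ThetaStar a θ₀ r₁ = 0)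
    (hz2 : ThetaStar a θ₀ r₂ = 0) :
    thetaMono a θ₀ r₁ = -(a * sin θ₀) ∧ thetaMono a θ₀ r₂ = a * sin θ₀ := by
  have h2 := h1.trans h12
  have hlt := thetaMono_strictMonoOn (by nlinarith) θ₀ h1 h2 h12
  have has : 0 < a * sin θ₀ := mul_pos ha hs
  rw [ThetaStar_eq_zero_iff ha hs h1] at hz1
  rw [ThetaStar_eq_zero_iff ha hs h2] at hz2
  rcases hz1 with h3 | h3 <;> rcases hz2 with h4 | h4 <;> constructor <;> linarith

theorem zeros_ThetaStar (ha : 0 < a) (ha1 : a ≤ 1) (hs : 0 < sin θ₀) {r₁ r₂ : ℝ}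
    (h1 : rPlus a < r₁) (h12 : r₁ < r₂) (hz1 : ThetaStar a θ₀ r₁ = 0)
    (hz2 : ThetaStar a θ₀ r₂ = 0) :
    {rc : ℝ | rPlus a < rc ∧ ThetaStar a θ₀ rc = 0} = {r₁, r₂} := by
  have h2 := h1.trans h12
  have hinj := (thetaMono_strictMonoOn (by nlinarith) θ₀ : StrictMonoOn _ (Ioi (rPlus a))).injOn
  obtain ⟨h3, h4⟩ := thetaMono_of_zeros ha ha1 hs h1 h12 hz1 hz2
  ext r
  constructor
  · rintro ⟨hr, hz⟩
    rw [ThetaStar_eq_zero_iff ha hs hr, ← h3, ← h4] at hz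
    rcases hz with hz | hz
    · exact Or.inr (hinj hr h2 hz)
    · exact Or.inl (hinj hr h1 hz)
  · rintro (rfl | rfl)
    · exact ⟨h1, hz1⟩
    · exact ⟨h2, hz2⟩

theorem ThetaStar_pos (ha : 0 < a) (ha1 : a ≤ 1) (hs : 0 < sin θ₀) {r₁ r₂ : ℝ}
    (h1 : rPlus a < r₁) (hz1 : ThetaStar a θ₀ r₁ = 0)
    (hz2 : ThetaStar a θ₀ r₂ = 0) (hr : r ∈ Ioo r₁ r₂) : 0 < ThetaStar a θ₀ r := by
  have h12 := hr.1.trans hr.2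
  have hm := thetaMono_strictMonoOn (a := a) (by nlinarith) θ₀
  obtain ⟨h3, h4⟩ := thetaMono_of_zeros ha ha1 hs h1 h12 hz1 hz2
  have hr' := h1.trans hr.1
  have h5 := hm h1 hr' hr.1
  have h6 := hm hr' (hr'.trans hr.2) hr.2
  have hδ := sqrt_pos.2 (kerrDelta_pos hr')
  have h7 : 0 < r - 1 := by linarith [one_lt_of_rPlus_lt hr']
  have h8 : 0 < r := by linarith
  rw [ThetaStar_eq_mul ha.ne' hs.ne' hr']
  rw [h3] at h5
  rw [h4] at h6
  refine mul_pos (by positivity) ?_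
  nlinarith

theorem mem_Icc_of_ThetaStar_nonneg (ha : 0 < a) (ha1 : a ≤ 1) (hs : 0 < sin θ₀) {r₁ r₂ : ℝ}
    (h1 : rPlus a < r₁) (h12 : r₁ < r₂) (hz1 : ThetaStar a θ₀ r₁ = 0)
    (hz2 : ThetaStar a θ₀ r₂ = 0) (hr : rPlus a < r) (h : 0 ≤ ThetaStar a θ₀ r) :
    r ∈ Icc r₁ r₂ := by
  have h2 := h1.trans h12
  have hm := thetaMono_strictMonoOn (a := a) (by nlinarith) θ₀
  obtain ⟨h3, h4⟩ := thetaMono_of_zeros ha ha1 hs h1 h12 hz1 hz2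
  have hδ := sqrt_pos.2 (kerrDelta_pos hr)
  have h7 : 0 < r - 1 := by linarith [one_lt_of_rPlus_lt hr]
  have h8 : 0 < r := by linarith
  rw [ThetaStar_eq_mul ha.ne' hs.ne' hr] at h
  have h9 := nonneg_of_mul_nonneg_right h (by positivity)
  have h10 := abs_le_of_sq_le_sq' (by linarith : thetaMono a θ₀ r ^ 2 ≤ (a * sin θ₀) ^ 2)
    (mul_pos ha hs).le
  constructor
  · rw [← hm.le_iff_le h1 hr, h3]; exact h10.1
  · rw [← hm.le_iff_le hr h2, h4]; exact h10.2

/-- For `a = 1` one has `√Δ = r - 1`, and the equation for the smaller zero becomes `r² - 2 r (1 -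
sin θ₀) - cos² θ₀ = 0`. A root beyond `1` forces a negative value at `r = 1`, which is the claim. It
disposes of the borderline case of the extremal hole. -/
theorem two_mul_sin_lt_of_zeros (hs : 0 < sin θ₀) {r₁ r₂ : ℝ}
    (h1 : rPlus 1 < r₁) (h12 : r₁ < r₂) (hz1 : ThetaStar 1 θ₀ r₁ = 0)
    (hz2 : ThetaStar 1 θ₀ r₂ = 0) : 2 * sin θ₀ < 1 + cos θ₀ ^ 2 := by
  have h3 := (thetaMono_of_zeros one_pos le_rfl hs h1 h12 hz1 hz2).1
  have hr1 := one_lt_of_rPlus_lt h1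
  have hΔ : √(kerrDelta 1 r₁) = r₁ - 1 := by
    rw [kerrDelta_eq]
    simp only [one_pow, sub_self, sub_zero]
    exact sqrt_sq (by linarith)
  have h4 : r₁ - 1 ≠ 0 := by linarith
  have h5 : r₁ ≠ 0 := by linarith
  rw [thetaMono, hΔ] at h3
  field_simp at h3
  nlinarith [sq_nonneg (cos θ₀), cos_sq_le_one θ₀]

/-! ### Bounds by the radii of the circular photon orbits -/

theorem eta_pos_of_abs_lam_le (ha : 0 < a) (hr : rPlus a < r) (h : |lam a r| ≤ a) :
    0 < eta a r := by
  have hr1 := one_lt_of_rPlus_lt hr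
  have hΔ := kerrDelta_pos hr
  have h1 : r - 1 ≠ 0 := by linarith
  obtain ⟨h2, h3⟩ := abs_le.1 h
  have hP : r ^ 2 + a * (a - lam a r) = 2 * r * kerrDelta a r / (r - 1) := by
    rw [lam_eq ha.ne' hr1, critRatio_eq_sub hr1]
    field_simp
    ring
  set y := a - lam a r with hy
  have hy0 : 0 ≤ y := by linarith
  have hy1 : y ≤ 2 * a := by linarith
  -- Expanding with `Δ = r² - 2r + a²` gives `r⁴ + r² y (2a - y) + 2 r y²`, positive for `0 ≤ y ≤
  -- 2a`.
  have h4 : kerrDelta a r * eta a r = (r ^ 2 + a * y) ^ 2 - kerrDelta a r * y ^ 2 := by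
    rw [eta_eq ha.ne' hr1, hP, hy]
    field_simp
    ring
  have h5 : 0 < kerrDelta a r * eta a r := by
    rw [h4]
    unfold kerrDelta
    have h6 : 0 < r ^ 4 := by positivity
    have h7 : 0 ≤ r ^ 2 * (y * (2 * a - y)) := by
      have := mul_nonneg hy0 (by linarith : 0 ≤ 2 * a - y); positivity
    have h8 : 0 ≤ 2 * r * y ^ 2 := by positivity
    nlinarith
  exact pos_of_mul_pos_right h5 hΔ.le

/-- Negative `η` forces `|λ| > a`, and then the term with `cos² θ₀` cannot compensate. Consequently
`Θ_* ≥ 0` implies `η ≥ 0`, a cubic inequality in `r`. -/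
theorem ThetaStar_neg_of_eta_neg (ha : 0 < a) (hs : 0 < sin θ₀) (hr : rPlus a < r)
    (h : eta a r < 0) : ThetaStar a θ₀ r < 0 := by
  have h1 : a < |lam a r| := by
    by_contra! h1
    exact absurd (eta_pos_of_abs_lam_le ha hr h1) (not_lt.2 h.le)
  have h2 : a ^ 2 < lam a r ^ 2 := by
    rw [← sq_abs (lam a r)]; gcongr
  have h3 : lam a r ^ 2 ≤ lam a r ^ 2 / sin θ₀ ^ 2 := by
    rw [le_div_iff₀ (by positivity)]
    have : sin θ₀ ^ 2 ≤ 1 := sin_sq_le_one θ₀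
    exact mul_le_of_le_one_right (sq_nonneg _) this
  unfold ThetaStar
  nlinarith [sq_nonneg (cos θ₀)]

theorem cubic_le_of_ThetaStar_nonneg (ha : 0 < a) (hs : 0 < sin θ₀) (hr : rPlus a < r)
    (h : 0 ≤ ThetaStar a θ₀ r) : r * (r - 3) ^ 2 ≤ 4 * a ^ 2 := by
  by_contra! hlt
  refine absurd (ThetaStar_neg_of_eta_neg ha hs hr ?_) (not_lt.2 h)
  have hr1 := one_lt_of_rPlus_lt hr
  have h1 : 0 < r - 1 := by linarith
  exact mul_neg_of_pos_of_neg (by positivity) (div_neg_of_neg_of_pos (by linarith) (by positivity))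

/-- The triple angle formula solves `r (r - 3)² = 4 a²`: with `3ψ = 2 arccos (∓a)` the right side
equals `4 a²`. -/
theorem cubic_two_add_two_cos (ψ : ℝ) :
    (2 + 2 * cos ψ) * (2 + 2 * cos ψ - 3) ^ 2 = 2 + 2 * cos (3 * ψ) := by
  rw [cos_three_mul]; ring

theorem rOne_cubic (ha : |a| ≤ 1) : rOne a * (rOne a - 3) ^ 2 = 4 * a ^ 2 := by
  obtain ⟨h1, h2⟩ := abs_le.1 ha
  rw [rOne, cubic_two_add_two_cos, show 3 * (2 / 3 * arccos (-a)) = 2 * arccos (-a) by ring,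
    cos_two_mul, cos_arccos (by linarith) (by linarith)]
  ring

theorem rTwo_cubic (ha : |a| ≤ 1) : rTwo a * (rTwo a - 3) ^ 2 = 4 * a ^ 2 := by
  obtain ⟨h1, h2⟩ := abs_le.1 ha
  rw [rTwo, cubic_two_add_two_cos, show 3 * (2 / 3 * arccos a) = 2 * arccos a by ring,
    cos_two_mul, cos_arccos (by linarith) (by linarith)]
  ring

theorem rOne_le_three (ha : 0 ≤ a) : rOne a ≤ 3 := by
  have h1 : π / 2 ≤ arccos (-a) := by
    rw [arccos_neg]
    linarith [arccos_le_pi_div_two.2 ha]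
  have h2 : cos (2 / 3 * arccos (-a)) ≤ cos (π / 3) :=
    cos_le_cos_of_nonneg_of_le_pi (by positivity) (by linarith [arccos_le_pi (-a), pi_pos])
      (by linarith)
  rw [cos_pi_div_three] at h2
  unfold rOne; linarith

theorem three_le_rTwo (ha : 0 ≤ a) : 3 ≤ rTwo a := by
  have h1 := arccos_le_pi_div_two.2 ha
  have h2 : cos (π / 3) ≤ cos (2 / 3 * arccos a) :=
    cos_le_cos_of_nonneg_of_le_pi (by linarith [arccos_nonneg a]) (by linarith [pi_pos])
      (by linarith)
  rw [cos_pi_div_three] at h2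
  unfold rTwo; linarith

/-- The cubic decreases on `[1, 3]`, and `rOne a ≤ 3` lies on this branch. -/
theorem rOne_le_of_cubic_le (ha : 0 ≤ a) (ha1 : a ≤ 1) (hr : 1 < r)
    (h : r * (r - 3) ^ 2 ≤ 4 * a ^ 2) : rOne a ≤ r := by
  by_contra! hlt
  rw [← rOne_cubic (abs_le.2 ⟨by linarith, ha1⟩)] at h
  have h3 := rOne_le_three ha
  generalize rOne a = q at *
  have h4 : r ^ 2 + r * q + q ^ 2 - 6 * r - 6 * q + 9 < 0 := by
    nlinarith [mul_pos (sub_pos.2 hr) (sub_pos.2 hlt), mul_nonneg (sub_nonneg.2 h3)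
      (sub_pos.2 hr).le, mul_pos (sub_pos.2 hr) (sub_pos.2 (hlt.trans_le h3)),
      mul_nonneg (sub_nonneg.2 h3) (sub_pos.2 hlt).le]
  nlinarith

theorem le_rTwo_of_cubic_le (ha : 0 ≤ a) (ha1 : a ≤ 1)
    (h : r * (r - 3) ^ 2 ≤ 4 * a ^ 2) : r ≤ rTwo a := by
  by_contra! hlt
  rw [← rTwo_cubic (abs_le.2 ⟨by linarith, ha1⟩)] at h
  have h3 := three_le_rTwo ha
  have h4 : rTwo a * (rTwo a - 3) ^ 2 < r * (r - 3) ^ 2 := by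
    have h5 : 0 ≤ rTwo a - 3 := by linarith
    have h6 : (rTwo a - 3) ^ 2 < (r - 3) ^ 2 := by gcongr
    nlinarith [sq_nonneg (rTwo a - 3)]
  linarith

/-! ### Existence of two zeros for `a < 1` -/

theorem continuousOn_lam (ha : a ≠ 0) : ContinuousOn (lam a) (Ioi 1) := by
  unfold lam
  refine ContinuousOn.div (by fun_prop) (by fun_prop) fun r hr => ?_
  rw [mem_Ioi] at hr
  exact mul_ne_zero ha (by linarith)

theorem continuousOn_ThetaStar (ha : a ≠ 0) (θ₀ : ℝ) : ContinuousOn (ThetaStar a θ₀) (Ioi 1) := by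
  have h1 := continuousOn_lam ha
  have h2 : ContinuousOn (eta a) (Ioi 1) := by
    unfold eta
    refine ContinuousOn.mul (by fun_prop) (ContinuousOn.div (by fun_prop) (by fun_prop) ?_)
    intro r hr
    rw [mem_Ioi] at hr
    exact mul_ne_zero (pow_ne_zero 2 ha) (pow_ne_zero 2 (by linarith))
  unfold ThetaStar
  fun_prop

/-- Three sign evaluations suffice: at `r₊ > 1` the positive term of `ThetaStar_eq_sub` vanishes
with `Δ`; where `λ = a sin² θ₀` the subtracted square vanishes; and for `r ≥ 4` the cubic bound is
violated, as `r (r - 3)² ≥ 4 > 4 a²`. -/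
theorem exists_zeros_ThetaStar (ha : 0 < a) (ha1 : a < 1) (hs : 0 < sin θ₀) :
    ∃ r₁ r₂ : ℝ, rPlus a < r₁ ∧ r₁ < r₂ ∧ ThetaStar a θ₀ r₁ = 0 ∧ ThetaStar a θ₀ r₂ = 0 := by
  have ha2 : a ^ 2 < 1 := by nlinarith
  have hrp : 1 < rPlus a := by
    unfold rPlus
    linarith [sqrt_pos.2 (by linarith : 0 < 1 - a ^ 2)]
  have hrp0 := rPlus_pos a
  have hΔp := kerrDelta_rPlus ha2.le
  have hneg : ThetaStar a θ₀ (rPlus a) < 0 := by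
    rw [ThetaStar_eq_sub ha.ne' hs.ne' hrp, lam_eq ha.ne' hrp, critRatio_eq_sub hrp, hΔp]
    have h1 : (a ^ 2 - (2 * rPlus a * 0 / (rPlus a - 1) - rPlus a ^ 2)) / a / sin θ₀
        - a * sin θ₀ = (rPlus a ^ 2 + a ^ 2 * cos θ₀ ^ 2) / (a * sin θ₀) := by
      rw [cos_sq']; field_simp; ring
    rw [h1]
    have h2 : 0 < (rPlus a ^ 2 + a ^ 2 * cos θ₀ ^ 2) / (a * sin θ₀) := by positivity
    simp only [mul_zero, zero_div, zero_sub, neg_lt_zero]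
    positivity
  obtain ⟨rm, hrm, hβ⟩ := exists_critRatio_eq (a := a) (c := a ^ 2 * cos θ₀ ^ 2) ha2.le (by
    have : 0 ≤ a ^ 2 * cos θ₀ ^ 2 := by positivity
    nlinarith)
  have hrm1 := one_lt_of_rPlus_lt hrm
  have hpos : 0 < ThetaStar a θ₀ rm := by
    rw [ThetaStar_eq_sub ha.ne' hs.ne' hrm1, lam_eq ha.ne' hrm1, hβ]
    have h1 : (a ^ 2 - a ^ 2 * cos θ₀ ^ 2) / a / sin θ₀ - a * sin θ₀ = 0 := by
      rw [cos_sq']; field_simp; ring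
    rw [h1]
    have := kerrDelta_pos hrm
    have h2 : 0 < rm - 1 := by linarith
    simp only [ne_eq, OfNat.ofNat_ne_zero, not_false_eq_true, zero_pow, sub_zero]
    positivity
  have hcub : ∀ r, rPlus a < r → 4 ≤ r → ThetaStar a θ₀ r < 0 := fun r hr h4 => by
    by_contra! h
    have h1 := cubic_le_of_ThetaStar_nonneg ha hs hr h
    have h2 : (1 : ℝ) ≤ (r - 3) ^ 2 := by nlinarith
    nlinarith
  have hrm4 : rm < 4 := by
    by_contra! h
    exact absurd (hcub rm hrm h) (not_lt.2 hpos.le)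
  have hcont := continuousOn_ThetaStar ha.ne' θ₀
  obtain ⟨r₁, h1, hz1⟩ := intermediate_value_Ioo hrm.le (hcont.mono fun r hr => hrp.trans_le hr.1)
    (show (0 : ℝ) ∈ Ioo _ _ from ⟨hneg, hpos⟩)
  obtain ⟨r₂, h2, hz2⟩ := intermediate_value_Ioo' hrm4.le
    (hcont.mono fun r hr => hrm1.trans_le hr.1)
    (show (0 : ℝ) ∈ Ioo _ _ from ⟨hcub 4 (hrm.trans hrm4) le_rfl, hpos⟩)
  exact ⟨r₁, r₂, h1.1, h1.2.trans h2.1, hz1, hz2⟩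

end zeros

/-! ### The critical curve -/

/-- The observed energy of a beam with `E = 1` and `L = λ(r_c)`. -/
def critFreq (a r₀ θ₀ Ω rc : ℝ) : ℝ := uZero a r₀ θ₀ Ω * (1 - lam a rc * Ω)

/-- The component `N₂` of the beams with `L = λ(r_c) E`. -/
def critY (a r₀ θ₀ Ω rc : ℝ) : ℝ :=
  -(BBetaNum a r₀ θ₀ Ω rc / (rhoSq a r₀ θ₀ * sin θ₀ * √(kerrDelta a r₀) * critFreq a r₀ θ₀ Ω rc))

/-- The reduced radial potential divided by `(r₀ - r_c)²`. -/
def critQuad (a r₀ rc : ℝ) : ℝ := r₀ ^ 2 + 2 * rc * r₀ - 3 * rc ^ 2 + zFun a rc ^ 2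

/-- The component `N₃` of the beam that approaches the spherical orbit of radius `r_c`. -/
def critZ (a r₀ θ₀ Ω rc : ℝ) : ℝ :=
  (r₀ - rc) * √(critQuad a r₀ rc) /
    (√(rhoSq a r₀ θ₀) * critFreq a r₀ θ₀ Ω rc * √(kerrDelta a r₀))

/-- The modulus of the component `N₁` of the beam that approaches the spherical orbit of radius
`r_c`. -/
def critX (a r₀ θ₀ Ω rc : ℝ) : ℝ :=
  √(ThetaStar a θ₀ rc) / (√(rhoSq a r₀ θ₀) * critFreq a r₀ θ₀ Ω rc)

/-- The two directions `σ = ±1` in which the observer sees the spherical orbit of radius `r_c`. -/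
def critDir (a r₀ θ₀ Ω σ rc : ℝ) : EuclideanSpace ℝ (Fin 3) :=
  !₂[σ * critX a r₀ θ₀ Ω rc, critY a r₀ θ₀ Ω rc, critZ a r₀ θ₀ Ω rc]

theorem zFun_sq {a rc : ℝ} (ha : a ^ 2 ≤ 1) (hrc : 1 < rc) :
    zFun a rc ^ 2 = 4 * rc * ((rc - 1) ^ 3 + (1 - a ^ 2)) / (rc - 1) ^ 2 := by
  have h1 : 0 < rc - 1 := by linarith
  have h2 : 1 - rc ≠ 0 := by linarith
  have h3 : 3 * rc - (a ^ 2 + 3 * rc ^ 2) + rc ^ 3 = (rc - 1) ^ 3 + (1 - a ^ 2) := by ring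
  have h4 : 0 ≤ (rc - 1) ^ 3 + (1 - a ^ 2) := by have := pow_pos h1 3; linarith
  unfold zFun
  rw [h3, mul_pow, div_pow, mul_pow, sq_sqrt h4, sq_sqrt (by linarith)]
  have h5 := h1.ne'
  field_simp
  ring

theorem critQuad_pos {a r₀ rc : ℝ} (ha : a ^ 2 ≤ 1) (hr₀ : 1 < r₀) (hrc : 1 < rc) :
    0 < critQuad a r₀ rc := by
  have h1 : 0 < rc - 1 := by linarith
  have h2 : critQuad a r₀ rc = (rc - 1) ^ 2 + (r₀ - 1) * (r₀ + 1 + 2 * rc) +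
      4 * rc * (1 - a ^ 2) / (rc - 1) ^ 2 := by
    unfold critQuad
    rw [zFun_sq ha hrc]
    have h5 := h1.ne'
    field_simp
    ring
  have h3 : 0 < (r₀ - 1) * (r₀ + 1 + 2 * rc) := mul_pos (by linarith) (by linarith)
  have h4 : 0 ≤ 4 * rc * (1 - a ^ 2) / (rc - 1) ^ 2 :=
    div_nonneg (mul_nonneg (by linarith) (by linarith)) (sq_nonneg _)
  have h5 := sq_nonneg (rc - 1)
  rw [h2]; linarith

/-- The left side is the radial potential at `r₀` with `E = 1` and the constants of the spherical
orbit. It has a double root at `r_c`, and `critQuad` is the quotient. -/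
theorem sq_sub_eq_mul_critQuad {a r₀ rc : ℝ} (ha : a ^ 2 ≤ 1) (hrc : 1 < rc) :
    (r₀ ^ 2 + critRatio a rc) ^ 2
      - kerrDelta a r₀ * (4 * rc ^ 2 * kerrDelta a rc / (rc - 1) ^ 2) =
      (r₀ - rc) ^ 2 * critQuad a r₀ rc := by
  have h1 : rc - 1 ≠ 0 := by linarith
  unfold critQuad critRatio kerrDelta
  rw [zFun_sq ha hrc]
  field_simp
  ring

namespace IsObserver

variable {a r₀ θ₀ Ω : ℝ}

/-- In the Carter frame, `ρ² (1 - λ Ω)` is the pairing `P(r₀) (1 - a Ω sin² θ₀) - D V`. The beam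
satisfies `√Δ |D| ≤ P(r₀)` because its radial and angular potentials are nonnegative, and the
observer satisfies `|V| < √Δ (1 - a Ω sin² θ₀)`. -/
theorem critFreq_pos (h : IsObserver a r₀ θ₀ Ω) {rc : ℝ} (hrc : rPlus a < rc)
    (hΘ : 0 ≤ ThetaStar a θ₀ rc) : 0 < critFreq a r₀ θ₀ Ω rc := by
  have hs := h.sin_pos
  have ha := h.a_pos
  have hrc1 := one_lt_of_rPlus_lt hrc
  have hX : 0 < r₀ ^ 2 + critRatio a rc := by
    have h1 := neg_rPlus_sq_lt_critRatio h.sq_le hrc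
    have h2 := pow_lt_pow_left₀ h.gt (rPlus_pos a).le two_ne_zero
    linarith
  have hlam : a * lam a rc = a ^ 2 - critRatio a rc := by
    rw [lam_eq ha.ne' hrc1]; field_simp
  have hK := sq_sub_eq_mul_critQuad (r₀ := r₀) h.sq_le hrc1
  rw [ThetaStar_eq_sub ha.ne' hs.ne' hrc1] at hΘ
  set D := lam a rc / sin θ₀ - a * sin θ₀ with hD
  have hDs : D * sin θ₀ = lam a rc - a * sin θ₀ ^ 2 := by rw [hD]; field_simp
  have hQ := critQuad_pos h.sq_le (one_lt_of_rPlus_lt h.gt) hrc1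
  have hΔ := kerrDelta_pos h.gt
  have hδ : 0 < √(kerrDelta a r₀) := sqrt_pos.2 hΔ
  have hδ2 : √(kerrDelta a r₀) ^ 2 = kerrDelta a r₀ := sq_sqrt hΔ.le
  have h1 : |√(kerrDelta a r₀) * D| ≤ r₀ ^ 2 + critRatio a rc := by
    refine abs_le_of_sq_le_sq ?_ hX.le
    rw [mul_pow, hδ2]
    have h2 : kerrDelta a r₀ * D ^ 2 ≤
        kerrDelta a r₀ * (4 * rc ^ 2 * kerrDelta a rc / (rc - 1) ^ 2) :=
      mul_le_mul_of_nonneg_left (by linarith) hΔ.le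
    have h3 : 0 ≤ (r₀ - rc) ^ 2 * critQuad a r₀ rc := by positivity
    linarith
  rw [abs_mul, abs_of_pos hδ] at h1
  have h2 := h.abs_lt
  have h3 := h.one_sub_pos
  set V := sin θ₀ * (Ω * (r₀ ^ 2 + a ^ 2) - a) with hV
  have h4 : rhoSq a r₀ θ₀ * (1 - lam a rc * Ω) =
      (r₀ ^ 2 + critRatio a rc) * (1 - a * Ω * sin θ₀ ^ 2) - D * V := by
    have h5 : D * V = (lam a rc - a * sin θ₀ ^ 2) * (Ω * (r₀ ^ 2 + a ^ 2) - a) := by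
      rw [← hDs, hV]; ring
    rw [h5, rhoSq_eq]
    linear_combination (-(1 - a * Ω * sin θ₀ ^ 2)) * hlam
  have h5 : D * V < (r₀ ^ 2 + critRatio a rc) * (1 - a * Ω * sin θ₀ ^ 2) := by
    rcases eq_or_ne D 0 with h0 | h0
    · rw [h0, zero_mul]; positivity
    · calc D * V ≤ |D| * |V| := by rw [← abs_mul]; exact le_abs_self _
        _ < |D| * (√(kerrDelta a r₀) * (1 - a * Ω * sin θ₀ ^ 2)) :=
          mul_lt_mul_of_pos_left h2 (abs_pos.2 h0)
        _ = √(kerrDelta a r₀) * |D| * (1 - a * Ω * sin θ₀ ^ 2) := by ring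
        _ ≤ _ := mul_le_mul_of_nonneg_right h1 h3.le
  have h6 : 0 < rhoSq a r₀ θ₀ * (1 - lam a rc * Ω) := by rw [h4]; linarith
  exact mul_pos h.uZero_pos (pos_of_mul_pos_right h6 (rhoSq_pos _ h.gt).le)

/-- Together with `beamL_critY` this shows that `critY` solves `L = λ E`. -/
theorem beamE_critY (h : IsObserver a r₀ θ₀ Ω) (W : ℝ) {rc : ℝ}
    (hq : critFreq a r₀ θ₀ Ω rc ≠ 0) :
    beamE a r₀ θ₀ Ω W (critY a r₀ θ₀ Ω rc) = W / critFreq a r₀ θ₀ Ω rc := by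
  have hs := h.sin_pos.ne'
  have hρ := (rhoSq_pos θ₀ h.gt).ne'
  have hδ : √(kerrDelta a r₀) ≠ 0 := (sqrt_pos.2 (kerrDelta_pos h.gt)).ne'
  have hu := h.uZero_sq
  have hy : √(kerrDelta a r₀) * sin θ₀ * Ω * critY a r₀ θ₀ Ω rc =
      -(Ω * BBetaNum a r₀ θ₀ Ω rc / (rhoSq a r₀ θ₀ * critFreq a r₀ θ₀ Ω rc)) := by
    unfold critY; field_simp
  rw [h.beamE_eq, hy, eq_div_iff hq]
  have key : uZero a r₀ θ₀ Ω * ((kerrDelta a r₀ * (1 - a * Ω * sin θ₀ ^ 2)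
      + a * sin θ₀ ^ 2 * (Ω * (r₀ ^ 2 + a ^ 2) - a)) * critFreq a r₀ θ₀ Ω rc
      + Ω * BBetaNum a r₀ θ₀ Ω rc) = rhoSq a r₀ θ₀ := by
    rw [← hu, BBetaNum, critFreq, rhoSq_eq, uDen, kerrDelta]
    ring
  rw [sub_neg_eq_add]
  field_simp
  linear_combination W * key

theorem beamL_critY (h : IsObserver a r₀ θ₀ Ω) (W : ℝ) {rc : ℝ}
    (hq : critFreq a r₀ θ₀ Ω rc ≠ 0) :
    beamL a r₀ θ₀ Ω W (critY a r₀ θ₀ Ω rc) = lam a rc * (W / critFreq a r₀ θ₀ Ω rc) := by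
  have hs := h.sin_pos.ne'
  have hρ := (rhoSq_pos θ₀ h.gt).ne'
  have hδ : √(kerrDelta a r₀) ≠ 0 := (sqrt_pos.2 (kerrDelta_pos h.gt)).ne'
  have hu := h.uZero_sq
  have hy : √(kerrDelta a r₀) * (1 - a * Ω * sin θ₀ ^ 2) * critY a r₀ θ₀ Ω rc =
      -((1 - a * Ω * sin θ₀ ^ 2) * BBetaNum a r₀ θ₀ Ω rc /
        (rhoSq a r₀ θ₀ * sin θ₀ * critFreq a r₀ θ₀ Ω rc)) := by
    unfold critY; field_simp
  rw [h.beamL_eq, hy, h.beamE_critY W hq]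
  have key : uZero a r₀ θ₀ Ω * (sin θ₀ ^ 2 * (Ω * (r₀ ^ 2 + a ^ 2) - a) * rhoSq a r₀ θ₀ *
      critFreq a r₀ θ₀ Ω rc + (1 - a * Ω * sin θ₀ ^ 2) * BBetaNum a r₀ θ₀ Ω rc) =
      (lam a rc - a * sin θ₀ ^ 2) * rhoSq a r₀ θ₀ := by
    conv_rhs => rw [← hu]
    rw [BBetaNum, critFreq, rhoSq_eq, uDen, kerrDelta]
    ring
  rw [sub_neg_eq_add]
  field_simp
  linear_combination W * key

theorem radP_lam (h : IsObserver a r₀ θ₀ Ω) {rc : ℝ} (hrc : rPlus a < rc) (r e : ℝ) :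
    radP a e (lam a rc * e) r = e * (r ^ 2 + critRatio a rc) := by
  have ha := h.a_pos.ne'
  unfold radP
  rw [lam_eq ha (one_lt_of_rPlus_lt hrc)]
  field_simp
  ring

/-- The sign of `Θ_*` plays no role in this identity, so comparison with a unit vector can deduce
`Θ_* ≥ 0` from `N₁² ≥ 0`. -/
theorem crit_sq (h : IsObserver a r₀ θ₀ Ω) {rc : ℝ} (hrc : rPlus a < rc)
    (hq : critFreq a r₀ θ₀ Ω rc ≠ 0) :
    ThetaStar a θ₀ rc / (√(rhoSq a r₀ θ₀) * critFreq a r₀ θ₀ Ω rc) ^ 2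
      + critY a r₀ θ₀ Ω rc ^ 2 + critZ a r₀ θ₀ Ω rc ^ 2 = 1 := by
  have hs := h.sin_pos.ne'
  have hrc1 := one_lt_of_rPlus_lt hrc
  have hρ0 := rhoSq_pos θ₀ h.gt
  have hΔ := kerrDelta_pos h.gt
  have hρ : √(rhoSq a r₀ θ₀) ≠ 0 := (sqrt_pos.2 hρ0).ne'
  have hδ : √(kerrDelta a r₀) ≠ 0 := (sqrt_pos.2 hΔ).ne'
  have hδ2 : √(kerrDelta a r₀) ^ 2 = kerrDelta a r₀ := sq_sqrt hΔ.le
  have hc := h.carter_sq (critY a r₀ θ₀ Ω rc)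
  have h1 := h.radP_beam (critFreq a r₀ θ₀ Ω rc) (critY a r₀ θ₀ Ω rc)
  have h2 : beamL a r₀ θ₀ Ω (critFreq a r₀ θ₀ Ω rc) (critY a r₀ θ₀ Ω rc) / sin θ₀ -
      a * beamE a r₀ θ₀ Ω (critFreq a r₀ θ₀ Ω rc) (critY a r₀ θ₀ Ω rc) * sin θ₀ =
      critFreq a r₀ θ₀ Ω rc * √(rhoSq a r₀ θ₀) *
        carterMomentum a r₀ θ₀ Ω (critY a r₀ θ₀ Ω rc) := by
    unfold beamL; field_simp; ring
  rw [h.beamE_critY _ hq, h.beamL_critY _ hq, div_self hq] at h1 h2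
  rw [h.radP_lam hrc] at h1
  have hK := sq_sub_eq_mul_critQuad (r₀ := r₀) h.sq_le hrc1
  have hQ := critQuad_pos h.sq_le (one_lt_of_rPlus_lt h.gt) hrc1
  rw [ThetaStar_eq_sub h.a_pos.ne' hs hrc1]
  rw [mul_one, mul_one] at h2
  rw [one_mul] at h1
  rw [h2]
  rw [h1] at hK
  have hZ : critZ a r₀ θ₀ Ω rc ^ 2 = (r₀ - rc) ^ 2 * critQuad a r₀ rc /
      (√(rhoSq a r₀ θ₀) * critFreq a r₀ θ₀ Ω rc * √(kerrDelta a r₀)) ^ 2 := by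
    rw [critZ, div_pow, mul_pow, sq_sqrt hQ.le]
  rw [hZ, ← hK, ← hδ2, sqrt_sq (sqrt_nonneg _)]
  generalize 4 * rc ^ 2 * kerrDelta a rc / (rc - 1) ^ 2 = K
  field_simp
  linear_combination (critFreq a r₀ θ₀ Ω rc ^ 2 * √(rhoSq a r₀ θ₀) ^ 2) * hc

/-- The square root produces `|r₀ - r_c|` from the double root, and the sign in `threshold` removes
the absolute value. -/
theorem threshold_crit (h : IsObserver a r₀ θ₀ Ω) {rc e : ℝ} (hrc : rPlus a < rc) (he : 0 ≤ e) :
    threshold a r₀ e (lam a rc * e) rc = e * ((r₀ - rc) * √(critQuad a r₀ rc)) := by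
  have hrc1 := one_lt_of_rPlus_lt hrc
  have hΔ := (kerrDelta_pos hrc).ne'
  have hK := sq_sub_eq_mul_critQuad (r₀ := r₀) h.sq_le hrc1
  have h0 : rc - 1 ≠ 0 := by linarith
  have h1 : radR a e (lam a rc * e) (radP a e (lam a rc * e) rc ^ 2 / kerrDelta a rc) r₀ =
      (e * (r₀ - rc)) ^ 2 * critQuad a r₀ rc := by
    have h2 : rc ^ 2 + critRatio a rc = 2 * rc * kerrDelta a rc / (rc - 1) := by
      rw [critRatio_eq_sub hrc1]; ring
    rw [mul_pow, mul_assoc, ← hK, radR, h.radP_lam hrc, h.radP_lam hrc, h2]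
    field_simp
    ring
  rw [threshold, h1, sqrt_mul (sq_nonneg _), sqrt_sq_eq_abs, abs_mul, abs_of_nonneg he]
  have h2 : (SignType.sign (r₀ - rc) : ℝ) * |r₀ - rc| = r₀ - rc := sign_mul_abs _
  linear_combination (e * √(critQuad a r₀ rc)) * h2

theorem eq_critDir_of_isCritical (h : IsObserver a r₀ θ₀ Ω) {W rc : ℝ} (hW : 0 < W)
    {N : CelestialSphere} (hN : IsCritical a r₀ θ₀ Ω W rc N) :
    0 ≤ ThetaStar a θ₀ rc ∧
      (N.1 = critDir a r₀ θ₀ Ω (-1) rc ∨ N.1 = critDir a r₀ θ₀ Ω 1 rc) := by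
  obtain ⟨⟨hE, hrc, heq⟩, hv⟩ := hN
  have hs := h.sin_pos
  have ha := h.a_pos
  have hrc1 := one_lt_of_rPlus_lt hrc
  have hρ0 := rhoSq_pos θ₀ h.gt
  have hΔ := kerrDelta_pos h.gt
  have hρ : 0 < √(rhoSq a r₀ θ₀) := sqrt_pos.2 hρ0
  have hδ : 0 < √(kerrDelta a r₀) := sqrt_pos.2 hΔ
  have hL : beamL a r₀ θ₀ Ω W (N.1 1) = lam a rc * beamE a r₀ θ₀ Ω W (N.1 1) := by
    rw [lam_eq ha.ne' hrc1]
    field_simp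
    linarith
  have hu := h.uZero_mul W (N.1 1)
  rw [hL] at hu hv
  have hu' : critFreq a r₀ θ₀ Ω rc * beamE a r₀ θ₀ Ω W (N.1 1) = W := by
    rw [critFreq]; linear_combination hu
  have hq : 0 < critFreq a r₀ θ₀ Ω rc := pos_of_mul_pos_left (hu'.symm ▸ hW) hE.le
  have hE' : beamE a r₀ θ₀ Ω W (N.1 1) = W / critFreq a r₀ θ₀ Ω rc := by
    rw [eq_div_iff hq.ne', mul_comm, hu']
  -- With `E` known, `L` is affine in `N₂` with nonzero slope. The formula for `E` alone would not
  -- determine `N₂` when `Ω = 0`.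
  have hy : N.1 1 = critY a r₀ θ₀ Ω rc := by
    have h1 := h.beamL_eq W (N.1 1)
    have h2 := h.beamL_eq W (critY a r₀ θ₀ Ω rc)
    rw [h.beamL_critY W hq.ne', h.beamE_critY W hq.ne'] at h2
    rw [hL, hE', h2] at h1
    have h3 : W * uZero a r₀ θ₀ Ω * sin θ₀ * (√(kerrDelta a r₀) * (1 - a * Ω * sin θ₀ ^ 2)) *
        (N.1 1 - critY a r₀ θ₀ Ω rc) = 0 := by linear_combination h1
    have h4 := h.uZero_pos
    have h5 := h.one_sub_pos
    have h6 := (mul_eq_zero.1 h3).resolve_left (by positivity)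
    linarith
  have hz : N.1 2 = critZ a r₀ θ₀ Ω rc := by
    rw [h.threshold_crit hrc hE.le, hE', beamV, neg_inj] at hv
    unfold critZ
    field_simp at hv ⊢
    linear_combination hv
  have hsq := sq_add_sq_add_sq N
  have hc := h.crit_sq hrc hq.ne'
  rw [hy, hz] at hsq
  have hx : N.1 0 ^ 2 = ThetaStar a θ₀ rc / (√(rhoSq a r₀ θ₀) * critFreq a r₀ θ₀ Ω rc) ^ 2 := by
    linarith
  have hd : 0 < √(rhoSq a r₀ θ₀) * critFreq a r₀ θ₀ Ω rc := mul_pos hρ hq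
  have hΘ : 0 ≤ ThetaStar a θ₀ rc := by
    rw [eq_div_iff (by positivity)] at hx
    rw [← hx]; positivity
  refine ⟨hΘ, ?_⟩
  have hx' : N.1 0 ^ 2 = critX a r₀ θ₀ Ω rc ^ 2 := by
    rw [hx, critX, div_pow, sq_sqrt hΘ]
  rcases sq_eq_sq_iff_eq_or_eq_neg.1 hx' with h1 | h1
  · right
    ext i
    fin_cases i <;> simp [critDir, h1, hy, hz]
  · left
    ext i
    fin_cases i <;> simp [critDir, h1, hy, hz]

theorem critDir_mem (h : IsObserver a r₀ θ₀ Ω) {rc σ : ℝ} (hσ : σ ^ 2 = 1) (hrc : rPlus a < rc)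
    (hΘ : 0 ≤ ThetaStar a θ₀ rc) :
    critDir a r₀ θ₀ Ω σ rc ∈ Metric.sphere (0 : EuclideanSpace ℝ (Fin 3)) 1 := by
  have hc := h.crit_sq hrc (h.critFreq_pos hrc hΘ).ne'
  refine mem_celestialSphere ?_
  have h1 : critX a r₀ θ₀ Ω rc ^ 2 =
      ThetaStar a θ₀ rc / (√(rhoSq a r₀ θ₀) * critFreq a r₀ θ₀ Ω rc) ^ 2 := by
    rw [critX, div_pow, sq_sqrt hΘ]
  rw [← h1] at hc
  simp only [critDir, Matrix.cons_val]
  rw [mul_pow, hσ, one_mul, hc]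

theorem isCritical_of_eq_critDir (h : IsObserver a r₀ θ₀ Ω) {W rc σ : ℝ} (hW : 0 < W)
    (hrc : rPlus a < rc) (hΘ : 0 ≤ ThetaStar a θ₀ rc) {N : CelestialSphere}
    (hN : N.1 = critDir a r₀ θ₀ Ω σ rc) : IsCritical a r₀ θ₀ Ω W rc N := by
  have hq := h.critFreq_pos hrc hΘ
  have ha := h.a_pos.ne'
  have h1 : N.1 1 = critY a r₀ θ₀ Ω rc := by rw [hN]; simp [critDir]
  have h2 : N.1 2 = critZ a r₀ θ₀ Ω rc := by rw [hN]; simp [critDir]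
  have hρ : 0 < √(rhoSq a r₀ θ₀) := sqrt_pos.2 (rhoSq_pos θ₀ h.gt)
  have hδ : 0 < √(kerrDelta a r₀) := sqrt_pos.2 (kerrDelta_pos h.gt)
  have he : 0 < W / critFreq a r₀ θ₀ Ω rc := div_pos hW hq
  unfold IsCritical
  rw [h1, h2, h.beamE_critY W hq.ne', h.beamL_critY W hq.ne']
  refine ⟨⟨he, hrc, ?_⟩, ?_⟩
  · rw [lam_eq ha (one_lt_of_rPlus_lt hrc)]
    field_simp
    ring
  · rw [h.threshold_crit hrc he.le, beamV, critZ]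
    field_simp

end IsObserver

/-! ### Angular coordinates of the critical curve -/

theorem ThetaStar_nonneg {a θ₀ r₁ r₂ : ℝ} (ha : 0 < a) (ha1 : a ≤ 1) (hs : 0 < sin θ₀)
    (h1 : rPlus a < r₁) (hz1 : ThetaStar a θ₀ r₁ = 0) (hz2 : ThetaStar a θ₀ r₂ = 0) :
    ∀ r ∈ Icc r₁ r₂, rPlus a < r ∧ 0 ≤ ThetaStar a θ₀ r := fun r hr => by
  refine ⟨h1.trans_le hr.1, ?_⟩
  rcases eq_endpoints_or_mem_Ioo_of_mem_Icc hr with h3 | h3 | h3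
  · rw [h3, hz1]
  · rw [h3, hz2]
  · exact (ThetaStar_pos ha ha1 hs h1 hz1 hz2 h3).le

/-- Polar coordinates in the half-plane `T ≥ 0`. On its boundary the convention `±π/2` gives the
correct angle, and at the origin any angle would do. -/
theorem sqrt_mul_cos_sin {T m : ℝ} (hT : 0 ≤ T) {B : ℝ}
    (h0 : T = 0 → B = SignType.sign m * (π / 2)) (h1 : T ≠ 0 → B = arctan (m / T)) :
    √(T ^ 2 + m ^ 2) * cos B = T ∧ √(T ^ 2 + m ^ 2) * sin B = m := by
  rcases eq_or_ne T 0 with hT0 | hT0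
  · rw [h0 hT0, hT0, zero_pow two_ne_zero, zero_add, sqrt_sq_eq_abs]
    rcases lt_trichotomy m 0 with hm | hm | hm
    · rw [sign_neg hm, abs_of_neg hm]
      simp [cos_neg]
    · simp [hm]
    · rw [sign_pos hm, abs_of_pos hm]
      simp
  · have hT' := hT.lt_of_ne' hT0
    have h2 : √(T ^ 2 + m ^ 2) = T * √(1 + (m / T) ^ 2) := by
      rw [show T ^ 2 + m ^ 2 = T ^ 2 * (1 + (m / T) ^ 2) by field_simp, sqrt_mul (sq_nonneg _),
        sqrt_sq hT]
    have h3 : √(1 + (m / T) ^ 2) ≠ 0 := (sqrt_pos.2 (by positivity)).ne'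
    rw [h1 hT0, h2, cos_arctan, sin_arctan]
    constructor <;> field_simp

namespace IsObserver

variable {a r₀ θ₀ Ω rc : ℝ}

theorem critX_nonneg (h : IsObserver a r₀ θ₀ Ω) (hrc : rPlus a < rc)
    (hΘ : 0 ≤ ThetaStar a θ₀ rc) : 0 ≤ critX a r₀ θ₀ Ω rc := by
  have := h.critFreq_pos hrc hΘ
  unfold critX; positivity

theorem critX_eq_zero_iff (h : IsObserver a r₀ θ₀ Ω) (hrc : rPlus a < rc)
    (hΘ : 0 ≤ ThetaStar a θ₀ rc) : critX a r₀ θ₀ Ω rc = 0 ↔ ThetaStar a θ₀ rc = 0 := by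
  have h1 := h.critFreq_pos hrc hΘ
  have h2 := sqrt_pos.2 (rhoSq_pos θ₀ h.gt)
  rw [critX, div_eq_zero_iff, sqrt_eq_zero hΘ]
  simp [h1.ne', h2.ne']

theorem critX_sq_add (h : IsObserver a r₀ θ₀ Ω) (hrc : rPlus a < rc)
    (hΘ : 0 ≤ ThetaStar a θ₀ rc) :
    critX a r₀ θ₀ Ω rc ^ 2 + critY a r₀ θ₀ Ω rc ^ 2 + critZ a r₀ θ₀ Ω rc ^ 2 = 1 := by
  rw [← h.crit_sq hrc (h.critFreq_pos hrc hΘ).ne', critX, div_pow, sq_sqrt hΘ]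

/-- Only `|N₃|` enters `B_α`; the hemisphere is chosen by using `B_α` or `π - B_α`, according to the
sign of `r₀ - r_c`. -/
theorem cos_BAlpha (h : IsObserver a r₀ θ₀ Ω) (hrc : rPlus a < rc)
    (hΘ : 0 ≤ ThetaStar a θ₀ rc) : cos (BAlpha a r₀ θ₀ Ω rc) = |critZ a r₀ θ₀ Ω rc| ∧
      sin (BAlpha a r₀ θ₀ Ω rc) = √(critX a r₀ θ₀ Ω rc ^ 2 + critY a r₀ θ₀ Ω rc ^ 2) := by
  have hq := h.critFreq_pos hrc hΘ
  have h1 : BAlpha a r₀ θ₀ Ω rc = arccos |critZ a r₀ θ₀ Ω rc| := by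
    have h0 : 0 ≤ √(rhoSq a r₀ θ₀) * critFreq a r₀ θ₀ Ω rc * √(kerrDelta a r₀) := by positivity
    rw [critZ, abs_div, abs_mul, abs_of_nonneg (sqrt_nonneg _), abs_of_nonneg h0]
    rw [BAlpha, critQuad, critFreq, ← mul_assoc (√_)]
  have h2 := h.critX_sq_add hrc hΘ
  have h3 : |critZ a r₀ θ₀ Ω rc| ≤ 1 := by
    rw [← sq_le_one_iff_abs_le_one]
    nlinarith [sq_nonneg (critX a r₀ θ₀ Ω rc), sq_nonneg (critY a r₀ θ₀ Ω rc)]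
  rw [h1, cos_arccos (by linarith [abs_nonneg (critZ a r₀ θ₀ Ω rc)]) h3, sin_arccos, sq_abs]
  exact ⟨rfl, by congr 1; linarith⟩

theorem cos_sin_BBeta (h : IsObserver a r₀ θ₀ Ω) (hrc : rPlus a < rc)
    (hΘ : 0 ≤ ThetaStar a θ₀ rc) :
    sin (BAlpha a r₀ θ₀ Ω rc) * cos (BBeta a r₀ θ₀ Ω rc) = critX a r₀ θ₀ Ω rc ∧
      sin (BAlpha a r₀ θ₀ Ω rc) * sin (BBeta a r₀ θ₀ Ω rc) = -critY a r₀ θ₀ Ω rc := by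
  have hq := h.critFreq_pos hrc hΘ
  have hs := h.sin_pos
  have hρ := rhoSq_pos θ₀ h.gt
  have hρ' : 0 < √(rhoSq a r₀ θ₀) := sqrt_pos.2 hρ
  have hδ : 0 < √(kerrDelta a r₀) := sqrt_pos.2 (kerrDelta_pos h.gt)
  have hd : 0 < rhoSq a r₀ θ₀ * sin θ₀ * √(kerrDelta a r₀) * critFreq a r₀ θ₀ Ω rc := by positivity
  have hm : -critY a r₀ θ₀ Ω rc = BBetaNum a r₀ θ₀ Ω rc /
      (rhoSq a r₀ θ₀ * sin θ₀ * √(kerrDelta a r₀) * critFreq a r₀ θ₀ Ω rc) := by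
    rw [critY, neg_neg]
  rw [(h.cos_BAlpha hrc hΘ).2, ← neg_sq (critY a r₀ θ₀ Ω rc)]
  refine sqrt_mul_cos_sin (h.critX_nonneg hrc hΘ) (fun h0 => ?_) fun h0 => ?_
  · rw [h.critX_eq_zero_iff hrc hΘ] at h0
    rw [BBeta, if_pos h0, hm, div_eq_mul_inv (BBetaNum a r₀ θ₀ Ω rc), sign_mul,
      sign_pos (inv_pos.2 hd), mul_one]
  · rw [Ne, h.critX_eq_zero_iff hrc hΘ] at h0
    have h1 : √(ThetaStar a θ₀ rc) ≠ 0 := (sqrt_pos.2 (hΘ.lt_of_ne' h0)).ne'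
    rw [BBeta, if_neg h0, hm, critX]
    congr 1
    nth_rewrite 2 [← sq_sqrt hρ.le]
    field_simp

theorem direction_eq (h : IsObserver a r₀ θ₀ Ω) (hrc : rPlus a < rc)
    (hΘ : 0 ≤ ThetaStar a θ₀ rc) (hle : rc ≤ r₀) :
    direction (BAlpha a r₀ θ₀ Ω rc) (π + BBeta a r₀ θ₀ Ω rc) = critDir a r₀ θ₀ Ω (-1) rc ∧
      direction (BAlpha a r₀ θ₀ Ω rc) (2 * π - BBeta a r₀ θ₀ Ω rc) =
        critDir a r₀ θ₀ Ω 1 rc := by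
  obtain ⟨h1, h2⟩ := h.cos_sin_BBeta hrc hΘ
  have h3 : 0 ≤ critZ a r₀ θ₀ Ω rc := by
    have := h.critFreq_pos hrc hΘ
    have : 0 ≤ r₀ - rc := by linarith
    unfold critZ; positivity
  have h4 := (h.cos_BAlpha hrc hΘ).1
  rw [abs_of_nonneg h3] at h4
  rw [direction, direction, cos_two_pi_sub, sin_two_pi_sub, add_comm π, cos_add_pi, sin_add_pi,
    mul_neg, mul_neg, h1, h2, h4, neg_neg, critDir, critDir]
  simp

theorem direction_pi_sub_eq (h : IsObserver a r₀ θ₀ Ω) (hrc : rPlus a < rc)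
    (hΘ : 0 ≤ ThetaStar a θ₀ rc) (hle : r₀ ≤ rc) :
    direction (π - BAlpha a r₀ θ₀ Ω rc) (π + BBeta a r₀ θ₀ Ω rc) =
        critDir a r₀ θ₀ Ω (-1) rc ∧
      direction (π - BAlpha a r₀ θ₀ Ω rc) (2 * π - BBeta a r₀ θ₀ Ω rc) =
        critDir a r₀ θ₀ Ω 1 rc := by
  obtain ⟨h1, h2⟩ := h.cos_sin_BBeta hrc hΘ
  have h3 : critZ a r₀ θ₀ Ω rc ≤ 0 := by
    have := h.critFreq_pos hrc hΘ
    have : r₀ - rc ≤ 0 := by linarith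
    exact div_nonpos_of_nonpos_of_nonneg (mul_nonpos_of_nonpos_of_nonneg this (sqrt_nonneg _))
      (by positivity)
  have h4 := (h.cos_BAlpha hrc hΘ).1
  rw [abs_of_nonpos h3] at h4
  rw [direction, direction, cos_two_pi_sub, sin_two_pi_sub, add_comm π, cos_add_pi, sin_add_pi,
    sin_pi_sub, cos_pi_sub, mul_neg, mul_neg, h1, h2, h4, neg_neg, neg_neg, critDir, critDir]
  simp

/-! ### The boundary of the shadow -/

theorem continuousOn_critDir (h : IsObserver a r₀ θ₀ Ω) (σ : ℝ) :
    ContinuousOn (critDir a r₀ θ₀ Ω σ) {r | rPlus a < r ∧ 0 ≤ ThetaStar a θ₀ r} := by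
  have hsub : {r | rPlus a < r ∧ 0 ≤ ThetaStar a θ₀ r} ⊆ Ioi 1 :=
    fun r hr => one_lt_of_rPlus_lt hr.1
  have h1 := (continuousOn_lam h.a_pos.ne').mono hsub
  have h2 := (continuousOn_ThetaStar h.a_pos.ne' θ₀).mono hsub
  have hq : ContinuousOn (critFreq a r₀ θ₀ Ω) {r | rPlus a < r ∧ 0 ≤ ThetaStar a θ₀ r} := by
    unfold critFreq; fun_prop
  have hs := h.sin_pos.ne'
  have hρ := (rhoSq_pos θ₀ h.gt).ne'
  have hρ' : √(rhoSq a r₀ θ₀) ≠ 0 := (sqrt_pos.2 (rhoSq_pos θ₀ h.gt)).ne'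
  have hδ : √(kerrDelta a r₀) ≠ 0 := (sqrt_pos.2 (kerrDelta_pos h.gt)).ne'
  have hq0 : ∀ r ∈ {r | rPlus a < r ∧ 0 ≤ ThetaStar a θ₀ r}, critFreq a r₀ θ₀ Ω r ≠ 0 :=
    fun r hr => (h.critFreq_pos hr.1 hr.2).ne'
  have hX : ContinuousOn (critX a r₀ θ₀ Ω) {r | rPlus a < r ∧ 0 ≤ ThetaStar a θ₀ r} :=
    (continuous_sqrt.comp_continuousOn h2).div (continuousOn_const.mul hq)
      fun r hr => mul_ne_zero hρ' (hq0 r hr)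
  have hY : ContinuousOn (critY a r₀ θ₀ Ω) {r | rPlus a < r ∧ 0 ≤ ThetaStar a θ₀ r} := by
    refine (ContinuousOn.div ?_ (continuousOn_const.mul hq) fun r hr =>
      mul_ne_zero (mul_ne_zero (mul_ne_zero hρ hs) hδ) (hq0 r hr)).neg
    unfold BBetaNum; fun_prop
  have hZ : ContinuousOn (critZ a r₀ θ₀ Ω) {r | rPlus a < r ∧ 0 ≤ ThetaStar a θ₀ r} := by
    have h3 : ContinuousOn (zFun a) {r | rPlus a < r ∧ 0 ≤ ThetaStar a θ₀ r} := by
      unfold zFun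
      refine ContinuousOn.mul (ContinuousOn.div (by fun_prop) (by fun_prop) fun r hr => ?_)
        (by fun_prop)
      have := mem_Ioi.1 (hsub hr)
      linarith
    refine ContinuousOn.div ?_ ((continuousOn_const.mul hq).mul continuousOn_const) fun r hr =>
      mul_ne_zero (mul_ne_zero hρ' (hq0 r hr)) hδ
    unfold critQuad
    fun_prop
  unfold critDir
  refine (PiLp.continuous_toLp 2 _).comp_continuousOn (continuousOn_pi.2 fun i => ?_)
  fin_cases i
  · exact continuousOn_const.mul hX
  · exact hY
  · exact hZ

theorem frontier_shadow_eq (h : IsObserver a r₀ θ₀ Ω) {φ₀ t₀ W : ℝ} (hW : 0 < W) {r₁ r₂ : ℝ}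
    (h1 : rPlus a < r₁) (h12 : r₁ < r₂) (hz1 : ThetaStar a θ₀ r₁ = 0)
    (hz2 : ThetaStar a θ₀ r₂ = 0) :
    frontier (shadow a r₀ θ₀ Ω φ₀ t₀ W) = {N | ∃ rc ∈ Icc r₁ r₂,
      N.1 = critDir a r₀ θ₀ Ω (-1) rc ∨ N.1 = critDir a r₀ θ₀ Ω 1 rc} := by
  have ha := h.a_pos
  have hs := h.sin_pos
  have hpos : ∀ r ∈ Ioo r₁ r₂, 0 < ThetaStar a θ₀ r := fun r hr =>
    ThetaStar_pos ha h.a_le hs h1 hz1 hz2 hr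
  have hsub : Icc r₁ r₂ ⊆ {r | rPlus a < r ∧ 0 ≤ ThetaStar a θ₀ r} :=
    ThetaStar_nonneg ha h.a_le hs h1 hz1 hz2
  have hext : a = 1 → 2 * sin θ₀ < 1 + cos θ₀ ^ 2 := by
    rintro rfl
    exact two_mul_sin_lt_of_zeros hs h1 h12 hz1 hz2
  -- At the endpoints `N₁ = 0` and the rotation argument fails. They are reached as limits along the
  -- continuous curve, since the frontier is closed.
  have hclosed : IsClosed (Subtype.val '' frontier (shadow a r₀ θ₀ Ω φ₀ t₀ W)) :=
    Metric.isClosed_sphere.isClosedEmbedding_subtypeVal.isClosedMap _ isClosed_frontier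
  have hcurve : ∀ {σ : ℝ}, σ ^ 2 = 1 → ∀ r ∈ Icc r₁ r₂,
      critDir a r₀ θ₀ Ω σ r ∈ Subtype.val '' frontier (shadow a r₀ θ₀ Ω φ₀ t₀ W) := by
    intro σ hσ r hr
    have hIoo : critDir a r₀ θ₀ Ω σ '' Ioo r₁ r₂ ⊆
        Subtype.val '' frontier (shadow a r₀ θ₀ Ω φ₀ t₀ W) := by
      rintro _ ⟨q, hq, rfl⟩
      have hq1 := h1.trans hq.1
      have hq2 := hpos q hq
      refine ⟨⟨_, h.critDir_mem hσ hq1 hq2.le⟩, ?_, rfl⟩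
      refine h.mem_frontier_of_isCritical hW (h.isCritical_of_eq_critDir hW hq1 hq2.le rfl) ?_
      have hx : critX a r₀ θ₀ Ω q ≠ 0 := by
        rw [Ne, h.critX_eq_zero_iff hq1 hq2.le]; exact hq2.ne'
      have hσ0 : σ ≠ 0 := by rintro rfl; norm_num at hσ
      simpa [critDir] using ⟨hσ0, hx⟩
    have hcont : ContinuousOn (critDir a r₀ θ₀ Ω σ) (closure (Ioo r₁ r₂)) := by
      rw [closure_Ioo h12.ne]
      exact (h.continuousOn_critDir σ).mono hsub
    refine closure_minimal hIoo hclosed (hcont.image_closure ?_)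
    rw [closure_Ioo h12.ne]
    exact mem_image_of_mem _ hr
  ext N
  constructor
  · intro hN
    obtain ⟨rc, hc⟩ := h.exists_isCritical_of_mem_frontier hW hext hN
    obtain ⟨hΘ, hN'⟩ := h.eq_critDir_of_isCritical hW hc
    exact ⟨rc, mem_Icc_of_ThetaStar_nonneg ha h.a_le hs h1 h12 hz1 hz2 hc.1.gt hΘ, hN'⟩
  · rintro ⟨rc, hrc, hN | hN⟩
    · obtain ⟨M, hM, hMN⟩ := hcurve (σ := -1) (by norm_num) rc hrc
      rwa [Subtype.ext (hMN.trans hN.symm)] at hM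
    · obtain ⟨M, hM, hMN⟩ := hcurve (σ := 1) (by norm_num) rc hrc
      rwa [Subtype.ext (hMN.trans hN.symm)] at hM

theorem curveFront_eq (h : IsObserver a r₀ θ₀ Ω) {I : Set ℝ}
    (hI : ∀ rc ∈ I, rPlus a < rc ∧ 0 ≤ ThetaStar a θ₀ rc ∧ rc ≤ r₀) :
    curveFront a r₀ θ₀ Ω I =
      {N | ∃ rc ∈ I, N.1 = critDir a r₀ θ₀ Ω (-1) rc ∨ N.1 = critDir a r₀ θ₀ Ω 1 rc} := by
  have hd := fun rc hrc => h.direction_eq (hI rc hrc).1 (hI rc hrc).2.1 (hI rc hrc).2.2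
  ext N
  simp only [curveFront, mem_union, mem_ofPred_eq]
  rw [← exists_or]
  refine exists_congr fun rc => ?_
  rw [← and_or_left]
  refine and_congr_right fun hrc => ?_
  rw [(hd rc hrc).1, (hd rc hrc).2]

theorem curveBack_eq (h : IsObserver a r₀ θ₀ Ω) {I : Set ℝ}
    (hI : ∀ rc ∈ I, rPlus a < rc ∧ 0 ≤ ThetaStar a θ₀ rc ∧ r₀ ≤ rc) :
    curveBack a r₀ θ₀ Ω I =
      {N | ∃ rc ∈ I, N.1 = critDir a r₀ θ₀ Ω (-1) rc ∨ N.1 = critDir a r₀ θ₀ Ω 1 rc} := by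
  have hd := fun rc hrc => h.direction_pi_sub_eq (hI rc hrc).1 (hI rc hrc).2.1 (hI rc hrc).2.2
  ext N
  simp only [curveBack, mem_union, mem_ofPred_eq]
  rw [← exists_or]
  refine exists_congr fun rc => ?_
  rw [← and_or_left]
  refine and_congr_right fun hrc => ?_
  rw [(hd rc hrc).1, (hd rc hrc).2]

end IsObserver

end KerrShadow

end

theorem mainTheorem1 (a r₀ θ₀ Ω φ₀ t₀ W : ℝ) (ha₀ : 0 < a) (ha₁ : a ≤ 1)
    (hr₀ : rPlus a < r₀) (hθ₀ : θ₀ ∈ Ioo 0 π)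
    (hΩ : Ω ∈ Ioo (OmegaMinus a r₀ θ₀) (OmegaPlus a r₀ θ₀)) (hW : 0 < W) :
    (a < 1 → ∃ r₁s r₂s : ℝ, rPlus a < r₁s ∧ r₁s < r₂s ∧
      ThetaStar a θ₀ r₁s = 0 ∧ ThetaStar a θ₀ r₂s = 0) ∧
    ∀ r₁s r₂s : ℝ, rPlus a < r₁s → r₁s < r₂s →
      ThetaStar a θ₀ r₁s = 0 → ThetaStar a θ₀ r₂s = 0 →
      ({rc : ℝ | rPlus a < rc ∧ ThetaStar a θ₀ rc = 0} = {r₁s, r₂s} ∧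
        rOne a ≤ r₁s ∧ r₂s ≤ rTwo a) ∧
      (r₂s < r₀ →
        frontier (shadow a r₀ θ₀ Ω φ₀ t₀ W) = curveFront a r₀ θ₀ Ω (Icc r₁s r₂s)) ∧
      (r₀ < r₁s →
        frontier (shadow a r₀ θ₀ Ω φ₀ t₀ W) = curveBack a r₀ θ₀ Ω (Icc r₁s r₂s)) ∧
      (r₁s ≤ r₀ → r₀ ≤ r₂s →
        frontier (shadow a r₀ θ₀ Ω φ₀ t₀ W) =
          curveFront a r₀ θ₀ Ω (Icc r₁s r₀) ∪ curveBack a r₀ θ₀ Ω (Ioc r₀ r₂s)) := by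
  have h : IsObserver a r₀ θ₀ Ω := ⟨ha₀, ha₁, hr₀, hθ₀, hΩ⟩
  have hs := h.sin_pos
  refine ⟨fun ha => exists_zeros_ThetaStar ha₀ ha hs, fun r₁ r₂ h1 h12 hz1 hz2 => ?_⟩
  have h2 := h1.trans h12
  have hΘ := ThetaStar_nonneg ha₀ ha₁ hs h1 hz1 hz2
  have hfr := h.frontier_shadow_eq (φ₀ := φ₀) (t₀ := t₀) hW h1 h12 hz1 hz2
  refine ⟨⟨zeros_ThetaStar ha₀ ha₁ hs h1 h12 hz1 hz2,
    rOne_le_of_cubic_le ha₀.le ha₁ (one_lt_of_rPlus_lt h1)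
      (cubic_le_of_ThetaStar_nonneg ha₀ hs h1 hz1.ge),
    le_rTwo_of_cubic_le ha₀.le ha₁ (cubic_le_of_ThetaStar_nonneg ha₀ hs h2 hz2.ge)⟩,
    fun hr => ?_, fun hr => ?_, fun hr1 hr2 => ?_⟩
  · rw [hfr, h.curveFront_eq fun r hr' => ⟨(hΘ r hr').1, (hΘ r hr').2, hr'.2.trans hr.le⟩]
  · rw [hfr, h.curveBack_eq fun r hr' => ⟨(hΘ r hr').1, (hΘ r hr').2, hr.le.trans hr'.1⟩]
  · have hl : ∀ r ∈ Icc r₁ r₀, r ∈ Icc r₁ r₂ := fun r hr => ⟨hr.1, hr.2.trans hr2⟩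
    have hu : ∀ r ∈ Ioc r₀ r₂, r ∈ Icc r₁ r₂ := fun r hr => ⟨hr1.trans hr.1.le, hr.2⟩
    -- The parameter interval splits at `r₀`, where `N₃` changes sign.
    rw [hfr,
      h.curveFront_eq fun r hr => ⟨(hΘ r (hl r hr)).1, (hΘ r (hl r hr)).2, hr.2⟩,
      h.curveBack_eq fun r hr => ⟨(hΘ r (hu r hr)).1, (hΘ r (hu r hr)).2, hr.1.le⟩,
      ← Icc_union_Ioc_eq_Icc hr1 hr2]
    ext N
    simp only [mem_union, mem_ofPred_eq, or_and_right, exists_or]
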